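/- **Setting.** Let $f_1,\dots,f_K:\mathbb R^{D\times d}\to\mathbb R$ be differentiable local error functions of $K$ devices and $F=\frac1K\sum_k f_k$ the global error function. $F$ is $C^2$ with $|F|\le B$, $\|\nabla F\|\le C$, $\nabla F$ $\beta$-Lipschitz and Hessian $\nabla^2F$ $\chi$-Lipschitz. For $\varepsilon,\gamma>0$ the saddle region is $\mathcal R_{\rm sa}=\{W:\|\nabla F(W)\|<\varepsilon,\ \lambda_{\min}(\nabla^2F(W))\le-\gamma\}$. Matrices are vectorized into $c=Dd/2$ complex symbols; write $g_k,g$ for the vectorized gradients of $f_k,F$. The data noise $\Delta_k=g_k-g$ (which averages to $0$ over the devices) satisfies $\frac1K\sum_k\Delta_k\Delta_k^H\preceq\kappa^2 I$ at every $W$. In round $m$ all devices transmit the symbols $([g_k(W_m)]_i-\eta)/\nu$ simultaneously, the $i$-th one on a sub-channel with gains $h_{k,m}^{(i)}\sim\mathcal{CN}(0,1)$, independent over devices, sub-channels and rounds. Device $k$ precodes by $\sqrt{P^{\rm rx}_m}/h_{k,m}^{(i)}$ if $|h_{k,m}^{(i)}|^2\ge G$ and is silent otherwise; $\zeta=\Pr(|h_{k,m}^{(i)}|^2\ge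 G)$, and the number $K_m^{(i)}$ of active devices on each sub-channel is conditioned to be nonzero. The server receives the superposed symbols plus independent noise $z_m^{(i)}\sim\mathcal{CN}(0,\sigma^2)$, $\sigma>0$, multiplies by $\nu/(K_m^{(i)}\sqrt{P^{\rm rx}_m})$, adds $\eta$, and uses the resulting noisy gradient $\widehat g(W_m)$ in the update $W_{m+1}=W_m-\mu\,\widehat g(W_m)$. **Theorem (Descent speed in a saddle region).** Let $0<P_{\min}\le P_{\max}$ and put $$\mathcal V_{\max}=\frac{\kappa^2}{K\zeta}+\frac{3\nu^2\sigma^2}{K^2\zeta^2P_{\min}},\qquad \mathcal V_{\min}=\frac{\nu^2\sigma^2}{K^2P_{\max}},\qquad N_{\max}=\frac1{2\mu\gamma}\log\Bigl(6c\,\frac{\mathcal V_{\max}}{\mathcal V_{\min}}+1\Bigr).$$ For every horizon $T$ there is $\delta>0$, depending only on $T$ and the constants $D,d,c,K,B,C,\beta,\chi,\varepsilon,\gamma,G,\kappa,\nu,\sigma,P_{\min},P_{\max}$ and the number of sub-channels (not on the $f_k$, the starting point, $\mu$, $n$ or the powers), such that the following holds. If $W_0\in\mathcal R_{\rm sa}$,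 $0<\mu\le\delta/(c\mathcal V_{\max})$, $n>N_{\max}$, $n\mu\le T$ and $P^{\rm rx}_0,\dots,P^{\rm rx}_{n-1}\in[P_{\min},P_{\max}]$, then $F(W_0)-F(W_n)$ is integrable and $$\mathsf E[F(W_0)-F(W_n)]\ \ge\ \frac\mu4\left[\frac{\kappa^2}{K\zeta}+\mu\gamma\sum_{0\le m\le n-N_{\max}-1}\frac{(1+\mu\gamma)^{2(n-m-1)}\nu^2\sigma^2}{K^2P^{\rm rx}_m}+\frac{3\nu^2\sigma^2}{K^2\zeta^2P_{\min}}\right].$$ -/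

import Mathlib

open MeasureTheory ProbabilityTheory
open scoped NNReal ComplexOrder

namespace AirPCA

noncomputable section

/-! ### Objective functions and the saddle region -/

/-- Real `D × d` matrices with the Frobenius inner product. -/
abbrev Mat (D d : ℕ) : Type := EuclideanSpace ℝ (Fin D × Fin d)

/-- The global error function, the average of the local error functions of the `K` devices. -/
def globalObjective {D d K : ℕ} (f : Fin K → Mat D d → ℝ) (W : Mat D d) : ℝ :=
  (K : ℝ)⁻¹ * ∑ k, f k W

/-- The Hessian, as the derivative of the gradient field. -/
def hessian {D d : ℕ} (F : Mat D d → ℝ) (W : Mat D d) : Mat D d →L[ℝ] Mat D d :=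
  fderiv ℝ (gradient F) W

/-- The smallest eigenvalue of the Hessian. -/
def hessianMinEigenvalue {D d : ℕ} (F : Mat D d → ℝ) (W : Mat D d) : ℝ :=
  sInf {l : ℝ | Module.End.HasEigenvalue (hessian F W : Mat D d →ₗ[ℝ] Mat D d) l}

/-- The saddle region: small gradient, and a Hessian whose least eigenvalue is at most `-γ`. -/
def saddleRegion {D d : ℕ} (F : Mat D d → ℝ) (ε γ : ℝ) : Set (Mat D d) :=
  {W | ‖gradient F W‖ < ε ∧ hessianMinEigenvalue F W ≤ -γ}

/-- The regularity assumptions on the error function: twice differentiability, boundedness of the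
function and of its gradient, smoothness, and Lipschitz continuity of the Hessian. -/
structure IsRegularObjective {D d : ℕ} (F : Mat D d → ℝ) (B C β χ : ℝ) : Prop where
  contDiff : ContDiff ℝ 2 F
  bounded : ∀ W, |F W| ≤ B
  gradient_bounded : ∀ W, ‖gradient F W‖ ≤ C
  smooth : ∀ W₁ W₂, ‖gradient F W₁ - gradient F W₂‖ ≤ β * ‖W₁ - W₂‖
  hessian_lipschitz : ∀ W₁ W₂, ‖hessian F W₁ - hessian F W₂‖ ≤ χ * ‖W₁ - W₂‖

/-! ### Complex vectorization of real matrices -/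

/-- Complex vectorization: `e` pairs the `D * d = 2 * c` real entries into the real and imaginary
parts of `c` complex symbols. -/
def vec {D d c : ℕ} (e : Fin D × Fin d ≃ Fin c × Fin 2) (V : Mat D d) : Fin c → ℂ :=
  fun i => ⟨V (e.symm (i, 0)), V (e.symm (i, 1))⟩

/-- The inverse of `vec`. -/
def devec {D d c : ℕ} (e : Fin D × Fin d ≃ Fin c × Fin 2) (u : Fin c → ℂ) : Mat D d :=
  WithLp.toLp 2 fun p => if (e p).2 = 0 then (u (e p).1).re else (u (e p).1).im

/-- The data noise of device `k`: local minus global (vectorized) gradient. -/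
def dataNoise {D d c K : ℕ} (e : Fin D × Fin d ≃ Fin c × Fin 2) (f : Fin K → Mat D d → ℝ)
    (W : Mat D d) (k : Fin K) : Fin c → ℂ :=
  vec e (gradient (f k) W) - vec e (gradient (globalObjective f) W)

/-- `𝔼[Δ Δᴴ] ≤ κ² I` in the Loewner order, the mean being taken over the devices.
The companion property `𝔼[Δ] = 0` is automatic, the global objective being the average. -/
def DataNoiseBound {D d c K : ℕ} (e : Fin D × Fin d ≃ Fin c × Fin 2)
    (f : Fin K → Mat D d → ℝ) (κ : ℝ) : Prop :=
  ∀ W, (((κ : ℂ) ^ 2) • (1 : Matrix (Fin c) (Fin c) ℂ) -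
    (K : ℂ)⁻¹ • ∑ k, Matrix.vecMulVec (dataNoise e f W k) (star (dataNoise e f W k))).PosSemidef

/-! ### The channel -/

/-- The circularly symmetric complex Gaussian law `𝒞𝒩(0, v)`. -/
def complexGaussian (v : ℝ≥0) : Measure ℂ :=
  ((gaussianReal 0 (v / 2)).prod (gaussianReal 0 (v / 2))).map
    Complex.measurableEquivRealProd.symm

/-- The devices that are not truncated, given the gains `h` of one sub-channel. -/
def activeSet {K : ℕ} (G : ℝ) (h : Fin K → ℂ) : Finset (Fin K) :=
  {k | G ≤ ‖h k‖ ^ 2}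

/-- The activation probability `Pr(|h|² ≥ G)` for `h ∼ 𝒞𝒩(0, 1)`. -/
def activationProb (G : ℝ) : ℝ :=
  (complexGaussian 1).real {h | G ≤ ‖h‖ ^ 2}

/-- The law of the gains of one sub-channel: independent `𝒞𝒩(0, 1)` gains for the `K` devices,
conditioned on at least one device being active (so that the server can normalize by the number of
active devices). -/
def gainLaw (K : ℕ) (G : ℝ) : Measure (Fin K → ℂ) :=
  ProbabilityTheory.cond (Measure.pi fun _ : Fin K => complexGaussian 1)
    {h | (activeSet G h).Nonempty}

/-- The law of gains and receiver noise in one round: independent sub-channels, and independent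
`𝒞𝒩(0, σ²)` noise on each of the `c` received symbols. -/
def roundLaw (K M c : ℕ) (G : ℝ) (σ : ℝ≥0) : Measure ((Fin M → Fin K → ℂ) × (Fin c → ℂ)) :=
  (Measure.pi fun _ : Fin M => gainLaw K G).prod
    (Measure.pi fun _ : Fin c => complexGaussian (σ ^ 2))

/-- Truncated channel inversion with receive power `p` and truncation threshold `G`. -/
def precoder (G p : ℝ) (h : ℂ) : ℂ := by
  classical exact if G ≤ ‖h‖ ^ 2 then (Real.sqrt p : ℂ) / h else 0

/-- The over-the-air received symbol: superposition of the precoded symbols `s k` sent through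
the gains `h k`, plus noise `z`. -/
def receivedSymbol {K : ℕ} (G p : ℝ) (h s : Fin K → ℂ) (z : ℂ) : ℂ :=
  ∑ k, h k * precoder G p (h k) * s k + z

/-- The global gradient as obtained by the server at `W`. Every gradient element is normalized to
`(g - η) / ν`, sent over the sub-channel `sub i`, received in superposition, and de-normalized by
the number of active devices. -/
def receivedGradient {D d c K M : ℕ} (e : Fin D × Fin d ≃ Fin c × Fin 2) (sub : Fin c → Fin M)
    (f : Fin K → Mat D d → ℝ) (G ν : ℝ) (η : ℂ) (p : ℝ)
    (h : Fin M → Fin K → ℂ) (z : Fin c → ℂ) (W : Mat D d) : Mat D d :=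
  devec e fun i =>
    ((activeSet G (h (sub i))).card : ℂ)⁻¹ * ((ν : ℂ) / (Real.sqrt p : ℂ)) *
      receivedSymbol G p (h (sub i)) (fun k => (vec e (gradient (f k) W) i - η) / (ν : ℂ)) (z i)
    + η

/-- The iterates of AirPCA from `W₀`, with step size `μ`, receive power `p m`, gains `h m` and
receiver noise `z m` in round `m`. -/
def state {D d c K M : ℕ} (e : Fin D × Fin d ≃ Fin c × Fin 2) (sub : Fin c → Fin M)
    (f : Fin K → Mat D d → ℝ) (G ν : ℝ) (η : ℂ) (μ : ℝ) (p : ℕ → ℝ) (W₀ : Mat D d)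
    (h : ℕ → Fin M → Fin K → ℂ) (z : ℕ → Fin c → ℂ) : ℕ → Mat D d
  | 0 => W₀
  | m + 1 =>
      state e sub f G ν η μ p W₀ h z m -
        μ • receivedGradient e sub f G ν η (p m) (h m) (z m)
          (state e sub f G ν η μ p W₀ h z m)

/-! ### The constants of the bound -/

/-- `𝒱_max`. -/
def Vmax (K : ℕ) (ζ κ ν σ Pmin : ℝ) : ℝ :=
  κ ^ 2 / (K * ζ) + 3 * ν ^ 2 * σ ^ 2 / ((K : ℝ) ^ 2 * ζ ^ 2 * Pmin)

/-- `𝒱_min`. -/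
def Vmin (K : ℕ) (ν σ Pmax : ℝ) : ℝ :=
  ν ^ 2 * σ ^ 2 / ((K : ℝ) ^ 2 * Pmax)

/-- `N_max`. -/
def Nmax (K c : ℕ) (ζ κ ν σ Pmin Pmax γ μ : ℝ) : ℝ :=
  1 / (2 * μ * γ) * Real.log (6 * c * (Vmax K ζ κ ν σ Pmin / Vmin K ν σ Pmax) + 1)

/-- The lower bound on the expected error reduction over `n` rounds. The sum runs over the
natural numbers `m ≤ n - N_max - 1`. -/
def reductionBound (K c : ℕ) (ζ κ ν σ Pmin Pmax γ μ : ℝ) (p : ℕ → ℝ) (n : ℕ) : ℝ :=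
  μ / 4 * (κ ^ 2 / (K * ζ) +
    μ * γ * ∑ m ∈ Finset.range ⌊(n : ℝ) - Nmax K c ζ κ ν σ Pmin Pmax γ μ⌋₊,
      (1 + μ * γ) ^ (2 * (n - m - 1)) * ν ^ 2 * σ ^ 2 / ((K : ℝ) ^ 2 * p m) +
    3 * ν ^ 2 * σ ^ 2 / ((K : ℝ) ^ 2 * ζ ^ 2 * Pmin))

end

end AirPCA

/-! The received gradient is the true gradient plus a noise that is centred given the past, because
the data noises sum to zero over the devices and the set of active devices is exchangeable. Its
fourth moment is bounded uniformly in the iterate (`norm_gradientNoise_le`). Write N = ν²σ² and let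
y be the second moment of the inverse number of active devices. The noise variance in every unit
direction lies between y·N/(2p) and y·(Kκ² + N/(2p)) (`integral_inner_canonicalNoise_sq_mem_Icc`).
The value of y is never computed: it is a factor of both bounds, and only 1/K² ≤ y ≤ 1 is used.

What remains concerns noisy gradient descent (`IsNoisyDescent`) over a time nμ between T₀ = log
L/(2γ) and T, where L is the argument of the logarithm in `Nmax`. The claimed reduction is at most
Rμ for a constant R (`reductionBound_le`). This gives a dichotomy (`descent_or_displacement_le`). If
μ times the accumulated expected squared gradients exceeds a large multiple of μ, the descent lemma
alone yields the decrease Rμ. Otherwise the second moment of the displacement is O(μ). As the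
elapsed time is at least T₀, this forces the squared initial gradient to be O(μ), and then the
fourth moment of the displacement is O(μ²).

In that second regime the objective is replaced by its quadratic Taylor polynomial at the start, at
a cost O(μ^{3/2}), and the polynomial splits along an eigenbasis of the Hessian
(`integral_objective_le_sum_eigenvalues`). In a direction of eigenvalue l, the expected
one-dimensional polynomial obeys a linear recursion with factor (1 - μl)² and source lμ²/2 times the
noise variance (`integral_coordinate_succ_le`). For l > 0 the geometric series adds up to about μ/4
times the variance at most, whatever l is (`sum_contracting_le`). For l ≤ -γ the sources are
negative and are amplified exponentially (`sum_expanding_le`).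

`sum_eigenvalues_le_neg_reductionBound` balances these contributions. With Y = yK² ≥ 1 and up to the
factor μ/4, the final rounds of the unstable direction, at least N_max in number, are worth
3cY·V_max to leading order. This pays (2c - 1)Y·V_max for the other directions and leaves (c +
1)Y·V_max ≥ 2V_max, while the earlier rounds give the sum in the bound. One V_max belongs to the
bound, and the other absorbs the O(μ^{3/2}) errors once μ is small (`error_terms_le`). -/

namespace AirPCA

/-! ### Taylor estimates from Lipschitz derivatives -/

section Taylor

/-- Mean value inequality on the ball of radius ‖x‖, where the derivative differs from its value at
the centre by at most χ‖x‖. The factor 1/2 of the integral remainder is given up, which is harmless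
below. -/
lemma norm_sub_sub_fderiv_le {E E' : Type*} [NormedAddCommGroup E] [NormedSpace ℝ E]
    [NormedAddCommGroup E'] [NormedSpace ℝ E'] {g : E → E'} {χ : ℝ} (hχ : 0 ≤ χ) (hg : Differentiable ℝ g)
    (hL : ∀ x y, ‖fderiv ℝ g x - fderiv ℝ g y‖ ≤ χ * ‖x - y‖) (w x : E) :
    ‖g (w + x) - g w - fderiv ℝ g w x‖ ≤ χ * ‖x‖ ^ 2 := by
  have h := (convex_closedBall w ‖x‖).norm_image_sub_le_of_norm_hasFDerivWithin_le'
    (f := g) (f' := fderiv ℝ g) (φ := fderiv ℝ g w) (C := χ * ‖x‖)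
    (fun z _ => (hg z).hasFDerivAt.hasFDerivWithinAt)
    (fun z hz => (hL z w).trans (by
      rw [Metric.mem_closedBall, dist_eq_norm] at hz
      gcongr)) (x := w) (y := w + x) (by simp) (by simp)
  simpa [pow_two, mul_assoc] using h

variable {E : Type*} [NormedAddCommGroup E] [InnerProductSpace ℝ E] [CompleteSpace E]

lemma abs_sub_le_of_hasGradientAt {G : E → ℝ} {r : E → E} {M : ℝ} (x : E)
    (hG : ∀ z, HasGradientAt G (r z) z) (hr : ∀ z, ‖z‖ ≤ ‖x‖ → ‖r z‖ ≤ M) :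
    |G x - G 0| ≤ M * ‖x‖ := by
  have h := (convex_closedBall (0 : E) ‖x‖).norm_image_sub_le_of_norm_hasFDerivWithin_le
    (f := G) (C := M) (fun z _ => (hG z).hasFDerivAt.hasFDerivWithinAt)
    (fun z hz => by
      rw [LinearIsometryEquiv.norm_map]
      exact hr z (by simpa using hz)) (x := 0) (y := x) (by simp) (by simp)
  simpa using h

/-- After subtraction of the linear part, the gradient is at most β‖x‖ on the relevant ball, so the
mean value inequality applies. -/
lemma le_add_inner_add_of_gradient_lipschitz {F : E → ℝ} {g : E → E} {β : ℝ} (hβ : 0 ≤ β)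
    (hF : ∀ w, HasGradientAt F (g w) w) (hL : ∀ v w, ‖g v - g w‖ ≤ β * ‖v - w‖) (w x : E) :
    F (w + x) ≤ F w + inner ℝ (g w) x + β * ‖x‖ ^ 2 := by
  have hG : ∀ z, HasGradientAt (fun z => F (w + z) - inner ℝ (g w) z) (g (w + z) - g w) z := by
    intro z
    rw [hasGradientAt_iff_hasFDerivAt, map_sub]
    have h1 : HasFDerivAt (fun z => F (w + z)) (InnerProductSpace.toDual ℝ E (g (w + z))) z := by
      have := (hF (w + z)).hasFDerivAt
      exact (hasFDerivAt_comp_add_left w).2 this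
    exact h1.sub (InnerProductSpace.toDual ℝ E (g w)).hasFDerivAt
  have h := abs_sub_le_of_hasGradientAt (M := β * ‖x‖) x hG (fun z hz => by
    refine (hL _ _).trans ?_
    rw [add_sub_cancel_left]
    gcongr)
  have := (abs_le.1 h).2
  simp only [add_zero, inner_zero_right, sub_zero] at this
  nlinarith

lemma le_second_order_taylor {F : E → ℝ} {g : E → E} {H : E →L[ℝ] E} {χ : ℝ} (hχ : 0 ≤ χ) {w : E}
    (hF : ∀ w, HasGradientAt F (g w) w) (hH : ∀ x y, inner ℝ (H x) y = inner ℝ x (H y))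
    (hL : ∀ x, ‖g (w + x) - g w - H x‖ ≤ χ * ‖x‖ ^ 2) (x : E) :
    F (w + x) ≤ F w + (inner ℝ (g w) x + inner ℝ x (H x) / 2) + χ * ‖x‖ ^ 3 := by
  have hG : ∀ z, HasGradientAt (fun z => F (w + z) - inner ℝ (g w) z - inner ℝ z (H z) / 2)
      (g (w + z) - g w - H z) z := by
    intro z
    rw [hasGradientAt_iff_hasFDerivAt, map_sub, map_sub]
    have h1 : HasFDerivAt (fun z => F (w + z)) (InnerProductSpace.toDual ℝ E (g (w + z))) z := by
      have := (hF (w + z)).hasFDerivAt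
      exact (hasFDerivAt_comp_add_left w).2 this
    -- Symmetry of H is what makes H z the gradient of the quadratic form.
    have h2 : HasFDerivAt (fun z => inner ℝ z (H z) / 2) (InnerProductSpace.toDual ℝ E (H z)) z := by
      have := ((hasFDerivAt_id z).inner ℝ H.hasFDerivAt).mul_const (2⁻¹ : ℝ)
      refine this.congr_fderiv ?_
      ext y
      simp [real_inner_comm y (H z), ← hH z y]
      ring
    exact (h1.sub (InnerProductSpace.toDual ℝ E (g w)).hasFDerivAt).sub h2
  have h := abs_sub_le_of_hasGradientAt (M := χ * ‖x‖ ^ 2) x hG (fun z hz => by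
    refine (hL _).trans ?_
    gcongr)
  have := (abs_le.1 h).2
  simp only [add_zero, inner_zero_right, sub_zero, map_zero, zero_div] at this
  nlinarith

end Taylor

/-! ### Discrete Grönwall inequalities -/

section Gronwall

lemma le_sum_pow_mul_of_le_mul_add {a b : ℕ → ℝ} {r : ℝ} (hr : 0 ≤ r) (h0 : a 0 ≤ 0)
    (h : ∀ m, a (m + 1) ≤ r * a m + b m) (n : ℕ) :
    a n ≤ ∑ m ∈ Finset.range n, r ^ (n - 1 - m) * b m := by
  induction n with
  | zero => simpa using h0
  | succ k ih =>
    refine (h k).trans ?_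
    rw [Finset.sum_range_succ]
    have : ∑ m ∈ Finset.range k, r ^ (k + 1 - 1 - m) * b m
        = r * ∑ m ∈ Finset.range k, r ^ (k - 1 - m) * b m := by
      rw [Finset.mul_sum]
      refine Finset.sum_congr rfl fun m hm => ?_
      rw [Finset.mem_range] at hm
      rw [show k + 1 - 1 - m = (k - 1 - m) + 1 by omega, pow_succ]
      ring
    rw [this]
    have := mul_le_mul_of_nonneg_left ih hr
    simpa using this

/-- Over a time nμ ≤ T every power of the growth factor is at most exp(ρT), a constant independent
of the step size. -/
lemma le_exp_mul_sum_of_le_mul_add {a b : ℕ → ℝ} {r ρ μ T : ℝ} (hr : 0 ≤ r) (hρ : 0 ≤ ρ)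
    (hrρ : r ≤ Real.exp (ρ * μ)) (hμ : 0 ≤ μ) (hb : ∀ m, 0 ≤ b m)
    (h0 : a 0 ≤ 0) (h : ∀ m, a (m + 1) ≤ r * a m + b m) {n : ℕ} (hn : n * μ ≤ T) :
    a n ≤ Real.exp (ρ * T) * ∑ m ∈ Finset.range n, b m := by
  refine (le_sum_pow_mul_of_le_mul_add hr h0 h n).trans ?_
  rw [Finset.mul_sum]
  refine Finset.sum_le_sum fun m _ => mul_le_mul_of_nonneg_right ?_ (hb m)
  calc r ^ (n - 1 - m) ≤ Real.exp (ρ * μ) ^ (n - 1 - m) := by gcongr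
    _ = Real.exp (((n - 1 - m : ℕ) : ℝ) * (ρ * μ)) := by rw [Real.exp_nat_mul]
    _ ≤ Real.exp (ρ * T) := by
      refine Real.exp_le_exp.2 ?_
      have h1 : ((n - 1 - m : ℕ) : ℝ) ≤ n := by exact_mod_cast (by omega)
      calc ((n - 1 - m : ℕ) : ℝ) * (ρ * μ) ≤ n * (ρ * μ) := by gcongr
        _ = ρ * (n * μ) := by ring
        _ ≤ ρ * T := by gcongr

end Gronwall

lemma add_mul_sq_le {x y μ : ℝ} (hμ : 0 ≤ μ) : (x + μ * y) ^ 2 ≤ (1 + μ) * (x ^ 2 + μ * y ^ 2) := by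
  nlinarith [mul_nonneg hμ (sq_nonneg (x - y))]

/-- Convexity of the square with weights 1 and μ, used twice. -/
lemma add_mul_pow_four_le {x y μ : ℝ} (hμ : 0 ≤ μ) :
    (x + μ * y) ^ 4 ≤ (1 + μ) ^ 3 * (x ^ 4 + μ * y ^ 4) := by
  have h1 := add_mul_sq_le (x := x) (y := y) hμ
  have h2 := add_mul_sq_le (x := x ^ 2) (y := y ^ 2) hμ
  calc (x + μ * y) ^ 4 = ((x + μ * y) ^ 2) ^ 2 := by ring
    _ ≤ ((1 + μ) * (x ^ 2 + μ * y ^ 2)) ^ 2 := by gcongr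
    _ = (1 + μ) ^ 2 * (x ^ 2 + μ * y ^ 2) ^ 2 := by ring
    _ ≤ (1 + μ) ^ 2 * ((1 + μ) * ((x ^ 2) ^ 2 + μ * (y ^ 2) ^ 2)) := by gcongr
    _ = _ := by ring

/-! ### Integrability of mixed moments up to order four -/

section Moments

variable {Ω E : Type*} {mΩ : MeasurableSpace Ω} {P : Measure Ω} [IsFiniteMeasure P]
  [NormedAddCommGroup E]

/-- Both factors are replaced by the larger one. This domination makes every mixed moment below
integrable from fourth moments alone. -/
lemma pow_mul_pow_le_one_add {x y : ℝ} (hx : 0 ≤ x) (hy : 0 ≤ y) {i j : ℕ} (hij : i + j ≤ 4) :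
    x ^ i * y ^ j ≤ 1 + x ^ 4 + y ^ 4 := by
  have key : ∀ z : ℝ, 0 ≤ z → z ^ (i + j) ≤ 1 + z ^ 4 := by
    intro z hz
    rcases le_total z 1 with h | h
    · have := pow_le_one₀ hz h (n := i + j)
      have := pow_nonneg hz 4
      linarith
    · have := pow_le_pow_right₀ h hij
      linarith
  have hx4 := pow_nonneg hx 4
  have hy4 := pow_nonneg hy 4
  rcases le_total x y with h | h
  · have h1 : x ^ i * y ^ j ≤ y ^ i * y ^ j := by gcongr
    rw [← pow_add] at h1
    linarith [key y hy]
  · have h1 : x ^ i * y ^ j ≤ x ^ i * x ^ j := by gcongr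
    rw [← pow_add] at h1
    linarith [key x hx]

lemma integrable_norm_pow_mul_norm_pow {X Y : Ω → E} (hX : MemLp X 4 P) (hY : MemLp Y 4 P)
    {i j : ℕ} (hij : i + j ≤ 4) : Integrable (fun ω => ‖X ω‖ ^ i * ‖Y ω‖ ^ j) P := by
  have h4 : ∀ {Z : Ω → E}, MemLp Z 4 P → Integrable (fun ω => ‖Z ω‖ ^ 4) P := fun hZ =>
    hZ.integrable_norm_pow (p := 4) (by norm_num)
  refine (((integrable_const (1 : ℝ)).add (h4 hX)).add (h4 hY)).mono'
    ((hX.1.norm.pow i).mul (hY.1.norm.pow j)) (.of_forall fun ω => ?_)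
  rw [Real.norm_of_nonneg (by positivity)]
  exact pow_mul_pow_le_one_add (norm_nonneg _) (norm_nonneg _) hij

lemma integrable_norm_pow_of_memLp_four {X : Ω → E} (hX : MemLp X 4 P) {i : ℕ} (hi : i ≤ 4) :
    Integrable (fun ω => ‖X ω‖ ^ i) P := by
  simpa using integrable_norm_pow_mul_norm_pow hX hX (i := i) (j := 0) (by simpa using hi)

lemma integrable_of_abs_le_norm_pow_mul {X Y : Ω → E} (hX : MemLp X 4 P) (hY : MemLp Y 4 P)
    {i j : ℕ} (hij : i + j ≤ 4) {f : Ω → ℝ} (hf : AEStronglyMeasurable f P) {c : ℝ}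
    (h : ∀ ω, |f ω| ≤ c * (‖X ω‖ ^ i * ‖Y ω‖ ^ j)) : Integrable f P :=
  ((integrable_norm_pow_mul_norm_pow hX hY hij).const_mul c).mono' hf (.of_forall h)

end Moments

/-! ### Noisy gradient descent: descent lemma and moments of the displacement -/

section Descent

set_option linter.unusedSectionVars false

variable {Ω E : Type*} {mΩ : MeasurableSpace Ω}
  [NormedAddCommGroup E] [InnerProductSpace ℝ E] [CompleteSpace E]

/-- Gradient descent on `F` from `w` with step size `μ` and a noise `ξ` that is centred given the
past and has fourth moments bounded by `q`. -/
structure IsNoisyDescent (F : E → ℝ) (g : E → E) (B C β μ q : ℝ) (w : E) (ℱ : Filtration ℕ mΩ)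
    (P : Measure Ω) (ξ W : ℕ → Ω → E) : Prop where
  hasGradientAt : ∀ v, HasGradientAt F (g v) v
  bounded : ∀ v, |F v| ≤ B
  gradient_le : ∀ v, ‖g v‖ ≤ C
  lipschitz : ∀ v v', ‖g v - g v'‖ ≤ β * ‖v - v'‖
  beta_nonneg : 0 ≤ β
  step_pos : 0 < μ
  step_le_one : μ ≤ 1
  start : ∀ ω, W 0 ω = w
  step : ∀ m ω, W (m + 1) ω = W m ω - μ • (g (W m ω) + ξ m ω)
  adapted : ∀ m, StronglyMeasurable[ℱ (m + 1)] (ξ m)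
  memLp : ∀ m, MemLp (ξ m) 4 P
  fourth_moment : ∀ m, ∫ ω, ‖ξ m ω‖ ^ 4 ∂P ≤ q
  centred : ∀ m (φ : Ω → E), StronglyMeasurable[ℱ m] φ →
    Integrable (fun ω => inner ℝ (φ ω) (ξ m ω)) P → ∫ ω, inner ℝ (φ ω) (ξ m ω) ∂P = 0

namespace IsNoisyDescent

variable {F : E → ℝ} {g : E → E} {B C β μ q : ℝ} {w : E} {ℱ : Filtration ℕ mΩ}
  {P : Measure Ω} [IsProbabilityMeasure P] {ξ W : ℕ → Ω → E}
  (h : IsNoisyDescent F g B C β μ q w ℱ P ξ W)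

include h

lemma continuous_gradient : Continuous g :=
  (LipschitzWith.of_dist_le_mul (K := β.toNNReal) fun v v' => by
    simpa [dist_eq_norm, Real.coe_toNNReal β h.beta_nonneg] using h.lipschitz v v').continuous

lemma stronglyMeasurable_iterate (m : ℕ) : StronglyMeasurable[ℱ m] (W m) := by
  induction m with
  | zero => rw [show W 0 = fun _ => w from funext h.start]; exact stronglyMeasurable_const
  | succ k ih =>
    rw [show W (k + 1) = fun ω => W k ω - μ • (g (W k ω) + ξ k ω) from funext (h.step k)]
    have hk : StronglyMeasurable[ℱ (k + 1)] (W k) := ih.mono (ℱ.mono k.le_succ)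
    exact hk.sub (((h.continuous_gradient.comp_stronglyMeasurable hk).add
      (h.adapted k)).const_smul μ)

lemma stronglyMeasurable_gradient (m : ℕ) : StronglyMeasurable[ℱ m] (fun ω => g (W m ω)) :=
  h.continuous_gradient.comp_stronglyMeasurable (h.stronglyMeasurable_iterate m)

lemma memLp_gradient (m : ℕ) : MemLp (fun ω => g (W m ω)) 4 P :=
  MemLp.of_bound ((h.stronglyMeasurable_gradient m).mono (ℱ.le m)).aestronglyMeasurable C
    (.of_forall fun _ => h.gradient_le _)

lemma memLp_displacement (m : ℕ) : MemLp (fun ω => W m ω - w) 4 P := by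
  induction m with
  | zero => simp [h.start]
  | succ k ih =>
    refine (ih.sub (((h.memLp_gradient k).add (h.memLp k)).const_smul μ)).congr_norm
      (((h.stronglyMeasurable_iterate (k + 1)).mono (ℱ.le _)).aestronglyMeasurable.sub
        aestronglyMeasurable_const) (.of_forall fun ω => ?_)
    simp only [h.step, Pi.sub_apply, Pi.smul_apply, Pi.add_apply]
    congr 1
    abel

lemma stronglyMeasurable_displacement (m : ℕ) : StronglyMeasurable[ℱ m] (fun ω => W m ω - w) :=
  (h.stronglyMeasurable_iterate m).sub stronglyMeasurable_const

lemma stronglyMeasurable_drift (m : ℕ) :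
    StronglyMeasurable[ℱ m] (fun ω => W m ω - w - μ • g (W m ω)) :=
  (h.stronglyMeasurable_displacement m).sub ((h.stronglyMeasurable_gradient m).const_smul μ)

lemma memLp_drift (m : ℕ) : MemLp (fun ω => W m ω - w - μ • g (W m ω)) 4 P :=
  (h.memLp_displacement m).sub ((h.memLp_gradient m).const_smul μ)

lemma displacement_succ (m : ℕ) (ω : Ω) :
    W (m + 1) ω - w = (W m ω - w - μ • g (W m ω)) - μ • ξ m ω := by
  rw [h.step, smul_add]; abel

lemma integrable_inner {φ : Ω → E} (hφ : MemLp φ 4 P) (m : ℕ) :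
    Integrable (fun ω => inner ℝ (φ ω) (ξ m ω)) P :=
  integrable_of_abs_le_norm_pow_mul hφ (h.memLp m) (i := 1) (j := 1) (by norm_num)
    (hφ.1.inner (h.memLp m).1) (c := 1) fun ω => by simpa using abs_real_inner_le_norm _ _

lemma integral_inner_eq_zero {φ : Ω → E} {m : ℕ} (hφm : StronglyMeasurable[ℱ m] φ)
    (hφ : MemLp φ 4 P) : ∫ ω, inner ℝ (φ ω) (ξ m ω) ∂P = 0 :=
  h.centred m φ hφm (h.integrable_inner hφ m)

lemma fourth_moment_nonneg : 0 ≤ q :=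
  (integral_nonneg fun ω => by positivity).trans (h.fourth_moment 0)

lemma integral_noise_sq_le (m : ℕ) : ∫ ω, ‖ξ m ω‖ ^ 2 ∂P ≤ 1 + q := by
  calc ∫ ω, ‖ξ m ω‖ ^ 2 ∂P ≤ ∫ ω, (1 + ‖ξ m ω‖ ^ 4) ∂P := by
        refine integral_mono (integrable_norm_pow_of_memLp_four (h.memLp m) (by norm_num))
          ((integrable_const 1).add (integrable_norm_pow_of_memLp_four (h.memLp m) le_rfl))
          fun ω => ?_
        nlinarith [sq_nonneg (‖ξ m ω‖ ^ 2 - 1)]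
    _ ≤ 1 + q := by
        rw [integral_add (integrable_const 1)
          (integrable_norm_pow_of_memLp_four (h.memLp m) le_rfl)]
        simpa using h.fourth_moment m

lemma integrable_objective (m : ℕ) : Integrable (fun ω => F (W m ω)) P := by
  have hc : Continuous F := continuous_iff_continuousAt.2 fun v => (h.hasGradientAt v).continuousAt
  exact (MemLp.of_bound (p := 1) (hc.comp_stronglyMeasurable
    ((h.stronglyMeasurable_iterate m).mono (ℱ.le m))).aestronglyMeasurable B
    (.of_forall fun ω => h.bounded _)).integrable le_rfl

/-- The term linear in the noise has mean zero, and βμ ≤ 1/2 lets half of the first-order decrease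
absorb the quadratic gradient term. -/
lemma integral_objective_succ_le (hβμ : β * μ ≤ 1 / 2) (m : ℕ) :
    ∫ ω, F (W (m + 1) ω) ∂P ≤ ∫ ω, F (W m ω) ∂P - μ / 2 * ∫ ω, ‖g (W m ω)‖ ^ 2 ∂P
      + β * μ ^ 2 * (1 + q) := by
  have hg := integrable_norm_pow_of_memLp_four (h.memLp_gradient m) (i := 2) (by norm_num)
  have hξ := integrable_norm_pow_of_memLp_four (h.memLp m) (i := 2) (by norm_num)
  have hi := h.integrable_inner (h.memLp_gradient m) m
  have h0 := h.integral_inner_eq_zero (h.stronglyMeasurable_gradient m) (h.memLp_gradient m)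
  have hμ := h.step_pos
  have hβ := h.beta_nonneg
  have key : ∀ ω, F (W (m + 1) ω) ≤ F (W m ω) - μ / 2 * ‖g (W m ω)‖ ^ 2
      + (2 * β * μ ^ 2 - μ) * inner ℝ (g (W m ω)) (ξ m ω) + β * μ ^ 2 * ‖ξ m ω‖ ^ 2 := by
    intro ω
    have := le_add_inner_add_of_gradient_lipschitz hβ h.hasGradientAt h.lipschitz (W m ω)
      (-(μ • (g (W m ω) + ξ m ω)))
    rw [← sub_eq_add_neg, ← h.step, norm_neg, norm_smul, mul_pow, norm_add_sq_real,
      inner_neg_right, inner_smul_right, inner_add_right, real_inner_self_eq_norm_sq,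
      Real.norm_of_nonneg hμ.le] at this
    have h2 : β * μ ^ 2 * ‖g (W m ω)‖ ^ 2 ≤ μ / 2 * ‖g (W m ω)‖ ^ 2 := by
      refine mul_le_mul_of_nonneg_right ?_ (by positivity)
      nlinarith
    linarith
  have hF := h.integrable_objective m
  have i1 := hF.sub (hg.const_mul (μ / 2))
  have i2 := i1.add (hi.const_mul (2 * β * μ ^ 2 - μ))
  have i3 := i2.add (hξ.const_mul (β * μ ^ 2))
  refine (integral_mono (h.integrable_objective (m + 1)) i3 key).trans ?_
  have e3 := integral_add i2 (hξ.const_mul (β * μ ^ 2))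
  have e2 := integral_add i1 (hi.const_mul (2 * β * μ ^ 2 - μ))
  have e1 := integral_sub hF (hg.const_mul (μ / 2))
  simp only [Pi.add_apply, Pi.sub_apply, integral_const_mul] at e1 e2 e3 ⊢
  rw [e3, e2, e1, h0]
  have := mul_le_mul_of_nonneg_left (h.integral_noise_sq_le m) (by positivity : 0 ≤ β * μ ^ 2)
  linarith

lemma integral_objective_le (hβμ : β * μ ≤ 1 / 2) {T : ℝ} {n : ℕ} (hn : n * μ ≤ T) :
    ∫ ω, F (W n ω) ∂P ≤ F w - (μ * ∑ m ∈ Finset.range n, ∫ ω, ‖g (W m ω)‖ ^ 2 ∂P) / 2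
      + β * T * (1 + q) * μ := by
  have key : ∀ k : ℕ, ∫ ω, F (W k ω) ∂P ≤ F w
      - (μ * ∑ m ∈ Finset.range k, ∫ ω, ‖g (W m ω)‖ ^ 2 ∂P) / 2 + k * (β * μ ^ 2 * (1 + q)) := by
    intro k
    induction k with
    | zero => simp [h.start]
    | succ k ih =>
      have := h.integral_objective_succ_le hβμ k
      rw [Finset.sum_range_succ]
      push_cast
      linarith
  have h1 : n * (β * μ ^ 2 * (1 + q)) ≤ β * T * (1 + q) * μ := by
    have hq := h.fourth_moment_nonneg
    calc n * (β * μ ^ 2 * (1 + q)) = (β * μ * (1 + q)) * (n * μ) := by ring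
      _ ≤ (β * μ * (1 + q)) * T := by
        have := h.beta_nonneg
        have := h.step_pos
        gcongr
      _ = _ := by ring
  linarith [key n]

/-- The drift costs a factor 1 + μ and a multiple of μ times the squared gradient. The centred noise
enters only at order μ². -/
lemma integral_displacement_sq_succ_le (m : ℕ) :
    ∫ ω, ‖W (m + 1) ω - w‖ ^ 2 ∂P ≤ (1 + μ) * ∫ ω, ‖W m ω - w‖ ^ 2 ∂P
      + (2 * μ * ∫ ω, ‖g (W m ω)‖ ^ 2 ∂P + μ ^ 2 * (1 + q)) := by
  have hμ := h.step_pos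
  have hx := integrable_norm_pow_of_memLp_four (h.memLp_displacement m) (i := 2) (by norm_num)
  have hx' := integrable_norm_pow_of_memLp_four (h.memLp_displacement (m + 1)) (i := 2)
    (by norm_num)
  have hg := integrable_norm_pow_of_memLp_four (h.memLp_gradient m) (i := 2) (by norm_num)
  have hξ := integrable_norm_pow_of_memLp_four (h.memLp m) (i := 2) (by norm_num)
  have hi := h.integrable_inner (h.memLp_drift m) m
  have h0 := h.integral_inner_eq_zero (h.stronglyMeasurable_drift m) (h.memLp_drift m)
  have key : ∀ ω, ‖W (m + 1) ω - w‖ ^ 2 ≤ (1 + μ) * ‖W m ω - w‖ ^ 2 + 2 * μ * ‖g (W m ω)‖ ^ 2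
      + (-2 * μ) * inner ℝ (W m ω - w - μ • g (W m ω)) (ξ m ω) + μ ^ 2 * ‖ξ m ω‖ ^ 2 := by
    intro ω
    rw [h.displacement_succ, norm_sub_sq_real, inner_smul_right, norm_smul, mul_pow,
      Real.norm_of_nonneg hμ.le]
    have h1 : ‖W m ω - w - μ • g (W m ω)‖ ≤ ‖W m ω - w‖ + μ * ‖g (W m ω)‖ := by
      refine (norm_sub_le _ _).trans ?_
      rw [norm_smul, Real.norm_of_nonneg hμ.le]
    have h2 : ‖W m ω - w - μ • g (W m ω)‖ ^ 2 ≤ (‖W m ω - w‖ + μ * ‖g (W m ω)‖) ^ 2 := by gcongr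
    have h3 := add_mul_sq_le (x := ‖W m ω - w‖) (y := ‖g (W m ω)‖) hμ.le
    have h4 : μ * μ * ‖g (W m ω)‖ ^ 2 ≤ 1 * μ * ‖g (W m ω)‖ ^ 2 := by
      gcongr
      exact h.step_le_one
    linarith
  have i1 := (hx.const_mul (1 + μ)).add (hg.const_mul (2 * μ))
  have i2 := i1.add (hi.const_mul (-2 * μ))
  have i3 := i2.add (hξ.const_mul (μ ^ 2))
  refine (integral_mono hx' i3 key).trans ?_
  have e3 := integral_add i2 (hξ.const_mul (μ ^ 2))
  have e2 := integral_add i1 (hi.const_mul (-2 * μ))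
  have e1 := integral_add (hx.const_mul (1 + μ)) (hg.const_mul (2 * μ))
  simp only [Pi.add_apply, integral_const_mul] at e1 e2 e3 ⊢
  rw [e3, e2, e1, h0]
  have := mul_le_mul_of_nonneg_left (h.integral_noise_sq_le m) (by positivity : 0 ≤ μ ^ 2)
  linarith

lemma integral_displacement_sq_le {T : ℝ} {n : ℕ} (hn : n * μ ≤ T) {m : ℕ} (hm : m ≤ n) :
    ∫ ω, ‖W m ω - w‖ ^ 2 ∂P ≤ Real.exp T *
      (2 * (μ * ∑ j ∈ Finset.range n, ∫ ω, ‖g (W j ω)‖ ^ 2 ∂P) + T * (1 + q) * μ) := by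
  have hμ := h.step_pos
  have hq := h.fourth_moment_nonneg
  have hG : ∀ j, 0 ≤ ∫ ω, ‖g (W j ω)‖ ^ 2 ∂P := fun j => integral_nonneg fun ω => by positivity
  have hmT : m * μ ≤ T := (mul_le_mul_of_nonneg_right (by exact_mod_cast hm) hμ.le).trans hn
  refine (le_exp_mul_sum_of_le_mul_add (a := fun m => ∫ ω, ‖W m ω - w‖ ^ 2 ∂P)
    (b := fun m => 2 * μ * ∫ ω, ‖g (W m ω)‖ ^ 2 ∂P + μ ^ 2 * (1 + q)) (r := 1 + μ) (ρ := 1)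
    (μ := μ) (T := T) (by linarith) zero_le_one
    (by rw [one_mul, add_comm]; exact Real.add_one_le_exp μ) hμ.le
    (fun j => by have := hG j; positivity) (by simp [h.start])
    h.integral_displacement_sq_succ_le hmT).trans ?_
  rw [one_mul]
  refine mul_le_mul_of_nonneg_left ?_ (Real.exp_nonneg _)
  calc ∑ j ∈ Finset.range m, (2 * μ * ∫ ω, ‖g (W j ω)‖ ^ 2 ∂P + μ ^ 2 * (1 + q))
      ≤ ∑ j ∈ Finset.range n, (2 * μ * ∫ ω, ‖g (W j ω)‖ ^ 2 ∂P + μ ^ 2 * (1 + q)) :=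
        Finset.sum_le_sum_of_subset_of_nonneg (Finset.range_subset_range.2 hm)
          fun j _ _ => by have := hG j; positivity
    _ = 2 * (μ * ∑ j ∈ Finset.range n, ∫ ω, ‖g (W j ω)‖ ^ 2 ∂P) + (n * μ) * (1 + q) * μ := by
        rw [Finset.sum_add_distrib, ← Finset.mul_sum, Finset.sum_const, Finset.card_range,
          nsmul_eq_mul]
        ring
    _ ≤ _ := by gcongr

/-- The initial gradient is compared with each later one by the Lipschitz bound. Summation with
weight μ gives the left side a factor nμ ≥ T₀, so small accumulated gradients and displacements
force a small initial gradient. -/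
lemma norm_gradient_start_sq_le {T T₀ : ℝ} (hT₀ : 0 < T₀) {n : ℕ} (hn : n * μ ≤ T)
    (hn₀ : T₀ ≤ n * μ) {S E₂ : ℝ}
    (hS : μ * ∑ m ∈ Finset.range n, ∫ ω, ‖g (W m ω)‖ ^ 2 ∂P ≤ S)
    (hE₂ : ∀ m ≤ n, ∫ ω, ‖W m ω - w‖ ^ 2 ∂P ≤ E₂) :
    ‖g w‖ ^ 2 ≤ (2 * S + 2 * β ^ 2 * T * E₂) / T₀ := by
  have hμ := h.step_pos
  have hE₂0 : 0 ≤ E₂ := (integral_nonneg fun ω => by positivity).trans (hE₂ 0 (Nat.zero_le _))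
  have key : ∀ m ≤ n, ‖g w‖ ^ 2 ≤ 2 * ∫ ω, ‖g (W m ω)‖ ^ 2 ∂P + 2 * β ^ 2 * E₂ := by
    intro m hm
    have hg := integrable_norm_pow_of_memLp_four (h.memLp_gradient m) (i := 2) (by norm_num)
    have hx := integrable_norm_pow_of_memLp_four (h.memLp_displacement m) (i := 2) (by norm_num)
    have h1 : ∫ _ : Ω, ‖g w‖ ^ 2 ∂P
        ≤ ∫ ω, (2 * ‖g (W m ω)‖ ^ 2 + 2 * β ^ 2 * ‖W m ω - w‖ ^ 2) ∂P := by
      refine integral_mono (integrable_const _) ((hg.const_mul 2).add (hx.const_mul _)) fun ω => ?_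
      have a1 : ‖g w‖ ≤ ‖g (W m ω)‖ + β * ‖W m ω - w‖ := by
        have b1 := h.lipschitz (W m ω) w
        have b2 := norm_sub_norm_le (g w) (g (W m ω))
        rw [norm_sub_rev] at b2
        linarith
      have a2 : ‖g w‖ ^ 2 ≤ (‖g (W m ω)‖ + β * ‖W m ω - w‖) ^ 2 := by gcongr
      show ‖g w‖ ^ 2 ≤ 2 * ‖g (W m ω)‖ ^ 2 + 2 * β ^ 2 * ‖W m ω - w‖ ^ 2
      nlinarith [sq_nonneg (‖g (W m ω)‖ - β * ‖W m ω - w‖)]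
    rw [integral_add (hg.const_mul 2) (hx.const_mul _), integral_const_mul,
      integral_const_mul] at h1
    simp only [integral_const, probReal_univ, one_smul] at h1
    have := mul_le_mul_of_nonneg_left (hE₂ m hm) (by positivity : 0 ≤ 2 * β ^ 2)
    linarith
  rw [le_div_iff₀ hT₀]
  have hsum := Finset.sum_le_sum fun m (hm : m ∈ Finset.range n) =>
    key m (Finset.mem_range.1 hm).le
  rw [Finset.sum_add_distrib, ← Finset.mul_sum, Finset.sum_const, Finset.sum_const,
    Finset.card_range, nsmul_eq_mul, nsmul_eq_mul] at hsum
  have h2 := mul_le_mul_of_nonneg_left hsum hμ.le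
  calc ‖g w‖ ^ 2 * T₀ ≤ ‖g w‖ ^ 2 * (n * μ) := by gcongr
    _ ≤ 2 * (μ * ∑ m ∈ Finset.range n, ∫ ω, ‖g (W m ω)‖ ^ 2 ∂P) + 2 * β ^ 2 * (n * μ) * E₂ := by
      linarith
    _ ≤ 2 * S + 2 * β ^ 2 * T * E₂ := by gcongr

/-- Expansion of ‖a - μξ‖⁴, where a is the displacement after the deterministic part of the step.
Its linear term ‖a‖²⟪a, ξ⟫ is centred, because a depends on the past only. -/
lemma integral_displacement_pow_four_succ_le (m : ℕ) :
    ∫ ω, ‖W (m + 1) ω - w‖ ^ 4 ∂P ≤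
      (1 + 4 * μ) * (1 + 7 * μ) * (1 + 8 * β ^ 4 * μ) * ∫ ω, ‖W m ω - w‖ ^ 4 ∂P
      + (320 * μ * (‖g w‖ ^ 2) ^ 2 + 7 * μ ^ 3 * q) := by
  have hμ := h.step_pos
  have hμ1 := h.step_le_one
  have hβ := h.beta_nonneg
  have hx := integrable_norm_pow_of_memLp_four (h.memLp_displacement m) (i := 4) le_rfl
  have hx' := integrable_norm_pow_of_memLp_four (h.memLp_displacement (m + 1)) (i := 4) le_rfl
  have hξ := integrable_norm_pow_of_memLp_four (h.memLp m) (i := 4) le_rfl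
  set a : Ω → E := fun ω => W m ω - w - μ • g (W m ω) with ha
  have hφm : StronglyMeasurable[ℱ m] (fun ω => ‖a ω‖ ^ 2 • a ω) :=
    ((h.stronglyMeasurable_drift m).norm.pow 2).smul (h.stronglyMeasurable_drift m)
  have haL := h.memLp_drift m
  have hi : Integrable (fun ω => inner ℝ (‖a ω‖ ^ 2 • a ω) (ξ m ω)) P :=
    integrable_of_abs_le_norm_pow_mul haL (h.memLp m) (i := 3) (j := 1) (by norm_num)
      ((hφm.mono (ℱ.le m)).aestronglyMeasurable.inner (h.memLp m).1) (c := 1) fun ω => by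
        refine (abs_real_inner_le_norm _ _).trans (le_of_eq ?_)
        rw [norm_smul, norm_pow, norm_norm]
        ring
  have h0 := h.centred m _ hφm hi
  have key : ∀ ω, ‖W (m + 1) ω - w‖ ^ 4 ≤
      (1 + 4 * μ) * (1 + 7 * μ) * (1 + 8 * β ^ 4 * μ) * ‖W m ω - w‖ ^ 4
      + 320 * μ * (‖g w‖ ^ 2) ^ 2
      + (-4 * μ) * inner ℝ (‖a ω‖ ^ 2 • a ω) (ξ m ω) + 7 * μ ^ 3 * ‖ξ m ω‖ ^ 4 := by
    intro ω
    have e1 : ‖W (m + 1) ω - w‖ ^ 2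
        = ‖a ω‖ ^ 2 - 2 * (μ * inner ℝ (a ω) (ξ m ω)) + μ ^ 2 * ‖ξ m ω‖ ^ 2 := by
      rw [h.displacement_succ, norm_sub_sq_real, inner_smul_right, norm_smul, mul_pow,
        Real.norm_of_nonneg hμ.le]
    have hs := abs_real_inner_le_norm (a ω) (ξ m ω)
    rw [real_inner_smul_left]
    set s := inner ℝ (a ω) (ξ m ω)
    set α := ‖a ω‖
    set x := ‖ξ m ω‖
    have hα : 0 ≤ α := norm_nonneg _
    have hx0 : 0 ≤ x := norm_nonneg _
    have hs2 : s ^ 2 ≤ α ^ 2 * x ^ 2 := by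
      rw [← mul_pow, ← sq_abs s]; gcongr
    have hs1 : -s ≤ α * x := (neg_le_abs s).trans hs
    have b1 : ‖W (m + 1) ω - w‖ ^ 4 ≤ α ^ 4 - 4 * μ * (α ^ 2 * s) + 8 * μ ^ 2 * (α ^ 2 * x ^ 2)
        + 3 * μ ^ 4 * x ^ 4 := by
      have c1 : 4 * μ ^ 2 * s ^ 2 ≤ 4 * μ ^ 2 * (α ^ 2 * x ^ 2) := by gcongr
      have c2 : 4 * μ ^ 3 * x ^ 2 * (-s) ≤ 4 * μ ^ 3 * x ^ 2 * (α * x) := by gcongr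
      have c3 : 0 ≤ 2 * μ ^ 2 * x ^ 2 * (α - μ * x) ^ 2 := by positivity
      calc ‖W (m + 1) ω - w‖ ^ 4 = (‖W (m + 1) ω - w‖ ^ 2) ^ 2 := by ring
        _ = (α ^ 2 - 2 * (μ * s) + μ ^ 2 * x ^ 2) ^ 2 := by rw [e1]
        _ ≤ _ := by linarith
    -- The split is weighted so that the α part joins the growth factor and the noise is left with
    -- μ³: over T/μ rounds it accumulates to O(μ²) only.
    have b2 : 8 * μ ^ 2 * (α ^ 2 * x ^ 2) ≤ 4 * μ * α ^ 4 + 4 * μ ^ 3 * x ^ 4 := by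
      have : 0 ≤ 4 * μ * (α ^ 2 - μ * x ^ 2) ^ 2 := by positivity
      linarith
    have b3 : μ ^ 4 * x ^ 4 ≤ μ ^ 3 * x ^ 4 := by
      have : μ ^ 4 ≤ μ ^ 3 := pow_le_pow_of_le_one hμ.le hμ1 (by norm_num)
      gcongr
    have b4 : α ≤ ‖W m ω - w‖ + μ * (β * ‖W m ω - w‖ + ‖g w‖) := by
      have c1 : α ≤ ‖W m ω - w‖ + μ * ‖g (W m ω)‖ := by
        refine (norm_sub_le _ _).trans ?_
        rw [norm_smul, Real.norm_of_nonneg hμ.le]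
      have c2 : ‖g (W m ω)‖ ≤ β * ‖W m ω - w‖ + ‖g w‖ := by
        have d1 := h.lipschitz (W m ω) w
        have d2 := norm_sub_norm_le (g (W m ω)) (g w)
        linarith
      have := mul_le_mul_of_nonneg_left c2 hμ.le
      linarith
    set ρ := ‖W m ω - w‖
    set γ := ‖g w‖
    have hρ : 0 ≤ ρ := norm_nonneg _
    have hγ : 0 ≤ γ := norm_nonneg _
    have b5 : α ^ 4 ≤ (1 + 7 * μ) * (ρ ^ 4 + μ * (8 * (β ^ 4 * ρ ^ 4 + γ ^ 4))) := by
      have d1 : (β * ρ + γ) ^ 4 ≤ 8 * (β ^ 4 * ρ ^ 4 + γ ^ 4) := by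
        have := add_mul_pow_four_le (x := β * ρ) (y := γ) zero_le_one
        nlinarith
      have d2 : (1 + μ) ^ 3 ≤ 1 + 7 * μ := by nlinarith
      calc α ^ 4 ≤ (ρ + μ * (β * ρ + γ)) ^ 4 := by gcongr
        _ ≤ (1 + μ) ^ 3 * (ρ ^ 4 + μ * (β * ρ + γ) ^ 4) := add_mul_pow_four_le hμ.le
        _ ≤ _ := by gcongr
    have b6 : (1 + 4 * μ) * α ^ 4 ≤ (1 + 4 * μ) * (1 + 7 * μ) * (1 + 8 * β ^ 4 * μ) * ρ ^ 4
        + 320 * μ * (γ ^ 2) ^ 2 := by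
      -- By μ ≤ 1 the product is at most 5 · 8; with the 8 from `b5` this is the constant 320.
      have d1 : (1 + 4 * μ) * (1 + 7 * μ) ≤ 40 := by nlinarith
      have d2 : (1 + 4 * μ) * (1 + 7 * μ) * (8 * μ * γ ^ 4) ≤ 40 * (8 * μ * γ ^ 4) := by gcongr
      have := mul_le_mul_of_nonneg_left b5 (by linarith : 0 ≤ 1 + 4 * μ)
      linarith
    linarith
  have i1 := (hx.const_mul ((1 + 4 * μ) * (1 + 7 * μ) * (1 + 8 * β ^ 4 * μ))).add
    (integrable_const (320 * μ * (‖g w‖ ^ 2) ^ 2))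
  have i2 := i1.add (hi.const_mul (-4 * μ))
  have i3 := i2.add (hξ.const_mul (7 * μ ^ 3))
  refine (integral_mono hx' i3 key).trans ?_
  have e3 := integral_add i2 (hξ.const_mul (7 * μ ^ 3))
  have e2 := integral_add i1 (hi.const_mul (-4 * μ))
  have e1 := integral_add (hx.const_mul ((1 + 4 * μ) * (1 + 7 * μ) * (1 + 8 * β ^ 4 * μ)))
    (integrable_const (320 * μ * (‖g w‖ ^ 2) ^ 2))
  simp only [Pi.add_apply, integral_const_mul, integral_const, probReal_univ, one_smul]
    at e1 e2 e3 ⊢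
  rw [e3, e2, e1, h0]
  have := mul_le_mul_of_nonneg_left (h.fourth_moment m) (by positivity : 0 ≤ 7 * μ ^ 3)
  linarith

/-- With a squared initial gradient of order μ, the source of each round is O(μ³), and there are at
most T/μ rounds. -/
lemma integral_displacement_pow_four_le {T : ℝ} {n : ℕ} (hn : n * μ ≤ T) {L : ℝ}
    (hL : ‖g w‖ ^ 2 ≤ L * μ) {m : ℕ} (hm : m ≤ n) :
    ∫ ω, ‖W m ω - w‖ ^ 4 ∂P ≤
      Real.exp ((11 + 8 * β ^ 4) * T) * (T * (320 * L ^ 2 + 7 * q)) * μ ^ 2 := by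
  have hμ := h.step_pos
  have hq := h.fourth_moment_nonneg
  have hmT : m * μ ≤ T := (mul_le_mul_of_nonneg_right (by exact_mod_cast hm) hμ.le).trans hn
  refine (le_exp_mul_sum_of_le_mul_add (a := fun m => ∫ ω, ‖W m ω - w‖ ^ 4 ∂P)
    (b := fun m => 320 * μ * (‖g w‖ ^ 2) ^ 2 + 7 * μ ^ 3 * q)
    (r := (1 + 4 * μ) * (1 + 7 * μ) * (1 + 8 * β ^ 4 * μ)) (ρ := 11 + 8 * β ^ 4)
    (μ := μ) (T := T) (by positivity) (by positivity) ?_ hμ.le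
    (fun j => by positivity) (by simp [h.start])
    h.integral_displacement_pow_four_succ_le hmT).trans ?_
  · rw [show (11 + 8 * β ^ 4) * μ = 4 * μ + 7 * μ + 8 * β ^ 4 * μ by ring, Real.exp_add,
      Real.exp_add]
    have key : ∀ x : ℝ, 1 + x ≤ Real.exp x := fun x => by
      rw [add_comm]; exact Real.add_one_le_exp x
    gcongr <;> exact key _
  · rw [Finset.sum_const, Finset.card_range, nsmul_eq_mul, mul_assoc (Real.exp _)]
    refine mul_le_mul_of_nonneg_left ?_ (Real.exp_nonneg _)
    have h1 : (‖g w‖ ^ 2) ^ 2 ≤ (L * μ) ^ 2 := by gcongr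
    calc m * (320 * μ * (‖g w‖ ^ 2) ^ 2 + 7 * μ ^ 3 * q)
        ≤ m * (320 * μ * (L * μ) ^ 2 + 7 * μ ^ 3 * q) := by gcongr
      _ = (m * μ) * (320 * L ^ 2 + 7 * q) * μ ^ 2 := by ring
      _ ≤ _ := by gcongr

end IsNoisyDescent

end Descent

/-! ### Explicit constants, independent of the step size -/

section Constants

/-- Either the descent inequality alone decreases the objective by `R * μ`, or the squared gradients
sum up to at most this constant. -/
noncomputable def gradientSumConst (β q T R : ℝ) : ℝ := 2 * (R + β * T * (1 + q))

/-- The constant in the bound on the squared norm of the initial gradient. -/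
noncomputable def gradientConst (β q T T₀ R : ℝ) : ℝ :=
  (2 * gradientSumConst β q T R + 2 * β ^ 2 * T *
    (Real.exp T * (2 * gradientSumConst β q T R + T * (1 + q)))) / T₀

/-- The constant in the bounds on the initial gradient and on the fourth moments of the
displacement. -/
noncomputable def displacementConst (β q T T₀ R : ℝ) : ℝ :=
  gradientConst β q T T₀ R +
    Real.exp ((11 + 8 * β ^ 4) * T) * (T * (320 * gradientConst β q T T₀ R ^ 2 + 7 * q))

/-- The constant in the remainder of the one-dimensional second-order recursion. -/
noncomputable def coordinateConst (β χ A : ℝ) : ℝ :=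
  2 * χ * (A + β * (1 + A)) + β * χ ^ 2 * A

/-- The constant of the remainder in the second-order expansion of the expected objective. -/
noncomputable def remainderConst (N : ℕ) (β χ T A : ℝ) : ℝ :=
  N * (Real.exp (2 * β * T) * (T * coordinateConst β χ A)) + χ * (1 + A)

end Constants

/-! ### The dichotomy, and the second-order expansion along Hessian eigenvectors -/

namespace IsNoisyDescent

set_option linter.unusedSectionVars false

variable {Ω E : Type*} {mΩ : MeasurableSpace Ω}
  [NormedAddCommGroup E] [InnerProductSpace ℝ E] [CompleteSpace E]
  {F : E → ℝ} {g : E → E} {B C β μ q : ℝ} {w : E} {ℱ : Filtration ℕ mΩ}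
  {P : Measure Ω} [IsProbabilityMeasure P] {ξ W : ℕ → Ω → E}
  (h : IsNoisyDescent F g B C β μ q w ℱ P ξ W)

include h

/-- The cases are whether μ times the accumulated squared gradients reaches `gradientSumConst` times
μ. Half of that constant is exactly R plus the noise cost βT(1 + q) of the descent lemma. Below the
threshold, the second moment, the initial gradient and the fourth moment are bounded in turn. -/
lemma descent_or_displacement_le (hβμ : β * μ ≤ 1 / 2) {T T₀ R : ℝ} (hT₀ : 0 < T₀) (hR : 0 ≤ R)
    {n : ℕ} (hn : n * μ ≤ T) (hn₀ : T₀ ≤ n * μ) :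
    ∫ ω, F (W n ω) ∂P ≤ F w - R * μ ∨
      (‖g w‖ ^ 2 ≤ displacementConst β q T T₀ R * μ ∧
        ∀ m ≤ n, ∫ ω, ‖W m ω - w‖ ^ 4 ∂P ≤ displacementConst β q T T₀ R * μ ^ 2) := by
  have hμ := h.step_pos
  have hβ := h.beta_nonneg
  have hq := h.fourth_moment_nonneg
  have hT : 0 ≤ T := hT₀.le.trans (hn₀.trans hn)
  have hS0 : 0 ≤ gradientSumConst β q T R := by unfold gradientSumConst; positivity
  rcases le_total (gradientSumConst β q T R * μ)
    (μ * ∑ m ∈ Finset.range n, ∫ ω, ‖g (W m ω)‖ ^ 2 ∂P) with hS | hS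
  · left
    have := h.integral_objective_le hβμ hn
    unfold gradientSumConst at hS
    linarith
  · right
    have hE₂ : ∀ m ≤ n, ∫ ω, ‖W m ω - w‖ ^ 2 ∂P ≤
        Real.exp T * (2 * gradientSumConst β q T R + T * (1 + q)) * μ := fun m hm => by
      refine (h.integral_displacement_sq_le hn hm).trans ?_
      rw [mul_assoc (Real.exp T)]
      refine mul_le_mul_of_nonneg_left ?_ (Real.exp_nonneg _)
      linarith
    have hL : ‖g w‖ ^ 2 ≤ gradientConst β q T T₀ R * μ := by
      refine (h.norm_gradient_start_sq_le hT₀ hn hn₀ hS hE₂).trans (le_of_eq ?_)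
      unfold gradientConst
      ring
    have hL0 : 0 ≤ gradientConst β q T T₀ R := by unfold gradientConst; positivity
    unfold displacementConst
    refine ⟨hL.trans ?_, fun m hm => (h.integral_displacement_pow_four_le hn hL hm).trans ?_⟩
    · gcongr
      exact le_add_of_nonneg_right (by positivity)
    · gcongr
      exact le_add_of_nonneg_left hL0

lemma integrable_coordinate (u : E) (b l : ℝ) (m : ℕ) :
    Integrable (fun ω => b * inner ℝ u (W m ω - w) + l / 2 * inner ℝ u (W m ω - w) ^ 2) P := by
  have hX := h.memLp_displacement m
  have hm : AEStronglyMeasurable (fun ω => inner ℝ u (W m ω - w)) P :=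
    aestronglyMeasurable_const.inner hX.1
  refine Integrable.add (Integrable.const_mul ?_ b) (Integrable.const_mul ?_ _)
  · refine integrable_of_abs_le_norm_pow_mul hX hX (i := 1) (j := 0) (by norm_num) hm
      (c := ‖u‖) fun ω => ?_
    simpa using abs_real_inner_le_norm u (W m ω - w)
  · refine integrable_of_abs_le_norm_pow_mul hX hX (i := 2) (j := 0) (by norm_num) (hm.pow 2)
      (c := ‖u‖ ^ 2) fun ω => ?_
    rw [abs_pow, pow_zero, mul_one, ← mul_pow]
    exact pow_le_pow_left₀ (abs_nonneg _) (abs_real_inner_le_norm _ _) 2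

lemma integrable_inner_sq (u : E) (m : ℕ) :
    Integrable (fun ω => inner ℝ u (ξ m ω) ^ 2) P := by
  refine integrable_of_abs_le_norm_pow_mul (h.memLp m) (h.memLp m) (i := 2) (j := 0) (by norm_num)
    ((aestronglyMeasurable_const.inner (h.memLp m).1).pow 2) (c := ‖u‖ ^ 2) fun ω => ?_
  rw [abs_pow, pow_zero, mul_one, ← mul_pow]
  exact pow_le_pow_left₀ (abs_nonneg _) (abs_real_inner_le_norm _ _) 2

/-- For Q(x) = bx + lx²/2, an exact gradient step multiplies the derivative b + lx by 1 - μl. Hence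
it sends Q to (1 - μl)²Q - μ(1 - μl/2)b², and the last term has a favourable sign. The noise adds
lμ²/2 times its squared component, and the rest comes from the Taylor remainder of the gradient. -/
lemma integral_coordinate_succ_le {H : E →L[ℝ] E} {χ : ℝ}
    (hH : ∀ x, ‖g (w + x) - g w - H x‖ ≤ χ * ‖x‖ ^ 2) {u : E} (hu : ‖u‖ = 1) {l : ℝ}
    (hl : |l| ≤ β) (hHu : ∀ x, inner ℝ u (H x) = l * inner ℝ u x) (hβμ : β * μ ≤ 1 / 2) (m : ℕ) :
    ∫ ω, (inner ℝ u (g w) * inner ℝ u (W (m + 1) ω - w)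
        + l / 2 * inner ℝ u (W (m + 1) ω - w) ^ 2) ∂P ≤
      (1 - μ * l) ^ 2 * ∫ ω, (inner ℝ u (g w) * inner ℝ u (W m ω - w)
        + l / 2 * inner ℝ u (W m ω - w) ^ 2) ∂P +
      (l * μ ^ 2 / 2 * ∫ ω, inner ℝ u (ξ m ω) ^ 2 ∂P +
        (2 * μ * χ * (‖g w‖ * ∫ ω, ‖W m ω - w‖ ^ 2 ∂P + β * ∫ ω, ‖W m ω - w‖ ^ 3 ∂P)
          + β * μ ^ 2 * χ ^ 2 / 2 * ∫ ω, ‖W m ω - w‖ ^ 4 ∂P)) := by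
  have hμ := h.step_pos
  have hβ := h.beta_nonneg
  have hX := h.memLp_displacement m
  set b := inner ℝ u (g w) with hb
  -- The coefficient of the noise component in the expansion of Q after the step; it depends on the
  -- past only.
  set c : Ω → ℝ := fun ω => -μ * (1 - μ * l) * (b + l * inner ℝ u (W m ω - w))
    + l * μ ^ 2 * (inner ℝ u (g (W m ω)) - b - l * inner ℝ u (W m ω - w)) with hc
  set φ : Ω → E := fun ω => c ω • u with hφ
  -- Written as a continuous linear image of displacement and gradient plus a constant vector, φ is
  -- visibly adapted and in L⁴.
  have hφ' : φ = fun ω => (((innerSL ℝ u).smulRight u : E →L[ℝ] E)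
      ((-μ * (1 - μ * l) * l - l * μ ^ 2 * l) • (W m ω - w) + (l * μ ^ 2) • g (W m ω))
        + (-μ * (1 - μ * l) * b - l * μ ^ 2 * b) • u) := by
    funext ω
    simp only [hφ, hc, ContinuousLinearMap.smulRight_apply, innerSL_apply_apply, inner_add_right,
      real_inner_smul_right, ← add_smul]
    congr 1
    ring
  have hφm : StronglyMeasurable[ℱ m] φ := by
    rw [hφ']
    exact (((innerSL ℝ u).smulRight u : E →L[ℝ] E).continuous.comp_stronglyMeasurable
      (((h.stronglyMeasurable_displacement m).const_smul _).add
        ((h.stronglyMeasurable_gradient m).const_smul _))).add stronglyMeasurable_const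
  have hφL : MemLp φ 4 P := by
    rw [hφ']
    exact (((innerSL ℝ u).smulRight u : E →L[ℝ] E).comp_memLp'
      ((hX.const_smul _).add ((h.memLp_gradient m).const_smul _))).add (memLp_const _)
  have hi := h.integrable_inner hφL m
  have h0 := h.integral_inner_eq_zero hφm hφL
  have hq := h.integrable_coordinate u b l m
  have hq' := h.integrable_coordinate u b l (m + 1)
  have hs := h.integrable_inner_sq u m
  have h2 := integrable_norm_pow_of_memLp_four hX (i := 2) (by norm_num)
  have h3 := integrable_norm_pow_of_memLp_four hX (i := 3) (by norm_num)
  have h4 := integrable_norm_pow_of_memLp_four hX (i := 4) (by norm_num)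
  have key : ∀ ω, b * inner ℝ u (W (m + 1) ω - w) + l / 2 * inner ℝ u (W (m + 1) ω - w) ^ 2 ≤
      (1 - μ * l) ^ 2 * (b * inner ℝ u (W m ω - w) + l / 2 * inner ℝ u (W m ω - w) ^ 2)
      + l * μ ^ 2 / 2 * inner ℝ u (ξ m ω) ^ 2 + inner ℝ (φ ω) (ξ m ω)
      + (2 * μ * χ * (‖g w‖ * ‖W m ω - w‖ ^ 2 + β * ‖W m ω - w‖ ^ 3)
        + β * μ ^ 2 * χ ^ 2 / 2 * ‖W m ω - w‖ ^ 4) := by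
    intro ω
    have e1 : inner ℝ u (W (m + 1) ω - w)
        = inner ℝ u (W m ω - w) - μ * (inner ℝ u (g (W m ω)) + inner ℝ u (ξ m ω)) := by
      rw [h.displacement_succ, inner_sub_right, inner_sub_right, real_inner_smul_right,
        real_inner_smul_right]
      ring
    have hr := hH (W m ω - w)
    rw [add_sub_cancel] at hr
    have hr2 : |inner ℝ u (g (W m ω)) - b - l * inner ℝ u (W m ω - w)| ≤ χ * ‖W m ω - w‖ ^ 2 := by
      rw [hb, ← hHu, ← inner_sub_right, ← inner_sub_right]
      refine (abs_real_inner_le_norm _ _).trans ?_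
      rwa [hu, one_mul]
    have hbb : |b| ≤ ‖g w‖ := by
      have := abs_real_inner_le_norm u (g w)
      rwa [hu, one_mul] at this
    have hxx : |inner ℝ u (W m ω - w)| ≤ ‖W m ω - w‖ := by
      have := abs_real_inner_le_norm u (W m ω - w)
      rwa [hu, one_mul] at this
    rw [e1]
    simp only [hφ, real_inner_smul_left, hc]
    set x := inner ℝ u (W m ω - w)
    set y := inner ℝ u (g (W m ω))
    set s := inner ℝ u (ξ m ω)
    set ρ := ‖W m ω - w‖
    have hρ : 0 ≤ ρ := norm_nonneg _
    have ll : |1 - μ * l| ≤ 2 := by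
      have : |μ * l| ≤ 1 / 2 := by
        rw [abs_mul, abs_of_pos hμ, mul_comm]
        exact (mul_le_mul_of_nonneg_right hl hμ.le).trans hβμ
      have := abs_le.1 this
      exact abs_le.2 ⟨by linarith, by linarith⟩
    have t1 : -μ * (1 - μ * l) * (b + l * x) * (y - b - l * x)
        ≤ 2 * μ * χ * (‖g w‖ * ρ ^ 2 + β * ρ ^ 3) := by
      have u1 : |b + l * x| ≤ ‖g w‖ + β * ρ := by
        refine (abs_add_le _ _).trans ?_
        rw [abs_mul]
        gcongr
      calc -μ * (1 - μ * l) * (b + l * x) * (y - b - l * x)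
          ≤ |-μ * (1 - μ * l) * (b + l * x) * (y - b - l * x)| := le_abs_self _
        _ = μ * |1 - μ * l| * |b + l * x| * |y - b - l * x| := by
          rw [abs_mul, abs_mul, abs_mul, abs_neg, abs_of_pos hμ]
        _ ≤ μ * 2 * (‖g w‖ + β * ρ) * (χ * ρ ^ 2) := by gcongr
        _ = _ := by ring
    have t2 : l * μ ^ 2 / 2 * (y - b - l * x) ^ 2 ≤ β * μ ^ 2 * χ ^ 2 / 2 * ρ ^ 4 := by
      have u1 : (y - b - l * x) ^ 2 ≤ (χ * ρ ^ 2) ^ 2 := by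
        rw [← sq_abs (y - b - l * x)]; gcongr
      calc l * μ ^ 2 / 2 * (y - b - l * x) ^ 2 ≤ β * μ ^ 2 / 2 * (χ * ρ ^ 2) ^ 2 := by
            gcongr
            exact (le_abs_self l).trans hl
        _ = _ := by ring
    -- The contribution of the initial gradient, which only decreases Q and is discarded.
    have t3 : 0 ≤ μ * (1 - μ * l / 2) * b ^ 2 := by
      have : μ * l ≤ 1 / 2 := by
        rw [mul_comm]
        exact (mul_le_mul_of_nonneg_right ((le_abs_self l).trans hl) hμ.le).trans hβμ
      have : 0 ≤ 1 - μ * l / 2 := by linarith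
      positivity
    linarith
  have j1 := hq.const_mul ((1 - μ * l) ^ 2)
  have j2 := hs.const_mul (l * μ ^ 2 / 2)
  have j3 := ((h2.const_mul ‖g w‖).add (h3.const_mul β)).const_mul (2 * μ * χ)
  have j4 := h4.const_mul (β * μ ^ 2 * χ ^ 2 / 2)
  refine (integral_mono hq' (((j1.add j2).add hi).add (j3.add j4)) key).trans (le_of_eq ?_)
  have e1 := integral_add ((j1.add j2).add hi) (j3.add j4)
  have e2 := integral_add (j1.add j2) hi
  have e3 := integral_add j1 j2
  have e4 := integral_add j3 j4
  have e5 := integral_add (h2.const_mul ‖g w‖) (h3.const_mul β)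
  simp only [Pi.add_apply, integral_const_mul] at e1 e2 e3 e4 e5 ⊢
  rw [e1, e2, e3, e4, e5, h0]
  ring

lemma integral_displacement_sq_le_of_pow_four {A : ℝ} {m : ℕ}
    (hA : ∫ ω, ‖W m ω - w‖ ^ 4 ∂P ≤ A * μ ^ 2) :
    ∫ ω, ‖W m ω - w‖ ^ 2 ∂P ≤ (1 + A) * μ := by
  have hμ := h.step_pos
  have hX := h.memLp_displacement m
  have h2 := integrable_norm_pow_of_memLp_four hX (i := 2) (by norm_num)
  have h4 := integrable_norm_pow_of_memLp_four hX (i := 4) (by norm_num)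
  have h1 : ∫ ω, ‖W m ω - w‖ ^ 2 ∂P ≤ ∫ ω, (μ + μ⁻¹ * ‖W m ω - w‖ ^ 4) ∂P := by
    refine integral_mono h2 ((integrable_const _).add (h4.const_mul _)) fun ω => ?_
    show ‖W m ω - w‖ ^ 2 ≤ μ + μ⁻¹ * ‖W m ω - w‖ ^ 4
    rw [← mul_le_mul_iff_right₀ hμ, mul_add, mul_inv_cancel_left₀ hμ.ne']
    nlinarith [sq_nonneg (‖W m ω - w‖ ^ 2 - μ), sq_nonneg (‖W m ω - w‖ ^ 2)]
  rw [integral_add (integrable_const _) (h4.const_mul _), integral_const_mul] at h1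
  simp only [integral_const, probReal_univ, one_smul] at h1
  have := mul_le_mul_of_nonneg_left hA (inv_nonneg.2 hμ.le)
  have e : μ⁻¹ * (A * μ ^ 2) = A * μ := by field_simp
  linarith

/-- The cube is split between the square and the fourth power by a weighted arithmetic-geometric
mean inequality, the weight τ = √μ being the size of the displacement. -/
lemma integral_displacement_pow_three_le_of_pow_four {A τ : ℝ} (hτ : 0 < τ) (hτμ : τ ^ 2 = μ)
    {m : ℕ} (hA : ∫ ω, ‖W m ω - w‖ ^ 4 ∂P ≤ A * μ ^ 2) :
    ∫ ω, ‖W m ω - w‖ ^ 3 ∂P ≤ (1 + A) * τ ^ 3 := by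
  have hX := h.memLp_displacement m
  have h2 := integrable_norm_pow_of_memLp_four hX (i := 2) (by norm_num)
  have h3 := integrable_norm_pow_of_memLp_four hX (i := 3) (by norm_num)
  have h4 := integrable_norm_pow_of_memLp_four hX (i := 4) (by norm_num)
  have e2 := h.integral_displacement_sq_le_of_pow_four hA
  have h1 : ∫ ω, ‖W m ω - w‖ ^ 3 ∂P
      ≤ ∫ ω, (τ / 2 * ‖W m ω - w‖ ^ 2 + (2 * τ)⁻¹ * ‖W m ω - w‖ ^ 4) ∂P := by
    refine integral_mono h3 ((h2.const_mul _).add (h4.const_mul _)) fun ω => ?_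
    show ‖W m ω - w‖ ^ 3 ≤ τ / 2 * ‖W m ω - w‖ ^ 2 + (2 * τ)⁻¹ * ‖W m ω - w‖ ^ 4
    rw [← mul_le_mul_iff_right₀ (by positivity : 0 < 2 * τ), mul_add,
      mul_inv_cancel_left₀ (by positivity)]
    nlinarith [sq_nonneg (‖W m ω - w‖ * (‖W m ω - w‖ - τ))]
  rw [integral_add (h2.const_mul _) (h4.const_mul _), integral_const_mul,
    integral_const_mul] at h1
  have a1 := mul_le_mul_of_nonneg_left hA (by positivity : 0 ≤ (2 * τ)⁻¹)
  have a2 := mul_le_mul_of_nonneg_left e2 (by positivity : 0 ≤ τ / 2)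
  have e : (2 * τ)⁻¹ * (A * μ ^ 2) = A / 2 * τ ^ 3 := by rw [← hτμ]; field_simp
  have e' : τ / 2 * ((1 + A) * μ) = (1 + A) / 2 * τ ^ 3 := by rw [← hτμ]; ring
  have hτ3 : 0 < τ ^ 3 := by positivity
  linarith

/-- The remainder of one round is O(μ^{5/2}). The amplification is at most exp(2βT) and n ≤ T/μ, so
O(μ^{3/2}) remains in total. -/
lemma integral_coordinate_le {H : E →L[ℝ] E} {χ : ℝ} (hχ : 0 ≤ χ)
    (hH : ∀ x, ‖g (w + x) - g w - H x‖ ≤ χ * ‖x‖ ^ 2) {u : E} (hu : ‖u‖ = 1) {l : ℝ}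
    (hl : |l| ≤ β) (hHu : ∀ x, inner ℝ u (H x) = l * inner ℝ u x) (hβμ : β * μ ≤ 1 / 2)
    {T A τ : ℝ} {n : ℕ} (hn : n * μ ≤ T) (hτ : 0 < τ) (hτμ : τ ^ 2 = μ) (hA₀ : 0 ≤ A)
    (hg : ‖g w‖ ^ 2 ≤ A * μ) (hA : ∀ m ≤ n, ∫ ω, ‖W m ω - w‖ ^ 4 ∂P ≤ A * μ ^ 2) :
    ∫ ω, (inner ℝ u (g w) * inner ℝ u (W n ω - w) + l / 2 * inner ℝ u (W n ω - w) ^ 2) ∂P ≤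
      ∑ m ∈ Finset.range n,
        ((1 - μ * l) ^ 2) ^ (n - 1 - m) * (l * μ ^ 2 / 2 * ∫ ω, inner ℝ u (ξ m ω) ^ 2 ∂P)
      + Real.exp (2 * β * T) * (T * coordinateConst β χ A) * τ ^ 3 := by
  have hμ := h.step_pos
  have hβ := h.beta_nonneg
  refine (le_sum_pow_mul_of_le_mul_add
    (a := fun m => ∫ ω, (inner ℝ u (g w) * inner ℝ u (W m ω - w)
      + l / 2 * inner ℝ u (W m ω - w) ^ 2) ∂P)
    (b := fun m => l * μ ^ 2 / 2 * ∫ ω, inner ℝ u (ξ m ω) ^ 2 ∂P +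
      (2 * μ * χ * (‖g w‖ * ∫ ω, ‖W m ω - w‖ ^ 2 ∂P + β * ∫ ω, ‖W m ω - w‖ ^ 3 ∂P)
        + β * μ ^ 2 * χ ^ 2 / 2 * ∫ ω, ‖W m ω - w‖ ^ 4 ∂P))
    (r := (1 - μ * l) ^ 2) (by positivity) ?_
    (h.integral_coordinate_succ_le hH hu hl hHu hβμ) n).trans ?_
  · simp [h.start]
  simp_rw [fun m => mul_add (((1 - μ * l) ^ 2) ^ (n - 1 - m))
    (l * μ ^ 2 / 2 * ∫ ω, inner ℝ u (ξ m ω) ^ 2 ∂P)]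
  rw [Finset.sum_add_distrib]
  refine add_le_add le_rfl ?_
  have hτ1 : τ ≤ 1 := by
    have := h.step_le_one
    rw [← hτμ] at this
    nlinarith
  have hcc : 0 ≤ coordinateConst β χ A := by unfold coordinateConst; positivity
  have herr : ∀ m ≤ n, 2 * μ * χ * (‖g w‖ * ∫ ω, ‖W m ω - w‖ ^ 2 ∂P
      + β * ∫ ω, ‖W m ω - w‖ ^ 3 ∂P) + β * μ ^ 2 * χ ^ 2 / 2 * ∫ ω, ‖W m ω - w‖ ^ 4 ∂P
      ≤ coordinateConst β χ A * (μ * τ ^ 3) := by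
    intro m hm
    have hX := h.memLp_displacement m
    have h3 := h.integral_displacement_pow_three_le_of_pow_four hτ hτμ (hA m hm)
    have h2 : ‖g w‖ * ∫ ω, ‖W m ω - w‖ ^ 2 ∂P ≤ A * τ ^ 3 := by
      rw [← integral_const_mul]
      calc ∫ ω, ‖g w‖ * ‖W m ω - w‖ ^ 2 ∂P
          ≤ ∫ ω, (τ / 2 * ‖g w‖ ^ 2 + (2 * τ)⁻¹ * ‖W m ω - w‖ ^ 4) ∂P := by
            refine integral_mono
              ((integrable_norm_pow_of_memLp_four hX (i := 2) (by norm_num)).const_mul _)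
              ((integrable_const _).add
                ((integrable_norm_pow_of_memLp_four hX le_rfl).const_mul _)) fun ω => ?_
            show ‖g w‖ * ‖W m ω - w‖ ^ 2 ≤ τ / 2 * ‖g w‖ ^ 2 + (2 * τ)⁻¹ * ‖W m ω - w‖ ^ 4
            rw [← mul_le_mul_iff_right₀ (by positivity : 0 < 2 * τ), mul_add,
              mul_inv_cancel_left₀ (by positivity)]
            nlinarith [sq_nonneg (‖W m ω - w‖ ^ 2 - τ * ‖g w‖)]
        _ = τ / 2 * ‖g w‖ ^ 2 + (2 * τ)⁻¹ * ∫ ω, ‖W m ω - w‖ ^ 4 ∂P := by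
            rw [integral_add (integrable_const _)
              ((integrable_norm_pow_of_memLp_four hX le_rfl).const_mul _), integral_const,
              integral_const_mul, probReal_univ, one_smul]
        _ ≤ τ / 2 * (A * μ) + (2 * τ)⁻¹ * (A * μ ^ 2) := by
            gcongr
            exact hA m hm
        _ = A * τ ^ 3 := by rw [← hτμ]; field_simp; ring
    have h4 : β * μ ^ 2 * χ ^ 2 / 2 * ∫ ω, ‖W m ω - w‖ ^ 4 ∂P
        ≤ β * χ ^ 2 * A * (μ * τ ^ 3) := by
      calc β * μ ^ 2 * χ ^ 2 / 2 * ∫ ω, ‖W m ω - w‖ ^ 4 ∂P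
          ≤ β * μ ^ 2 * χ ^ 2 / 2 * (A * μ ^ 2) := by
            gcongr
            exact hA m hm
        _ = β * χ ^ 2 * A * (μ * τ ^ 6) / 2 := by rw [← hτμ]; ring
        _ ≤ β * χ ^ 2 * A * (μ * τ ^ 6) := half_le_self (by positivity)
        _ ≤ β * χ ^ 2 * A * (μ * τ ^ 3) := by
            have := pow_le_pow_of_le_one hτ.le hτ1 (show 3 ≤ 6 by norm_num)
            gcongr
    have h5 : 2 * μ * χ * (‖g w‖ * ∫ ω, ‖W m ω - w‖ ^ 2 ∂P + β * ∫ ω, ‖W m ω - w‖ ^ 3 ∂P)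
        ≤ 2 * μ * χ * (A * τ ^ 3 + β * ((1 + A) * τ ^ 3)) := by gcongr
    unfold coordinateConst
    linarith
  have hr : (1 - μ * l) ^ 2 ≤ Real.exp (2 * β * μ) := by
    have a1 : |1 - μ * l| ≤ 1 + β * μ := by
      refine (abs_sub _ _).trans ?_
      rw [abs_one, abs_mul, abs_of_pos hμ, mul_comm β]
      gcongr
    have a2 : 1 + β * μ ≤ Real.exp (β * μ) := by
      rw [add_comm]; exact Real.add_one_le_exp _
    calc (1 - μ * l) ^ 2 = |1 - μ * l| ^ 2 := (sq_abs _).symm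
      _ ≤ Real.exp (β * μ) ^ 2 := by gcongr; exact a1.trans a2
      _ = Real.exp (2 * β * μ) := by rw [← Real.exp_nat_mul]; congr 1; push_cast; ring
  calc ∑ m ∈ Finset.range n, ((1 - μ * l) ^ 2) ^ (n - 1 - m) *
        (2 * μ * χ * (‖g w‖ * ∫ ω, ‖W m ω - w‖ ^ 2 ∂P + β * ∫ ω, ‖W m ω - w‖ ^ 3 ∂P)
          + β * μ ^ 2 * χ ^ 2 / 2 * ∫ ω, ‖W m ω - w‖ ^ 4 ∂P)
      ≤ ∑ m ∈ Finset.range n, Real.exp (2 * β * T) * (coordinateConst β χ A * (μ * τ ^ 3)) := by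
        refine Finset.sum_le_sum fun m hm => ?_
        have hm' := (Finset.mem_range.1 hm).le
        refine (mul_le_mul_of_nonneg_left (herr m hm') (by positivity)).trans ?_
        refine mul_le_mul_of_nonneg_right ?_ (by positivity)
        calc ((1 - μ * l) ^ 2) ^ (n - 1 - m) ≤ Real.exp (2 * β * μ) ^ (n - 1 - m) := by gcongr
          _ = Real.exp (((n - 1 - m : ℕ) : ℝ) * (2 * β * μ)) := by rw [Real.exp_nat_mul]
          _ ≤ Real.exp (2 * β * T) := by
            refine Real.exp_le_exp.2 ?_
            have h1 : ((n - 1 - m : ℕ) : ℝ) ≤ n := by exact_mod_cast (by omega)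
            calc ((n - 1 - m : ℕ) : ℝ) * (2 * β * μ) ≤ n * (2 * β * μ) := by gcongr
              _ = 2 * β * (n * μ) := by ring
              _ ≤ 2 * β * T := by gcongr
    _ = Real.exp (2 * β * T) * ((n * μ) * coordinateConst β χ A) * τ ^ 3 := by
        rw [Finset.sum_const, Finset.card_range, nsmul_eq_mul]; ring
    _ ≤ _ := by gcongr

/-- In the regime of small initial gradient, the expected objective is governed by the second-order
contributions of the noise along the eigenvectors of the Hessian. -/
lemma integral_objective_le_sum_eigenvalues {ι : Type*} [Fintype ι] (u : OrthonormalBasis ι ℝ E)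
    {H : E →L[ℝ] E} {χ : ℝ} (hχ : 0 ≤ χ) (hHs : ∀ x y, inner ℝ (H x) y = inner ℝ x (H y))
    (hH : ∀ x, ‖g (w + x) - g w - H x‖ ≤ χ * ‖x‖ ^ 2) {l : ι → ℝ}
    (hl : ∀ i, |l i| ≤ β) (hHu : ∀ i, H (u i) = l i • u i) (hβμ : β * μ ≤ 1 / 2)
    {T A τ : ℝ} {n : ℕ} (hn : n * μ ≤ T) (hτ : 0 < τ) (hτμ : τ ^ 2 = μ) (hA₀ : 0 ≤ A)
    (hg : ‖g w‖ ^ 2 ≤ A * μ) (hA : ∀ m ≤ n, ∫ ω, ‖W m ω - w‖ ^ 4 ∂P ≤ A * μ ^ 2) :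
    ∫ ω, F (W n ω) ∂P ≤ F w + ∑ i, ∑ m ∈ Finset.range n,
        ((1 - μ * l i) ^ 2) ^ (n - 1 - m) * (l i * μ ^ 2 / 2 * ∫ ω, inner ℝ (u i) (ξ m ω) ^ 2 ∂P)
      + remainderConst (Fintype.card ι) β χ T A * τ ^ 3 := by
  have hHu' : ∀ i x, inner ℝ (u i) (H x) = l i * inner ℝ (u i) x := fun i x => by
    rw [← hHs, hHu, real_inner_smul_left]
  have hco := fun i => h.integral_coordinate_le hχ hH (u.orthonormal.1 i) (hl i) (hHu' i) hβμ hn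
    hτ hτμ hA₀ hg hA
  have hint := fun i => h.integrable_coordinate (u i) (inner ℝ (u i) (g w)) (l i) n
  have h3 := integrable_norm_pow_of_memLp_four (h.memLp_displacement n) (i := 3) (by norm_num)
  have hX3 := h.integral_displacement_pow_three_le_of_pow_four hτ hτμ (hA n le_rfl)
  -- The Taylor polynomial decouples in the eigenbasis by Parseval's identity.
  have key : ∀ ω, F (W n ω) ≤ F w + ∑ i, (inner ℝ (u i) (g w) * inner ℝ (u i) (W n ω - w)
      + l i / 2 * inner ℝ (u i) (W n ω - w) ^ 2) + χ * ‖W n ω - w‖ ^ 3 := by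
    intro ω
    have := le_second_order_taylor hχ h.hasGradientAt hHs hH (W n ω - w)
    rw [add_sub_cancel] at this
    refine this.trans (le_of_eq ?_)
    congr 2
    rw [← u.sum_inner_mul_inner (g w), ← u.sum_inner_mul_inner (W n ω - w), Finset.sum_div,
      ← Finset.sum_add_distrib]
    refine Finset.sum_congr rfl fun i _ => ?_
    rw [hHu', real_inner_comm (u i), real_inner_comm (u i)]
    ring
  have i1 := integrable_finsetSum Finset.univ fun i _ => hint i
  refine (integral_mono (h.integrable_objective n)
    (((integrable_const (F w)).add i1).add (h3.const_mul χ)) key).trans ?_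
  have e1 := integral_add ((integrable_const (μ := P) (F w)).add i1) (h3.const_mul χ)
  have e2 := integral_add (integrable_const (μ := P) (F w)) i1
  simp only [Pi.add_apply, integral_const_mul, integral_const, probReal_univ, one_smul] at e1 e2 ⊢
  rw [e1, e2, integral_finsetSum _ fun i _ => hint i]
  have hsum := Finset.sum_le_sum fun i (_ : i ∈ Finset.univ) => hco i
  rw [Finset.sum_add_distrib, Finset.sum_const, Finset.card_univ, nsmul_eq_mul] at hsum
  have := mul_le_mul_of_nonneg_left hX3 hχ
  unfold remainderConst
  linarith

end IsNoisyDescent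

/-! ### Stable against unstable directions: comparison with the claimed bound -/

section ReductionBound

/-- The argument `6 c 𝒱_max / 𝒱_min + 1` of the logarithm in `N_max`. -/
noncomputable def escapeFactor (K c : ℕ) (ζ κ ν σ Pmin Pmax : ℝ) : ℝ :=
  6 * c * (Vmax K ζ κ ν σ Pmin / Vmin K ν σ Pmax) + 1

/-- The constant of the second-order discretization error in the comparison with `reductionBound`. -/
noncomputable def discretizationConst (K c : ℕ) (ζ κ ν σ Pmin Pmax γ β : ℝ) : ℝ :=
  γ * (ν ^ 2 * σ ^ 2 / Pmax) * (escapeFactor K c ζ κ ν σ Pmin Pmax *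
    (1 + Real.log (escapeFactor K c ζ κ ν σ Pmin Pmax)))
    + 2 * c * β * K ^ 2 * Vmax K ζ κ ν σ Pmin

/-- For l > 0 the geometric series is at most 1/(1 - r) with 1 - r = 2μl(1 - μl/2). The factor l of
the source cancels, so flat and steep directions cost the same to leading order. For l ≤ 0 no term
is positive. -/
lemma sum_contracting_le {l β μ v y : ℝ} {a : ℕ → ℝ} (hμ : 0 < μ) (hβ : 0 ≤ β) (hl : l ≤ β)
    (hβμ : β * μ ≤ 1 / 2) {n : ℕ} (hy : 0 ≤ y) (ha : ∀ m < n, y ≤ a m) (hv0 : 0 ≤ v)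
    (hv : ∀ m < n, a m ≤ v) :
    ∑ m ∈ Finset.range n, ((1 - μ * l) ^ 2) ^ (n - 1 - m) * (l * μ ^ 2 / 2 * a m)
      ≤ μ / 4 * ((1 + β * μ) * v) := by
  rcases le_or_gt l 0 with h | h
  · refine (Finset.sum_nonpos fun m hm => ?_).trans (by positivity)
    have := hy.trans (ha m (Finset.mem_range.1 hm))
    refine mul_nonpos_of_nonneg_of_nonpos (by positivity) ?_
    have : 0 ≤ (-l) * μ ^ 2 / 2 * a m := by
      have : 0 ≤ -l := by linarith
      positivity
    linarith
  · have hlμ : μ * l ≤ β * μ := by rw [mul_comm]; gcongr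
    have hlμ' : 0 < μ * l := mul_pos hμ h
    set r := (1 - μ * l) ^ 2 with hr
    have hr0 : 0 ≤ r := by positivity
    have hr1 : r < 1 := by rw [hr]; nlinarith
    have hsum : ∑ m ∈ Finset.range n, r ^ (n - 1 - m) ≤ (1 - r)⁻¹ := by
      rw [Finset.sum_range_reflect (fun j => r ^ j) n]
      rw [← tsum_geometric_of_lt_one hr0 hr1]
      exact (summable_geometric_of_lt_one hr0 hr1).sum_le_tsum _ fun _ _ => by positivity
    calc ∑ m ∈ Finset.range n, r ^ (n - 1 - m) * (l * μ ^ 2 / 2 * a m)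
        ≤ ∑ m ∈ Finset.range n, r ^ (n - 1 - m) * (l * μ ^ 2 / 2 * v) := by
          refine Finset.sum_le_sum fun m hm => ?_
          have := hv m (Finset.mem_range.1 hm)
          gcongr
      _ = (∑ m ∈ Finset.range n, r ^ (n - 1 - m)) * (l * μ ^ 2 / 2 * v) := by
          rw [Finset.sum_mul]
      _ ≤ (1 - r)⁻¹ * (l * μ ^ 2 / 2 * v) := by gcongr
      _ = μ / 4 * ((1 - μ * l / 2)⁻¹ * v) := by
          rw [show 1 - r = 2 * (μ * l) * (1 - μ * l / 2) by rw [hr]; ring]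
          have : 1 - μ * l / 2 ≠ 0 := by nlinarith
          have : l ≠ 0 := h.ne'
          have : μ ≠ 0 := hμ.ne'
          field_simp
          ring
      _ ≤ μ / 4 * ((1 + β * μ) * v) := by
          have : (1 - μ * l / 2)⁻¹ ≤ 1 + β * μ := by
            rw [inv_le_iff_one_le_mul₀ (by linarith)]
            nlinarith
          gcongr

/-- With x = μγ, log(1 + x) ≥ x(1 - x) gives (1 + x)^{2J} ≥ L^{1-x} ≥ L(1 - x log L) when x < 1: the
exact value L is missed by O(μ) only. -/
lemma le_pow_of_log_le {μ γ L : ℝ} (hμ : 0 < μ) (hγ : 0 < γ) (hL : 1 ≤ L) {J : ℕ}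
    (hJ : 1 / (2 * μ * γ) * Real.log L ≤ J) :
    L * (1 - μ * γ * Real.log L) ≤ ((1 + μ * γ) ^ 2) ^ J := by
  have hx : 0 < μ * γ := mul_pos hμ hγ
  have hlog : 0 ≤ Real.log L := Real.log_nonneg hL
  have h1 : μ * γ * (1 - μ * γ) ≤ Real.log (1 + μ * γ) := by
    have h2 := Real.one_sub_inv_le_log_of_pos (by linarith : 0 < 1 + μ * γ)
    have h3 : μ * γ * (1 - μ * γ) ≤ 1 - (1 + μ * γ)⁻¹ := by
      rw [show 1 - (1 + μ * γ)⁻¹ = μ * γ / (1 + μ * γ) by field_simp; ring, le_div_iff₀ (by linarith)]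
      have : 0 ≤ (μ * γ) ^ 3 := by positivity
      nlinarith
    linarith
  rcases le_or_gt 1 (μ * γ) with h | h
  -- For μγ ≥ 1 the claim is trivial, since L(1 - log L) ≤ 1.
  · have : L * (1 - μ * γ * Real.log L) ≤ 1 := by
      have h4 : L * (1 - Real.log L) ≤ 1 := by
        have h5 := Real.one_sub_inv_le_log_of_pos (by linarith : 0 < L)
        have h6 : L * L⁻¹ = 1 := mul_inv_cancel₀ (by linarith)
        nlinarith
      have h7 : L * (1 - μ * γ * Real.log L) ≤ L * (1 - Real.log L) := by
        have : Real.log L ≤ μ * γ * Real.log L := le_mul_of_one_le_left hlog h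
        gcongr
      exact h7.trans h4
    exact this.trans (one_le_pow₀ (one_le_pow₀ (by linarith)))
  · have h2 : Real.log L * (1 - μ * γ) ≤ 2 * J * Real.log (1 + μ * γ) := by
      have h3 : Real.log L ≤ 2 * (μ * γ) * J := by
        have := mul_le_mul_of_nonneg_left hJ (by positivity : 0 ≤ 2 * μ * γ)
        rw [← mul_assoc, mul_one_div_cancel (by positivity), one_mul] at this
        linarith
      calc Real.log L * (1 - μ * γ) ≤ 2 * (μ * γ) * J * (1 - μ * γ) := by
            have : 0 ≤ 1 - μ * γ := by linarith
            gcongr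
        _ = 2 * J * (μ * γ * (1 - μ * γ)) := by ring
        _ ≤ _ := by gcongr
    calc L * (1 - μ * γ * Real.log L) ≤ L * Real.exp (-(μ * γ * Real.log L)) := by
          have := Real.add_one_le_exp (-(μ * γ * Real.log L))
          gcongr
          linarith
      _ = Real.exp (Real.log L * (1 - μ * γ)) := by
          conv_lhs => rw [← Real.exp_log (by linarith : 0 < L)]
          rw [← Real.exp_add, Real.log_exp]
          ring_nf
      _ ≤ Real.exp (2 * J * Real.log (1 + μ * γ)) := Real.exp_le_exp.2 h2
      _ = _ := by
          rw [← pow_mul, ← Real.rpow_natCast, Real.rpow_def_of_pos (by linarith)]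
          push_cast
          ring_nf

/-- Every term is negative and at least as large in size as for l = -γ and minimal noise. The rounds
before m₀ give the sum of the claimed bound; the n - m₀ later ones form a geometric series whose
amplification nearly reaches L. -/
lemma sum_expanding_le {l γ μ y N Pmax : ℝ} {a p : ℕ → ℝ} (hμ : 0 < μ) (hγ : 0 < γ) (hl : l ≤ -γ)
    {K n m₀ : ℕ} (hy : 0 ≤ y) (hK : 1 ≤ y * K ^ 2) (hK0 : 0 < K) (hN : 0 ≤ N) (hP : 0 < Pmax)
    (hp : ∀ m < n, 0 < p m) (hpm : ∀ m < n, p m ≤ Pmax)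
    (ha : ∀ m < n, y * (N / (2 * p m)) ≤ a m) (hm₀ : m₀ ≤ n) {L : ℝ} (hL : 1 ≤ L)
    (hJ : 1 / (2 * μ * γ) * Real.log L ≤ (n - m₀ : ℕ)) :
    ∑ m ∈ Finset.range n, ((1 - μ * l) ^ 2) ^ (n - 1 - m) * (l * μ ^ 2 / 2 * a m) ≤
      -(μ / 4 * (μ * γ * ∑ m ∈ Finset.range m₀, (1 + μ * γ) ^ (2 * (n - m - 1)) * N / (K ^ 2 * p m)
        + y * (N / Pmax) * ((L - 1) / 2 - μ * γ * (L * (1 + Real.log L))))) := by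
  have hx : 0 < μ * γ := mul_pos hμ hγ
  have hlog : 0 ≤ Real.log L := Real.log_nonneg hL
  set r := (1 + μ * γ) ^ 2 with hr
  have hr1 : 1 < r := by rw [hr]; nlinarith
  have hterm : ∀ m < n, ((1 - μ * l) ^ 2) ^ (n - 1 - m) * (l * μ ^ 2 / 2 * a m)
      ≤ -(μ / 4 * (μ * γ * (r ^ (n - 1 - m) * (y * (N / p m))))) := by
    intro m hm
    have hpm' := hp m hm
    have h1 : r ≤ (1 - μ * l) ^ 2 := by
      rw [hr]
      have : μ * γ ≤ -(μ * l) := by nlinarith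
      gcongr
      linarith
    have h2 : r ^ (n - 1 - m) * (γ * μ ^ 2 / 2 * (y * (N / (2 * p m))))
        ≤ ((1 - μ * l) ^ 2) ^ (n - 1 - m) * ((-l) * μ ^ 2 / 2 * a m) := by
      have := ha m hm
      have : γ ≤ -l := by linarith
      gcongr
      have : 0 ≤ -l := by linarith
      positivity
    have h3 : r ^ (n - 1 - m) * (γ * μ ^ 2 / 2 * (y * (N / (2 * p m))))
        = μ / 4 * (μ * γ * (r ^ (n - 1 - m) * (y * (N / p m)))) := by
      field_simp
      ring
    linarith
  refine (Finset.sum_le_sum fun m hm => hterm m (Finset.mem_range.1 hm)).trans ?_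
  rw [Finset.sum_neg_distrib, ← Finset.mul_sum, ← Finset.mul_sum]
  refine neg_le_neg (mul_le_mul_of_nonneg_left ?_ (by positivity))
  rw [← Finset.sum_range_add_sum_Ico _ hm₀, mul_add (μ * γ) (Finset.sum _ _)]
  refine add_le_add (mul_le_mul_of_nonneg_left (Finset.sum_le_sum fun m hm => ?_) hx.le) ?_
  · have hm' : m < n := (Finset.mem_range.1 hm).trans_le hm₀
    have hpm' := hp m hm'
    rw [pow_mul, show n - m - 1 = n - 1 - m by omega, mul_div_assoc]
    refine mul_le_mul_of_nonneg_left ?_ (by positivity)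
    have hK' : (0 : ℝ) < (K : ℝ) ^ 2 := by positivity
    calc N / (K ^ 2 * p m) = ((K : ℝ) ^ 2)⁻¹ * (N / p m) := by field_simp
      _ ≤ y * (N / p m) := by
        have : ((K : ℝ) ^ 2)⁻¹ ≤ y := by
          rw [inv_le_iff_one_le_mul₀ hK']; exact hK
        gcongr
  · set J := n - m₀ with hJ'
    have hgeom : ∑ m ∈ Finset.Ico m₀ n, r ^ (n - 1 - m) = (r ^ J - 1) / (r - 1) := by
      rw [← geom_sum_eq hr1.ne', Finset.sum_Ico_eq_sum_range, ← Finset.sum_range_reflect]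
      refine Finset.sum_congr rfl fun j hj => ?_
      have := Finset.mem_range.1 hj
      congr 1
      omega
    have hpow := le_pow_of_log_le hμ hγ hL hJ
    have hrJ : 1 ≤ r ^ J := one_le_pow₀ hr1.le
    -- As r - 1 = μγ(2 + μγ), the right side is (r^J - 1)/(2 + μγ); the subtracted term covers both
    -- the denominator's excess over 2 and the defect of r^J below L.
    have h1 : (L - 1) / 2 - μ * γ * (L * (1 + Real.log L)) ≤ μ * γ * ((r ^ J - 1) / (r - 1)) := by
      rw [show r - 1 = μ * γ * (2 + μ * γ) by rw [hr]; ring]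
      rw [show μ * γ * ((r ^ J - 1) / (μ * γ * (2 + μ * γ))) = (r ^ J - 1) / (2 + μ * γ) by
        field_simp, le_div_iff₀ (by linarith)]
      have hLl : 0 ≤ L * Real.log L := by positivity
      have hLx : 0 ≤ μ * γ * (L * Real.log L) := by positivity
      nlinarith [mul_nonneg hx.le (mul_nonneg hx.le hLl), mul_pos hx hx]
    have h2 : ∑ m ∈ Finset.Ico m₀ n, r ^ (n - 1 - m) * (y * (N / Pmax))
        ≤ ∑ m ∈ Finset.Ico m₀ n, r ^ (n - 1 - m) * (y * (N / p m)) := by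
      refine Finset.sum_le_sum fun m hm => ?_
      have hm' := (Finset.mem_Ico.1 hm).2
      have := hp m hm'
      have := hpm m hm'
      gcongr
    rw [← Finset.sum_mul, hgeom] at h2
    calc y * (N / Pmax) * ((L - 1) / 2 - μ * γ * (L * (1 + Real.log L)))
        ≤ y * (N / Pmax) * (μ * γ * ((r ^ J - 1) / (r - 1))) := by gcongr
      _ = μ * γ * ((r ^ J - 1) / (r - 1) * (y * (N / Pmax))) := by ring
      _ ≤ _ := by gcongr

variable {K c : ℕ} {ζ κ ν σ Pmin Pmax γ β μ : ℝ}

lemma Vmin_pos (hK : 0 < K) (hν : 0 < ν) (hσ : 0 < σ) (hP : 0 < Pmax) : 0 < Vmin K ν σ Pmax := by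
  unfold Vmin; positivity

lemma Vmax_pos (hK : 0 < K) (hν : 0 < ν) (hσ : 0 < σ) (hP : 0 < Pmin) (hζ : 0 < ζ) :
    0 < Vmax K ζ κ ν σ Pmin := by
  unfold Vmax; positivity

lemma one_lt_escapeFactor (hK : 0 < K) (hν : 0 < ν) (hσ : 0 < σ) (hPmin : 0 < Pmin)
    (hP : 0 < Pmax) (hζ : 0 < ζ) (hc : 0 < c) : 1 < escapeFactor K c ζ κ ν σ Pmin Pmax := by
  have h1 := Vmin_pos hK hν hσ hP
  have h2 := Vmax_pos (κ := κ) hK hν hσ hPmin hζ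
  unfold escapeFactor
  have : 0 < 6 * c * (Vmax K ζ κ ν σ Pmin / Vmin K ν σ Pmax) := by positivity
  linarith

lemma reductionBound_eq (p : ℕ → ℝ) (n : ℕ) :
    reductionBound K c ζ κ ν σ Pmin Pmax γ μ p n = μ / 4 * (Vmax K ζ κ ν σ Pmin +
      μ * γ * ∑ m ∈ Finset.range ⌊(n : ℝ) - Nmax K c ζ κ ν σ Pmin Pmax γ μ⌋₊,
        (1 + μ * γ) ^ (2 * (n - m - 1)) * (ν ^ 2 * σ ^ 2) / ((K : ℝ) ^ 2 * p m)) := by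
  simp only [reductionBound, Vmax, ← mul_assoc]
  ring

lemma Nmax_nonneg (hK : 0 < K) (hν : 0 < ν) (hσ : 0 < σ) (hPmin : 0 < Pmin)
    (hP : 0 < Pmax) (hζ : 0 < ζ) (hγ : 0 < γ) (hμ : 0 < μ) :
    0 ≤ Nmax K c ζ κ ν σ Pmin Pmax γ μ := by
  have h1 := Vmin_pos hK hν hσ hP
  have h2 := Vmax_pos (κ := κ) hK hν hσ hPmin hζ
  unfold Nmax
  have : 0 ≤ Real.log (6 * c * (Vmax K ζ κ ν σ Pmin / Vmin K ν σ Pmax) + 1) := by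
    apply Real.log_nonneg
    have : 0 ≤ 6 * c * (Vmax K ζ κ ν σ Pmin / Vmin K ν σ Pmax) := by positivity
    linarith
  positivity

lemma floor_sub_Nmax_le (hK : 0 < K) (hν : 0 < ν) (hσ : 0 < σ) (hPmin : 0 < Pmin)
    (hP : 0 < Pmax) (hζ : 0 < ζ) (hγ : 0 < γ) (hμ : 0 < μ) (n : ℕ) :
    ⌊(n : ℝ) - Nmax K c ζ κ ν σ Pmin Pmax γ μ⌋₊ ≤ n := by
  have := Nmax_nonneg (κ := κ) (c := c) hK hν hσ hPmin hP hζ hγ hμ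
  exact Nat.floor_le_of_le (by linarith)

/-- Supplies the constant R of the dichotomy: even the exponentially weighted sum is O(1/μ) over a
bounded time. -/
lemma reductionBound_le (hK : 0 < K) (hν : 0 < ν) (hσ : 0 < σ) (hPmin : 0 < Pmin)
    (hP : 0 < Pmax) (hζ : 0 < ζ) (hγ : 0 < γ) (hμ : 0 < μ) {T : ℝ} {n : ℕ} (hn : n * μ ≤ T)
    {p : ℕ → ℝ} (hp : ∀ m < n, Pmin ≤ p m) :
    reductionBound K c ζ κ ν σ Pmin Pmax γ μ p n ≤
      (Vmax K ζ κ ν σ Pmin + γ * T * Real.exp (2 * γ * T) * (ν ^ 2 * σ ^ 2 / Pmin)) / 4 * μ := by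
  rw [reductionBound_eq, show ∀ x : ℝ, x / 4 * μ = μ / 4 * x from fun x => by ring]
  refine mul_le_mul_of_nonneg_left (add_le_add le_rfl ?_) (by positivity)
  have hfl := floor_sub_Nmax_le (κ := κ) (c := c) hK hν hσ hPmin hP hζ hγ hμ n
  set m₀ := ⌊(n : ℝ) - Nmax K c ζ κ ν σ Pmin Pmax γ μ⌋₊
  have hT : 0 ≤ T := le_trans (by positivity) hn
  have hK1 : (1 : ℝ) ≤ (K : ℝ) ^ 2 := one_le_pow₀ (by exact_mod_cast hK)
  calc μ * γ * ∑ m ∈ Finset.range m₀,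
        (1 + μ * γ) ^ (2 * (n - m - 1)) * (ν ^ 2 * σ ^ 2) / ((K : ℝ) ^ 2 * p m)
      ≤ μ * γ * ∑ m ∈ Finset.range m₀, Real.exp (2 * γ * T) * (ν ^ 2 * σ ^ 2 / Pmin) := by
        refine mul_le_mul_of_nonneg_left (Finset.sum_le_sum fun m hm => ?_) (by positivity)
        have hm' : m < n := (Finset.mem_range.1 hm).trans_le hfl
        rw [mul_div_assoc]
        have h1 : (1 + μ * γ) ^ (2 * (n - m - 1)) ≤ Real.exp (2 * γ * T) := by
          have a1 : 1 + μ * γ ≤ Real.exp (μ * γ) := by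
            rw [add_comm]; exact Real.add_one_le_exp _
          calc (1 + μ * γ) ^ (2 * (n - m - 1)) ≤ Real.exp (μ * γ) ^ (2 * (n - m - 1)) := by gcongr
            _ = Real.exp (((2 * (n - m - 1) : ℕ) : ℝ) * (μ * γ)) := by rw [Real.exp_nat_mul]
            _ ≤ Real.exp (2 * γ * T) := by
              refine Real.exp_le_exp.2 ?_
              have h1 : ((2 * (n - m - 1) : ℕ) : ℝ) ≤ 2 * n := by exact_mod_cast (by omega)
              calc ((2 * (n - m - 1) : ℕ) : ℝ) * (μ * γ) ≤ 2 * n * (μ * γ) := by gcongr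
                _ = 2 * γ * (n * μ) := by ring
                _ ≤ 2 * γ * T := by gcongr
        have h2 : ν ^ 2 * σ ^ 2 / ((K : ℝ) ^ 2 * p m) ≤ ν ^ 2 * σ ^ 2 / Pmin := by
          have := hp m hm'
          have : Pmin ≤ (K : ℝ) ^ 2 * p m := by nlinarith
          gcongr
        have hpm : 0 < p m := hPmin.trans_le (hp m hm')
        gcongr
    _ = γ * (m₀ * μ) * Real.exp (2 * γ * T) * (ν ^ 2 * σ ^ 2 / Pmin) := by
        rw [Finset.sum_const, Finset.card_range, nsmul_eq_mul]; ring
    _ ≤ γ * T * Real.exp (2 * γ * T) * (ν ^ 2 * σ ^ 2 / Pmin) := by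
        have : (m₀ : ℝ) * μ ≤ T :=
          (mul_le_mul_of_nonneg_right (by exact_mod_cast hfl) hμ.le).trans hn
        gcongr

lemma sum_eigenvalues_le_neg_reductionBound {ι : Type*} [Fintype ι] (hι : Fintype.card ι = 2 * c)
    (hK : 0 < K) (hν : 0 < ν) (hσ : 0 < σ) (hPmin : 0 < Pmin) (hP : Pmin ≤ Pmax) (hζ : 0 < ζ)
    (hζ1 : ζ ≤ 1) (hγ : 0 < γ) (hμ : 0 < μ) (hβ : 0 ≤ β) (hβμ : β * μ ≤ 1 / 2)
    {y : ℝ} (hy : 1 ≤ y * (K : ℝ) ^ 2) (hy1 : y ≤ 1) {l : ι → ℝ}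
    (hl : ∀ i, l i ≤ β) {i₀ : ι} (hi₀ : l i₀ ≤ -γ) {n : ℕ} {p : ℕ → ℝ}
    (hp : ∀ m < n, p m ∈ Set.Icc Pmin Pmax) {a : ι → ℕ → ℝ}
    (ha : ∀ i, ∀ m < n, y * (ν ^ 2 * σ ^ 2 / (2 * p m)) ≤ a i m)
    (ha' : ∀ i, ∀ m < n, a i m ≤ y * (K * κ ^ 2 + ν ^ 2 * σ ^ 2 / (2 * p m)))
    (hn : Nmax K c ζ κ ν σ Pmin Pmax γ μ < n) :
    ∑ i, ∑ m ∈ Finset.range n,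
        ((1 - μ * l i) ^ 2) ^ (n - 1 - m) * (l i * μ ^ 2 / 2 * a i m) ≤
      -reductionBound K c ζ κ ν σ Pmin Pmax γ μ p n - μ / 4 * Vmax K ζ κ ν σ Pmin
        + discretizationConst K c ζ κ ν σ Pmin Pmax γ β * μ ^ 2 := by
  classical
  have hPm : 0 < Pmax := hPmin.trans_le hP
  have hy0 : 0 < y := by
    by_contra! hneg
    have : y * (K : ℝ) ^ 2 ≤ 0 := mul_nonpos_of_nonpos_of_nonneg hneg (by positivity)
    linarith
  have hc : 0 < c := by
    have := Fintype.card_pos_iff.2 ⟨i₀⟩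
    omega
  have hV := Vmax_pos (κ := κ) hK hν hσ hPmin hζ
  have hVm := Vmin_pos hK hν hσ hPm
  have hNn := Nmax_nonneg (κ := κ) (c := c) hK hν hσ hPmin hPm hζ hγ hμ
  have hfl := floor_sub_Nmax_le (κ := κ) (c := c) hK hν hσ hPmin hPm hζ hγ hμ n
  rw [reductionBound_eq]
  set m₀ := ⌊(n : ℝ) - Nmax K c ζ κ ν σ Pmin Pmax γ μ⌋₊ with hm₀
  have hL := (one_lt_escapeFactor (κ := κ) hK hν hσ hPmin hPm hζ hc).le
  set L := escapeFactor K c ζ κ ν σ Pmin Pmax with hLdef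
  have hlogL := Real.log_nonneg hL
  set V := Vmax K ζ κ ν σ Pmin with hVdef
  have hJ : 1 / (2 * μ * γ) * Real.log L ≤ (n - m₀ : ℕ) := by
    have h1 : (m₀ : ℝ) ≤ n - Nmax K c ζ κ ν σ Pmin Pmax γ μ := Nat.floor_le (by linarith)
    rw [Nat.cast_sub hfl]
    have : 1 / (2 * μ * γ) * Real.log L = Nmax K c ζ κ ν σ Pmin Pmax γ μ := rfl
    linarith
  have hKr : (1 : ℝ) ≤ K := by exact_mod_cast hK
  have hneg := sum_expanding_le hμ hγ hi₀ hy0.le hy hK (by positivity) hPm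
    (fun m hm => hPmin.trans_le (hp m hm).1) (fun m hm => (hp m hm).2) (ha i₀) hfl hL hJ
  set S := ∑ m ∈ Finset.range m₀,
    (1 + μ * γ) ^ (2 * (n - m - 1)) * (ν ^ 2 * σ ^ 2) / ((K : ℝ) ^ 2 * p m)
  -- The largest directional variance, without its factor y. Of the activation probability only 0 <
  -- ζ ≤ 1 is used.
  have hv : K * κ ^ 2 + ν ^ 2 * σ ^ 2 / (2 * Pmin) ≤ (K : ℝ) ^ 2 * V := by
    rw [hVdef, Vmax, mul_add]
    refine add_le_add ?_ ?_
    · have : (K : ℝ) ^ 2 * (κ ^ 2 / (K * ζ)) = K * κ ^ 2 / ζ := by field_simp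
      rw [this, le_div_iff₀ hζ]
      exact mul_le_of_le_one_right (by positivity) hζ1
    · have : (K : ℝ) ^ 2 * (3 * ν ^ 2 * σ ^ 2 / (K ^ 2 * ζ ^ 2 * Pmin))
          = 3 * (ν ^ 2 * σ ^ 2) / (ζ ^ 2 * Pmin) := by field_simp
      rw [this]
      have : ζ ^ 2 ≤ 1 := pow_le_one₀ hζ.le hζ1
      have h1 : ζ ^ 2 * Pmin ≤ 2 * Pmin := by nlinarith
      have h2 : ν ^ 2 * σ ^ 2 ≤ 3 * (ν ^ 2 * σ ^ 2) := by
        have : 0 ≤ ν ^ 2 * σ ^ 2 := by positivity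
        linarith
      gcongr
  have hpos : ∀ i, ∑ m ∈ Finset.range n,
      ((1 - μ * l i) ^ 2) ^ (n - 1 - m) * (l i * μ ^ 2 / 2 * a i m)
        ≤ μ / 4 * ((1 + β * μ) * (y * (K ^ 2 * V))) := by
    intro i
    refine sum_contracting_le hμ hβ (hl i) hβμ le_rfl (fun m hm => ?_) (by positivity)
      fun m hm => (ha' i m hm).trans ?_
    · have := hPmin.trans_le (hp m hm).1
      exact le_trans (by positivity) (ha i m hm)
    · refine mul_le_mul_of_nonneg_left (le_trans ?_ hv) hy0.le
      have := (hp m hm).1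
      gcongr
  rw [← Finset.add_sum_erase _ _ (Finset.mem_univ i₀)]
  have hrest := Finset.sum_le_sum fun i (_ : i ∈ Finset.univ.erase i₀) => hpos i
  rw [Finset.sum_const, Finset.card_erase_of_mem (Finset.mem_univ _), Finset.card_univ, hι,
    nsmul_eq_mul, Nat.cast_sub (by omega)] at hrest
  push_cast at hrest
  refine (add_le_add hneg hrest).trans ?_
  have hY : 1 ≤ y * (K : ℝ) ^ 2 := hy
  have hYK : y * (K : ℝ) ^ 2 ≤ (K : ℝ) ^ 2 := mul_le_of_le_one_left (by positivity) hy1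
  set Y := y * (K : ℝ) ^ 2
  -- This is where the 6c in `Nmax` is spent: `Vmin` equals ν²σ²/(K²Pmax), so the ratio V_max/V_min
  -- turns the gain into a multiple of V.
  have e1 : y * (ν ^ 2 * σ ^ 2 / Pmax) * ((L - 1) / 2) = 3 * c * Y * V := by
    have : L - 1 = 6 * c * (V / (ν ^ 2 * σ ^ 2 / (K ^ 2 * Pmax))) := by
      rw [hLdef, escapeFactor, Vmin]; ring
    rw [this]
    simp only [Y]
    field_simp
    ring
  have e2 : y * (ν ^ 2 * σ ^ 2 / Pmax) * (μ * γ * (L * (1 + Real.log L)))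
      ≤ μ * (γ * (ν ^ 2 * σ ^ 2 / Pmax) * (L * (1 + Real.log L))) := by
    have : 0 ≤ (ν ^ 2 * σ ^ 2 / Pmax) * (μ * γ * (L * (1 + Real.log L))) := by positivity
    have := mul_le_of_le_one_left this hy1
    linarith
  have hcr : (1 : ℝ) ≤ c := by exact_mod_cast hc
  have e3 : (2 * c - 1) * (β * μ * (Y * V)) ≤ μ * (2 * c * β * K ^ 2 * V) := by
    calc (2 * c - 1) * (β * μ * (Y * V)) ≤ (2 * c) * (β * μ * ((K : ℝ) ^ 2 * V)) := by
          gcongr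
          linarith
      _ = _ := by ring
  -- 3c - (2c - 1) = c + 1 ≥ 2: one V for the bound and one as surplus.
  have e4 : 2 * V ≤ (c + 1) * (Y * V) := by
    have : V ≤ Y * V := le_mul_of_one_le_left hV.le hY
    nlinarith
  have e5 : 0 ≤ discretizationConst K c ζ κ ν σ Pmin Pmax γ β := by
    unfold discretizationConst
    have : 0 ≤ L * (1 + Real.log L) := by positivity
    have : 0 ≤ Vmax K ζ κ ν σ Pmin := hV.le
    positivity
  have key : -(μ * γ * S + y * (ν ^ 2 * σ ^ 2 / Pmax)
        * ((L - 1) / 2 - μ * γ * (L * (1 + Real.log L))))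
      + (2 * c - 1) * ((1 + β * μ) * (Y * V))
      ≤ -(V + μ * γ * S) - V + discretizationConst K c ζ κ ν σ Pmin Pmax γ β * μ := by
    unfold discretizationConst
    rw [← hLdef, ← hVdef, mul_sub, e1]
    linarith
  have hfin := mul_le_mul_of_nonneg_left key (by positivity : 0 ≤ μ / 4)
  have e6 : discretizationConst K c ζ κ ν σ Pmin Pmax γ β * μ ^ 2 / 4
      ≤ discretizationConst K c ζ κ ν σ Pmin Pmax γ β * μ ^ 2 :=
    div_le_self (by positivity) (by norm_num)
  have e7 : y * (K ^ 2 * V) = Y * V := by simp only [Y]; ring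
  rw [e7]
  linarith

end ReductionBound

/-! ### Moments of the complex Gaussian law -/

section ComplexGaussian

instance isProbabilityMeasure_complexGaussian (v : ℝ≥0) :
    IsProbabilityMeasure (complexGaussian v) :=
  Measure.isProbabilityMeasure_map Complex.measurableEquivRealProd.symm.measurable.aemeasurable

lemma complexGaussian_map (v : ℝ≥0) :
    (complexGaussian v).map Complex.measurableEquivRealProd
      = (gaussianReal 0 (v / 2)).prod (gaussianReal 0 (v / 2)) := by
  rw [complexGaussian, Measure.map_map (by fun_prop) (by fun_prop)]
  simp

lemma measurePreserving_complexGaussian (v : ℝ≥0) :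
    MeasurePreserving Complex.measurableEquivRealProd (complexGaussian v)
      ((gaussianReal 0 (v / 2)).prod (gaussianReal 0 (v / 2))) :=
  ⟨Complex.measurableEquivRealProd.measurable, complexGaussian_map v⟩

lemma measurePreserving_re_complexGaussian (v : ℝ≥0) :
    MeasurePreserving Complex.re (complexGaussian v) (gaussianReal 0 (v / 2)) :=
  measurePreserving_fst.comp (measurePreserving_complexGaussian v)

lemma measurePreserving_im_complexGaussian (v : ℝ≥0) :
    MeasurePreserving Complex.im (complexGaussian v) (gaussianReal 0 (v / 2)) :=
  measurePreserving_snd.comp (measurePreserving_complexGaussian v)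

lemma memLp_re_complexGaussian (v p : ℝ≥0) : MemLp Complex.re p (complexGaussian v) :=
  (memLp_id_gaussianReal p).comp_measurePreserving (measurePreserving_re_complexGaussian v)

lemma memLp_im_complexGaussian (v p : ℝ≥0) : MemLp Complex.im p (complexGaussian v) :=
  (memLp_id_gaussianReal p).comp_measurePreserving (measurePreserving_im_complexGaussian v)

lemma memLp_id_complexGaussian (v p : ℝ≥0) : MemLp (fun z : ℂ => z) p (complexGaussian v) := by
  have h := (((memLp_re_complexGaussian v p).ofReal (K := ℂ)).add
    (((memLp_im_complexGaussian v p).ofReal (K := ℂ)).const_mul Complex.I))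
  refine h.congr_norm aestronglyMeasurable_id (.of_forall fun z => ?_)
  congr 1
  rw [Pi.add_apply, mul_comm]
  exact Complex.re_add_im z

lemma inner_complex_eq (a z : ℂ) : inner ℝ a z = a.re * z.re + a.im * z.im := by
  rw [Complex.inner]
  simp
  ring

lemma memLp_inner_complexGaussian (v p : ℝ≥0) (a : ℂ) :
    MemLp (fun z : ℂ => inner ℝ a z) p (complexGaussian v) := by
  simp_rw [inner_complex_eq]
  exact ((memLp_re_complexGaussian v p).const_mul _).add
    ((memLp_im_complexGaussian v p).const_mul _)

lemma integral_inner_complexGaussian (v : ℝ≥0) (a : ℂ) :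
    ∫ z, inner ℝ a z ∂(complexGaussian v) = 0 := by
  have e1 : ∫ z, Complex.re z ∂(complexGaussian v) = 0 := by
    rw [← integral_id_gaussianReal (μ := 0) (v := v / 2),
      ← (measurePreserving_re_complexGaussian v).map_eq,
      integral_map (by fun_prop) (by fun_prop)]
  have e2 : ∫ z, Complex.im z ∂(complexGaussian v) = 0 := by
    rw [← integral_id_gaussianReal (μ := 0) (v := v / 2),
      ← (measurePreserving_im_complexGaussian v).map_eq,
      integral_map (by fun_prop) (by fun_prop)]
  simp_rw [inner_complex_eq]
  rw [integral_add (((memLp_re_complexGaussian v 1).integrable le_rfl).const_mul _)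
    (((memLp_im_complexGaussian v 1).integrable le_rfl).const_mul _), integral_const_mul,
    integral_const_mul, e1, e2]
  simp

lemma integral_sq_gaussianReal_zero (v : ℝ≥0) : ∫ x, x ^ 2 ∂(gaussianReal 0 v) = v := by
  have := variance_of_integral_eq_zero (X := id) (μ := gaussianReal 0 v) aemeasurable_id
    (by simp [integral_id_gaussianReal])
  rw [variance_id_gaussianReal] at this
  simpa using this.symm

/-- Real and imaginary parts are independent with variance v/2 each. This half is the 2 in the term
ν²σ²/(2p) of the directional variances. -/
lemma integral_inner_sq_complexGaussian (v : ℝ≥0) (a : ℂ) :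
    ∫ z, inner ℝ a z ^ 2 ∂(complexGaussian v) = ‖a‖ ^ 2 * (v / 2) := by
  set γ := gaussianReal 0 (v / 2) with hγ
  have h1 : Integrable (fun x : ℝ => x) γ := (memLp_id_gaussianReal 1).integrable le_rfl
  have h2 : Integrable (fun x : ℝ => x ^ 2) γ := (memLp_id_gaussianReal 2).integrable_sq
  have s2 : ∫ x, x ^ 2 ∂γ = v / 2 := by
    rw [hγ, integral_sq_gaussianReal_zero]; simp
  have s1 : ∫ x, x ∂γ = 0 := by rw [hγ, integral_id_gaussianReal]
  have e : ∫ z, inner ℝ a z ^ 2 ∂(complexGaussian v)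
      = ∫ x : ℝ × ℝ, (a.re ^ 2 * x.1 ^ 2 + 2 * a.re * a.im * (x.1 * x.2) + a.im ^ 2 * x.2 ^ 2)
        ∂(γ.prod γ) := by
    rw [← complexGaussian_map, integral_map (by fun_prop)
      (by exact Measurable.aestronglyMeasurable (by fun_prop))]
    refine integral_congr_ae (.of_forall fun z => ?_)
    simp only [inner_complex_eq, Complex.measurableEquivRealProd_apply]
    ring
  have i1 := (h2.comp_fst γ).const_mul (a.re ^ 2)
  have i2 := (h1.mul_prod h1).const_mul (2 * a.re * a.im)
  have i3 := (h2.comp_snd γ).const_mul (a.im ^ 2)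
  have e1 := integral_add (i1.add i2) i3
  have e2 := integral_add i1 i2
  simp only [Pi.add_apply] at e1 e2
  rw [e, e1, e2, integral_const_mul, integral_const_mul,
    integral_const_mul, integral_prod_mul (fun x : ℝ => x) (fun x : ℝ => x),
    integral_fun_fst (fun x : ℝ => x ^ 2), integral_fun_snd (fun x : ℝ => x ^ 2), s1, s2]
  rw [← Complex.normSq_eq_norm_sq, Complex.normSq_apply]
  simp
  ring

lemma complexGaussian_singleton (v : ℝ≥0) (hv : v ≠ 0) (z : ℂ) : complexGaussian v {z} = 0 := by
  have hv' : v / 2 ≠ 0 := by positivity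
  have := nullSingletonClass_gaussianReal (μ := 0) hv'
  refine measure_mono_null (t := Complex.re ⁻¹' {z.re}) (by simp) ?_
  rw [(measurePreserving_re_complexGaussian v).measure_preimage (by simp)]
  simp

lemma complexGaussian_setOf_le_norm_sq_pos {v : ℝ≥0} (hv : v ≠ 0) (G : ℝ) :
    0 < complexGaussian v {h | G ≤ ‖h‖ ^ 2} := by
  have hv' : v / 2 ≠ 0 := by positivity
  have hpos : 0 < gaussianReal 0 (v / 2) (Set.Ici (Real.sqrt |G|)) := by
    rw [pos_iff_ne_zero]
    intro h0
    have := gaussianReal_absolutelyContinuous' 0 hv' h0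
    simp at this
  rw [← (measurePreserving_re_complexGaussian v).measure_preimage
    measurableSet_Ici.nullMeasurableSet] at hpos
  refine hpos.trans_le (measure_mono fun z hz => ?_)
  have hz' : Real.sqrt |G| ≤ z.re := hz
  have h1 : Real.sqrt |G| ≤ ‖z‖ := hz'.trans (Complex.re_le_norm z)
  calc G ≤ |G| := le_abs_self G
    _ = Real.sqrt |G| ^ 2 := (Real.sq_sqrt (abs_nonneg G)).symm
    _ ≤ ‖z‖ ^ 2 := by gcongr

lemma activationProb_pos (G : ℝ) : 0 < activationProb G :=
  ENNReal.toReal_pos (complexGaussian_setOf_le_norm_sq_pos one_ne_zero G).ne' (measure_ne_top _ _)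

lemma activationProb_le_one (G : ℝ) : activationProb G ≤ 1 := measureReal_le_one

end ComplexGaussian

/-! ### Exchangeability of the conditioned gains and sampling of the active devices -/

section GainLaw

variable {K : ℕ} {G : ℝ}

lemma mem_activeSet {h : Fin K → ℂ} {k : Fin K} : k ∈ activeSet G h ↔ G ≤ ‖h k‖ ^ 2 := by
  simp [activeSet]

/-- The weight of device `k` in the average over the active devices. -/
noncomputable def activeWeight (G : ℝ) (h : Fin K → ℂ) (k : Fin K) : ℝ :=
  if G ≤ ‖h k‖ ^ 2 then ((activeSet G h).card : ℝ)⁻¹ else 0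

lemma measurableSet_active (k : Fin K) : MeasurableSet {h : Fin K → ℂ | G ≤ ‖h k‖ ^ 2} :=
  measurableSet_le measurable_const (by fun_prop)

lemma measurable_card_activeSet :
    Measurable fun h : Fin K → ℂ => ((activeSet G h).card : ℝ) := by
  have : (fun h : Fin K → ℂ => ((activeSet G h).card : ℝ))
      = fun h => ∑ k, if G ≤ ‖h k‖ ^ 2 then (1 : ℝ) else 0 := by
    funext h
    rw [activeSet, Finset.card_filter]
    push_cast
    rfl
  rw [this]
  exact Finset.measurable_sum _ fun k _ =>
    Measurable.ite (measurableSet_active k) measurable_const measurable_const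

lemma measurable_activeWeight (k : Fin K) :
    Measurable fun h : Fin K → ℂ => activeWeight G h k :=
  Measurable.ite (measurableSet_active k) measurable_card_activeSet.inv measurable_const

lemma inv_card_nonneg (h : Fin K → ℂ) : 0 ≤ ((activeSet G h).card : ℝ)⁻¹ := by positivity

lemma inv_card_le_one (h : Fin K → ℂ) : ((activeSet G h).card : ℝ)⁻¹ ≤ 1 := Nat.cast_inv_le_one _

lemma activeWeight_nonneg (h : Fin K → ℂ) (k : Fin K) : 0 ≤ activeWeight G h k := by
  unfold activeWeight; split_ifs <;> positivity

lemma activeWeight_le (h : Fin K → ℂ) (k : Fin K) :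
    activeWeight G h k ≤ ((activeSet G h).card : ℝ)⁻¹ := by
  unfold activeWeight; split_ifs <;> [exact le_rfl; positivity]

lemma activeWeight_le_one (h : Fin K → ℂ) (k : Fin K) : activeWeight G h k ≤ 1 :=
  (activeWeight_le h k).trans (inv_card_le_one h)

lemma sum_activeWeight_mul {R : Type*} [Field R] [Algebra ℝ R] (h : Fin K → ℂ) (t : Fin K → R) :
    ∑ k, algebraMap ℝ R (activeWeight G h k) * t k
      = ((activeSet G h).card : R)⁻¹ * ∑ k ∈ activeSet G h, t k := by
  rw [Finset.mul_sum, activeSet, Finset.sum_filter]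
  refine Finset.sum_congr rfl fun k _ => ?_
  unfold activeWeight activeSet
  split_ifs <;> simp

lemma card_activeSet_comp (h : Fin K → ℂ) (π : Equiv.Perm (Fin K)) :
    (activeSet G (h ∘ π)).card = (activeSet G h).card :=
  Finset.card_equiv π fun k => by simp [mem_activeSet]

lemma activeWeight_comp (h : Fin K → ℂ) (π : Equiv.Perm (Fin K)) (k : Fin K) :
    activeWeight G (h ∘ π) k = activeWeight G h (π k) := by
  simp [activeWeight, card_activeSet_comp]

lemma measurePreserving_comp_perm {α : Type*} [MeasurableSpace α] (μ : Measure α)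
    [IsProbabilityMeasure μ] (π : Equiv.Perm (Fin K)) :
    MeasurePreserving (fun h : Fin K → α => h ∘ π) (Measure.pi fun _ => μ)
      (Measure.pi fun _ => μ) := by
  have hm : Measurable (fun h : Fin K → α => h ∘ π) :=
    measurable_pi_lambda _ fun i => measurable_pi_apply _
  refine ⟨hm, (Measure.pi_eq fun s hs => ?_).symm⟩
  rw [Measure.map_apply hm (MeasurableSet.univ_pi hs)]
  have : (fun h : Fin K → α => h ∘ π) ⁻¹' Set.univ.pi s
      = Set.univ.pi fun j => s (π.symm j) := by
    ext h
    simp only [Set.mem_preimage, Set.mem_univ_pi, Function.comp_apply]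
    exact ⟨fun H j => by simpa using H (π.symm j), fun H i => by simpa using H (π i)⟩
  rw [this, Measure.pi_pi]
  exact Equiv.prod_comp π.symm fun i => μ (s i)

lemma measurableSet_activeSet_nonempty :
    MeasurableSet {h : Fin K → ℂ | (activeSet G h).Nonempty} := by
  have : {h : Fin K → ℂ | (activeSet G h).Nonempty}
      = ⋃ k, {h : Fin K → ℂ | G ≤ ‖h k‖ ^ 2} := by
    ext h
    simp [Finset.Nonempty, mem_activeSet]
  rw [this]
  exact MeasurableSet.iUnion fun k => measurableSet_active k

lemma isProbabilityMeasure_gainLaw (hK : 0 < K) : IsProbabilityMeasure (gainLaw K G) := by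
  refine cond_isProbabilityMeasure ?_
  have h1 := complexGaussian_setOf_le_norm_sq_pos (v := 1) one_ne_zero G
  refine ne_of_gt (lt_of_lt_of_le ?_ (measure_mono (s := {h : Fin K → ℂ | G ≤ ‖h ⟨0, hK⟩‖ ^ 2})
    fun h hh => ⟨⟨0, hK⟩, mem_activeSet.2 hh⟩))
  rwa [← (measurePreserving_eval (fun _ : Fin K => complexGaussian 1) ⟨0, hK⟩).measure_preimage
    (measurableSet_le measurable_const (by fun_prop)).nullMeasurableSet] at h1

lemma ae_gainLaw_activeSet_nonempty : ∀ᵐ h ∂(gainLaw K G), (activeSet G h).Nonempty :=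
  ae_cond_mem measurableSet_activeSet_nonempty

/-- For a threshold G ≤ 0 a device with zero gain would count as active, so invertibility of the
gains must come from the absence of atoms. -/
lemma ae_gainLaw_ne_zero : ∀ᵐ h ∂(gainLaw K G), ∀ k, h k ≠ 0 := by
  refine (cond_absolutelyContinuous (μ := Measure.pi fun _ : Fin K => complexGaussian 1)).ae_le ?_
  refine Filter.eventually_all.2 fun k => ?_
  have : ∀ᵐ z ∂(complexGaussian 1), z ≠ 0 := by
    rw [ae_iff]
    simpa using complexGaussian_singleton 1 one_ne_zero 0
  exact (measurePreserving_eval (fun _ : Fin K => complexGaussian 1) k).quasiMeasurePreserving.ae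
    this

/-- The conditioning event involves only the number of active devices, so it is invariant under
permutations, as is the product law. -/
lemma measurePreserving_gainLaw_comp_perm (π : Equiv.Perm (Fin K)) :
    MeasurePreserving (fun h : Fin K → ℂ => h ∘ π) (gainLaw K G) (gainLaw K G) := by
  have h := (measurePreserving_comp_perm (complexGaussian 1) π).restrict_preimage
    (measurableSet_activeSet_nonempty (K := K) (G := G))
  have hpre : (fun h : Fin K → ℂ => h ∘ π) ⁻¹' {h | (activeSet G h).Nonempty}
      = {h | (activeSet G h).Nonempty} := by
    ext h
    simp [← Finset.card_pos, card_activeSet_comp]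
  rw [hpre] at h
  exact h.smul_measure _

/-- The second moment of the inverse number of active devices. -/
noncomputable def invCardMoment (K : ℕ) (G : ℝ) : ℝ :=
  ∫ h, (((activeSet G h).card : ℝ)⁻¹) ^ 2 ∂(gainLaw K G)

lemma integrable_of_measurable_of_abs_le {α : Type*} [MeasurableSpace α] {μ : Measure α}
    [IsFiniteMeasure μ] {f : α → ℝ} (hf : Measurable f) {c : ℝ} (h : ∀ x, |f x| ≤ c) :
    Integrable f μ :=
  (integrable_const c).mono' hf.aestronglyMeasurable (.of_forall h)

lemma integrable_inv_card_sq (hK : 0 < K) :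
    Integrable (fun h => (((activeSet G h).card : ℝ)⁻¹) ^ 2) (gainLaw K G) := by
  have := isProbabilityMeasure_gainLaw (G := G) hK
  refine integrable_of_measurable_of_abs_le (measurable_card_activeSet.inv.pow_const 2) (c := 1)
    fun h => ?_
  rw [abs_of_nonneg (by positivity)]
  exact pow_le_one₀ (inv_card_nonneg h) (inv_card_le_one h)

lemma invCardMoment_le_one (hK : 0 < K) : invCardMoment K G ≤ 1 := by
  have := isProbabilityMeasure_gainLaw (G := G) hK
  refine (integral_mono (integrable_inv_card_sq hK) (integrable_const 1) fun h =>
    pow_le_one₀ (inv_card_nonneg h) (inv_card_le_one h)).trans ?_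
  simp

lemma invCardMoment_nonneg : 0 ≤ invCardMoment K G := integral_nonneg fun h => by positivity

/-- At most K devices are active. The conditioning matters, since an empty active set would make the
inverse zero by convention. -/
lemma one_le_invCardMoment_mul (hK : 0 < K) : 1 ≤ invCardMoment K G * (K : ℝ) ^ 2 := by
  have := isProbabilityMeasure_gainLaw (G := G) hK
  have hK' : (0 : ℝ) < (K : ℝ) ^ 2 := by positivity
  rw [← inv_le_iff_one_le_mul₀ hK', invCardMoment]
  calc ((K : ℝ) ^ 2)⁻¹ = ∫ _, ((K : ℝ) ^ 2)⁻¹ ∂(gainLaw K G) := by simp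
    _ ≤ _ := by
      refine integral_mono_ae (integrable_const _) (integrable_inv_card_sq hK) ?_
      filter_upwards [ae_gainLaw_activeSet_nonempty] with h hh
      rw [← inv_pow]
      have h1 : 0 < (activeSet G h).card := Finset.card_pos.2 hh
      have h2 : (activeSet G h).card ≤ K := by
        simpa using Finset.card_le_univ (activeSet G h)
      gcongr

lemma integrable_activeWeight_mul (hK : 0 < K) (k l : Fin K) :
    Integrable (fun h => activeWeight G h k * activeWeight G h l) (gainLaw K G) := by
  have := isProbabilityMeasure_gainLaw (G := G) hK
  refine integrable_of_measurable_of_abs_le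
    ((measurable_activeWeight k).mul (measurable_activeWeight l)) (c := 1) fun h => ?_
  rw [abs_of_nonneg (mul_nonneg (activeWeight_nonneg h k) (activeWeight_nonneg h l))]
  exact mul_le_one₀ (activeWeight_le_one h k) (activeWeight_nonneg h l) (activeWeight_le_one h l)

lemma integrable_activeWeight (hK : 0 < K) (k : Fin K) :
    Integrable (fun h => activeWeight G h k) (gainLaw K G) := by
  have := isProbabilityMeasure_gainLaw (G := G) hK
  refine integrable_of_measurable_of_abs_le (measurable_activeWeight k) (c := 1) fun h => ?_
  rw [abs_of_nonneg (activeWeight_nonneg h k)]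
  exact activeWeight_le_one h k

lemma integral_activeWeight_perm (π : Equiv.Perm (Fin K)) (k : Fin K) :
    ∫ h, activeWeight G h (π k) ∂(gainLaw K G) = ∫ h, activeWeight G h k ∂(gainLaw K G) := by
  have h := measurePreserving_gainLaw_comp_perm (G := G) π
  conv_rhs => rw [← h.map_eq]
  rw [integral_map h.measurable.aemeasurable (measurable_activeWeight k).aestronglyMeasurable]
  simp_rw [activeWeight_comp]

lemma integral_activeWeight_mul_perm (π : Equiv.Perm (Fin K)) (k l : Fin K) :
    ∫ h, activeWeight G h (π k) * activeWeight G h (π l) ∂(gainLaw K G)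
      = ∫ h, activeWeight G h k * activeWeight G h l ∂(gainLaw K G) := by
  have h := measurePreserving_gainLaw_comp_perm (G := G) π
  conv_rhs => rw [← h.map_eq]
  rw [integral_map h.measurable.aemeasurable
    (f := fun h => activeWeight G h k * activeWeight G h l)
    ((measurable_activeWeight k).mul (measurable_activeWeight l)).aestronglyMeasurable]
  simp_rw [activeWeight_comp]

lemma exists_perm_pair {k l k' l' : Fin K} (h : k ≠ l) (h' : k' ≠ l') :
    ∃ π : Equiv.Perm (Fin K), π k = k' ∧ π l = l' := by
  refine ⟨(Equiv.swap k k').trans (Equiv.swap (Equiv.swap k k' l) l'), ?_, ?_⟩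
  · have h1 : k' ≠ Equiv.swap k k' l := by
      intro hh
      apply h
      have := congrArg (Equiv.swap k k') hh
      simpa using this
    simp [Equiv.swap_apply_of_ne_of_ne h1 h']
  · simp

lemma integral_sum_activeWeight_eq_zero (hK : 0 < K) {t : Fin K → ℝ} (ht : ∑ k, t k = 0) :
    ∫ h, ∑ k, activeWeight G h k * t k ∂(gainLaw K G) = 0 := by
  rw [integral_finsetSum _ fun k _ => (integrable_activeWeight hK k).mul_const _]
  simp_rw [integral_mul_const]
  have : ∀ k, ∫ h, activeWeight G h k ∂(gainLaw K G)
      = ∫ h, activeWeight G h ⟨0, hK⟩ ∂(gainLaw K G) := fun k => by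
    simpa using integral_activeWeight_perm (G := G) (Equiv.swap ⟨0, hK⟩ k) ⟨0, hK⟩
  rw [Finset.sum_congr rfl fun k _ => by rw [this k], ← Finset.mul_sum, ht, mul_zero]

/-- Sampling without replacement: the variance of the average of centred values over the active
devices is at most that of independent sampling. -/
lemma integral_sum_activeWeight_sq_le (hK : 0 < K) {t : Fin K → ℝ} (ht : ∑ k, t k = 0) :
    ∫ h, (∑ k, activeWeight G h k * t k) ^ 2 ∂(gainLaw K G) ≤
      invCardMoment K G * ∑ k, t k ^ 2 := by
  set M : Fin K → Fin K → ℝ := fun k l =>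
    ∫ h, activeWeight G h k * activeWeight G h l ∂(gainLaw K G) with hM
  have hint := fun k l => integrable_activeWeight_mul (G := G) hK k l
  have e1 : ∫ h, (∑ k, activeWeight G h k * t k) ^ 2 ∂(gainLaw K G)
      = ∑ k, ∑ l, M k l * (t k * t l) := by
    have : ∀ h : Fin K → ℂ, (∑ k, activeWeight G h k * t k) ^ 2
        = ∑ k, ∑ l, activeWeight G h k * activeWeight G h l * (t k * t l) := fun h => by
      rw [pow_two, Finset.sum_mul_sum]
      refine Finset.sum_congr rfl fun k _ => Finset.sum_congr rfl fun l _ => by ring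
    simp_rw [this]
    rw [integral_finsetSum _ fun k _ => integrable_finsetSum _ fun l _ => (hint k l).mul_const _]
    refine Finset.sum_congr rfl fun k _ => ?_
    rw [integral_finsetSum _ fun l _ => (hint k l).mul_const _]
    simp_rw [integral_mul_const, hM]
  have hM0 : ∀ k l, 0 ≤ M k l := fun k l =>
    integral_nonneg fun h => mul_nonneg (activeWeight_nonneg h k) (activeWeight_nonneg h l)
  have hdiag : ∀ k, M k k ≤ invCardMoment K G := fun k => by
    refine integral_mono (hint k k) (integrable_inv_card_sq hK) fun h => ?_
    show activeWeight G h k * activeWeight G h k ≤ _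
    rw [← pow_two]
    have := activeWeight_nonneg (G := G) h k
    have := activeWeight_le (G := G) h k
    gcongr
  -- The symmetric group acts transitively on ordered pairs of distinct devices, so exchangeability
  -- equates all off-diagonal moments. Without such a pair, q = 0 serves.
  have hoff : ∃ q, 0 ≤ q ∧ ∀ k l, k ≠ l → M k l = q := by
    by_cases hex : ∃ k l : Fin K, k ≠ l
    · obtain ⟨k, l, hkl⟩ := hex
      refine ⟨M k l, hM0 k l, fun k' l' h' => ?_⟩
      obtain ⟨π, rfl, rfl⟩ := exists_perm_pair hkl h'
      exact integral_activeWeight_mul_perm π k l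
    · push Not at hex
      exact ⟨0, le_rfl, fun k l h => absurd (hex k l) h⟩
  obtain ⟨q, hq, hoff⟩ := hoff
  -- The constant part q of the moment matrix is annihilated because the t k sum to zero.
  have e2 : ∑ k, ∑ l, M k l * (t k * t l) = ∑ k, (M k k - q) * t k ^ 2 := by
    have h1 : ∀ k, ∑ l, M k l * (t k * t l) = (M k k - q) * t k ^ 2 + q * (t k * ∑ l, t l) := by
      intro k
      have h2 : ∀ l, M k l * (t k * t l)
          = (if l = k then (M k k - q) * t k ^ 2 else 0) + q * (t k * t l) := by
        intro l
        by_cases hl : l = k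
        · subst hl; simp; ring
        · rw [hoff k l (Ne.symm hl)]; simp [hl]
      rw [Finset.sum_congr rfl fun l _ => h2 l, Finset.sum_add_distrib, Finset.sum_ite_eq',
        if_pos (Finset.mem_univ _), Finset.mul_sum, Finset.mul_sum]
    rw [Finset.sum_congr rfl fun k _ => h1 k, ht]
    simp
  rw [e1, e2, Finset.mul_sum]
  refine Finset.sum_le_sum fun k _ => mul_le_mul_of_nonneg_right ?_ (sq_nonneg _)
  linarith [hdiag k]

end GainLaw

/-! ### Mean and variance of the noise of one round in a fixed direction -/

section RoundNoise

lemma integral_sum_pi_sq {ι : Type*} [Fintype ι] {α : ι → Type*} [∀ i, MeasurableSpace (α i)]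
    {μ : ∀ i, Measure (α i)} [∀ i, IsProbabilityMeasure (μ i)] {X : ∀ i, α i → ℝ}
    (hX : ∀ i, MemLp (X i) 2 (μ i)) (h0 : ∀ i, ∫ x, X i x ∂(μ i) = 0) :
    ∫ ω, (∑ i, X i (ω i)) ^ 2 ∂(Measure.pi μ) = ∑ i, ∫ x, X i x ^ 2 ∂(μ i) := by
  have hL : ∀ i, MemLp (fun ω : ∀ i, α i => X i (ω i)) 2 (Measure.pi μ) := fun i =>
    (hX i).comp_measurePreserving (measurePreserving_eval _ i)
  have hv := variance_sum_pi hX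
  have h1 : ∫ ω, (∑ i, fun ω : ∀ i, α i => X i (ω i)) ω ∂(Measure.pi μ) = 0 := by
    simp only [Finset.sum_apply]
    rw [integral_finsetSum _ fun i _ => (hL i).integrable one_le_two]
    refine Finset.sum_eq_zero fun i _ => ?_
    rw [integral_comp_eval (hX i).1, h0]
  rw [variance_of_integral_eq_zero (memLp_finsetSum' _ fun i _ => hL i).1.aemeasurable h1] at hv
  simp_rw [fun i => variance_of_integral_eq_zero (hX i).1.aemeasurable (h0 i)] at hv
  simpa using hv

lemma integral_sum_pi {ι : Type*} [Fintype ι] {α : ι → Type*} [∀ i, MeasurableSpace (α i)]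
    {μ : ∀ i, Measure (α i)} [∀ i, IsProbabilityMeasure (μ i)] {X : ∀ i, α i → ℝ}
    (hX : ∀ i, Integrable (X i) (μ i)) :
    ∫ ω, ∑ i, X i (ω i) ∂(Measure.pi μ) = ∑ i, ∫ x, X i x ∂(μ i) := by
  rw [integral_finsetSum _ fun i _ => integrable_comp_eval (hX i)]
  exact Finset.sum_congr rfl fun i _ => integral_comp_eval (hX i).1

variable {K M c : ℕ} {G : ℝ} {σ : ℝ≥0}

/-- The component of the round noise in a fixed direction: `t s k` is the component of the data
noise of device `k` on sub-channel `s`, and `a` is the direction. -/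
noncomputable def roundNoise (G ρ : ℝ) (sub : Fin c → Fin M) (t : Fin M → Fin K → ℝ)
    (a : Fin c → ℂ) (x : (Fin M → Fin K → ℂ) × (Fin c → ℂ)) : ℝ :=
  ∑ s, ∑ k, activeWeight G (x.1 s) k * t s k
    + ρ * ∑ i, ((activeSet G (x.1 (sub i))).card : ℝ)⁻¹ * inner ℝ (a i) (x.2 i)

lemma isProbabilityMeasure_roundLaw (hK : 0 < K) :
    IsProbabilityMeasure (roundLaw K M c G σ) := by
  have := isProbabilityMeasure_gainLaw (G := G) hK
  unfold roundLaw
  infer_instance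

lemma memLp_snd_roundLaw (hK : 0 < K) (i : Fin c) {p : ENNReal} (hp : p ≠ ⊤) :
    MemLp (fun x : (Fin M → Fin K → ℂ) × (Fin c → ℂ) => x.2 i) p (roundLaw K M c G σ) := by
  have := isProbabilityMeasure_gainLaw (G := G) hK
  lift p to ℝ≥0 using hp
  exact ((memLp_id_complexGaussian (σ ^ 2) p).comp_measurePreserving
    (measurePreserving_eval (fun _ : Fin c => complexGaussian (σ ^ 2)) i)).comp_snd _

lemma measurable_roundNoise (ρ : ℝ) (sub : Fin c → Fin M) (t : Fin M → Fin K → ℝ)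
    (a : Fin c → ℂ) : Measurable (roundNoise G ρ sub t a) := by
  unfold roundNoise
  refine Measurable.add (Finset.measurable_sum _ fun s _ => Finset.measurable_sum _ fun k _ => ?_)
    (Measurable.const_mul (Finset.measurable_sum _ fun i _ => ?_) _)
  · exact ((measurable_activeWeight k).comp
      ((measurable_pi_apply s).comp measurable_fst)).mul_const _
  · refine (measurable_card_activeSet.comp
      ((measurable_pi_apply (sub i)).comp measurable_fst)).inv.mul ?_
    fun_prop

lemma abs_sum_activeWeight_le (h : Fin M → Fin K → ℂ) (t : Fin M → Fin K → ℝ) :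
    |∑ s, ∑ k, activeWeight G (h s) k * t s k| ≤ ∑ s, ∑ k, |t s k| := by
  refine (Finset.abs_sum_le_sum_abs _ _).trans (Finset.sum_le_sum fun s _ =>
    (Finset.abs_sum_le_sum_abs _ _).trans (Finset.sum_le_sum fun k _ => ?_))
  rw [abs_mul, abs_of_nonneg (activeWeight_nonneg _ _)]
  exact mul_le_of_le_one_left (abs_nonneg _) (activeWeight_le_one _ _)

lemma memLp_roundNoise (hK : 0 < K) (ρ : ℝ) (sub : Fin c → Fin M) (t : Fin M → Fin K → ℝ)
    (a : Fin c → ℂ) : MemLp (roundNoise G ρ sub t a) 2 (roundLaw K M c G σ) := by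
  have := isProbabilityMeasure_roundLaw (M := M) (c := c) (G := G) (σ := σ) hK
  have hi : ∀ i, MemLp (fun x : (Fin M → Fin K → ℂ) × (Fin c → ℂ) => ‖a i‖ * ‖x.2 i‖) 2
      (roundLaw K M c G σ) := fun i => by
    have := memLp_snd_roundLaw (M := M) (c := c) (G := G) (σ := σ) hK i (p := 2) (by simp)
    exact this.norm.const_mul _
  have hs := (memLp_finsetSum Finset.univ fun i _ => hi i).const_mul |ρ|
  have hb := (memLp_const (μ := roundLaw K M c G σ) (p := 2) (∑ s, ∑ k, |t s k|)).add hs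
  refine hb.mono' (measurable_roundNoise ρ sub t a).aestronglyMeasurable (.of_forall fun x => ?_)
  simp only [Pi.add_apply]
  rw [Real.norm_eq_abs, roundNoise]
  refine (abs_add_le _ _).trans (add_le_add (abs_sum_activeWeight_le _ _) ?_)
  rw [abs_mul]
  refine mul_le_mul_of_nonneg_left ((Finset.abs_sum_le_sum_abs _ _).trans
    (Finset.sum_le_sum fun i _ => ?_)) (abs_nonneg _)
  rw [abs_mul, abs_of_nonneg (inv_card_nonneg _)]
  exact (mul_le_of_le_one_left (abs_nonneg _) (inv_card_le_one _)).trans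
    (abs_real_inner_le_norm _ _)

lemma memLp_sum_activeWeight (hK : 0 < K) (t : Fin K → ℝ) :
    MemLp (fun h => ∑ k, activeWeight G h k * t k) 2 (gainLaw K G) := by
  have := isProbabilityMeasure_gainLaw (G := G) hK
  refine memLp_finsetSum _ fun k _ => MemLp.of_bound
    ((measurable_activeWeight k).mul_const _).aestronglyMeasurable |t k| (.of_forall fun h => ?_)
  rw [norm_mul, Real.norm_of_nonneg (activeWeight_nonneg _ _), Real.norm_eq_abs]
  exact mul_le_of_le_one_left (abs_nonneg _) (activeWeight_le_one _ _)

lemma integral_pi_complexGaussian_roundNoise (ρ : ℝ) (sub : Fin c → Fin M)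
    (t : Fin M → Fin K → ℝ) (a : Fin c → ℂ) (h : Fin M → Fin K → ℂ) :
    ∫ z, roundNoise G ρ sub t a (h, z) ∂(Measure.pi fun _ : Fin c => complexGaussian (σ ^ 2))
      = ∑ s, ∑ k, activeWeight G (h s) k * t s k := by
  have hi : ∀ i, Integrable (fun z : ℂ =>
      ((activeSet G (h (sub i))).card : ℝ)⁻¹ * inner ℝ (a i) z) (complexGaussian (σ ^ 2)) :=
    fun i => ((memLp_inner_complexGaussian _ 1 _).integrable le_rfl).const_mul _
  simp only [roundNoise]
  rw [integral_add (integrable_const _)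
    ((integrable_finsetSum _ fun i _ => integrable_comp_eval
      (μ := fun _ : Fin c => complexGaussian (σ ^ 2)) (hi i)).const_mul _),
    integral_const_mul, integral_sum_pi hi]
  simp only [integral_const_mul, integral_inner_complexGaussian]
  simp

lemma integral_pi_complexGaussian_roundNoise_sq (ρ : ℝ) (sub : Fin c → Fin M)
    (t : Fin M → Fin K → ℝ) (a : Fin c → ℂ) (h : Fin M → Fin K → ℂ) :
    ∫ z, roundNoise G ρ sub t a (h, z) ^ 2
        ∂(Measure.pi fun _ : Fin c => complexGaussian (σ ^ 2))
      = (∑ s, ∑ k, activeWeight G (h s) k * t s k) ^ 2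
        + ρ ^ 2 * (σ ^ 2 / 2) * ∑ i, (((activeSet G (h (sub i))).card : ℝ)⁻¹) ^ 2 * ‖a i‖ ^ 2 := by
  have hL : ∀ i, MemLp (fun z : ℂ =>
      ((activeSet G (h (sub i))).card : ℝ)⁻¹ * inner ℝ (a i) z) 2 (complexGaussian (σ ^ 2)) :=
    fun i => (memLp_inner_complexGaussian _ 2 _).const_mul _
  have hL' : MemLp (fun z : Fin c → ℂ =>
      ∑ i, ((activeSet G (h (sub i))).card : ℝ)⁻¹ * inner ℝ (a i) (z i)) 2
      (Measure.pi fun _ : Fin c => complexGaussian (σ ^ 2)) :=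
    memLp_finsetSum _ fun i _ => (hL i).comp_measurePreserving (measurePreserving_eval _ i)
  have h0 : ∀ i, ∫ z, ((activeSet G (h (sub i))).card : ℝ)⁻¹ * inner ℝ (a i) z
      ∂(complexGaussian (σ ^ 2)) = 0 := fun i => by
    rw [integral_const_mul, integral_inner_complexGaussian, mul_zero]
  have h1 := integral_sum_pi (μ := fun _ : Fin c => complexGaussian (σ ^ 2))
    fun i => (hL i).integrable one_le_two
  have h2 := integral_sum_pi_sq (μ := fun _ : Fin c => complexGaussian (σ ^ 2)) hL h0
  simp_rw [h0] at h1
  rw [Finset.sum_const_zero] at h1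
  simp_rw [mul_pow, integral_const_mul, integral_inner_sq_complexGaussian] at h2
  have i1 := hL'.integrable_sq
  have i2 := hL'.integrable one_le_two
  simp only [roundNoise]
  set A := ∑ s, ∑ k, activeWeight G (h s) k * t s k
  simp_rw [add_sq, mul_pow]
  have j1 := i2.const_mul ρ
  have j2 := (j1.const_mul (2 * A))
  have e1 := integral_add ((integrable_const (A ^ 2)).add j2) (i1.const_mul (ρ ^ 2))
  have e2 := integral_add (integrable_const (A ^ 2)) j2
  simp only [Pi.add_apply] at e1 e2
  rw [e1, e2, integral_const_mul, integral_const_mul, integral_const_mul, h1, h2]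
  simp only [integral_const, probReal_univ, one_smul, mul_zero, add_zero, Finset.mul_sum]
  congr 1
  refine Finset.sum_congr rfl fun i _ => ?_
  push_cast
  ring

lemma integral_roundNoise (hK : 0 < K) (ρ : ℝ) (sub : Fin c → Fin M) {t : Fin M → Fin K → ℝ}
    (ht : ∀ s, ∑ k, t s k = 0) (a : Fin c → ℂ) :
    ∫ x, roundNoise G ρ sub t a x ∂(roundLaw K M c G σ) = 0 := by
  have := isProbabilityMeasure_gainLaw (G := G) hK
  have := isProbabilityMeasure_roundLaw (M := M) (c := c) (G := G) (σ := σ) hK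
  have hL := (memLp_roundNoise (G := G) (σ := σ) hK ρ sub t a).integrable one_le_two
  unfold roundLaw at hL ⊢
  rw [integral_prod _ hL]
  simp_rw [integral_pi_complexGaussian_roundNoise]
  rw [integral_sum_pi (X := fun s h => ∑ k, activeWeight G h k * t s k)
    fun s => (memLp_sum_activeWeight hK _).integrable one_le_two]
  exact Finset.sum_eq_zero fun s _ => integral_sum_activeWeight_eq_zero hK (ht s)

/-- Given the gains, the receiver noise is centred and independent across symbols, so the cross
terms vanish. The data parts of different sub-channels are independent and centred as well. -/
lemma integral_roundNoise_sq (hK : 0 < K) (ρ : ℝ) (sub : Fin c → Fin M) {t : Fin M → Fin K → ℝ}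
    (ht : ∀ s, ∑ k, t s k = 0) (a : Fin c → ℂ) :
    ∫ x, roundNoise G ρ sub t a x ^ 2 ∂(roundLaw K M c G σ)
      = ∑ s, ∫ h, (∑ k, activeWeight G h k * t s k) ^ 2 ∂(gainLaw K G)
        + ρ ^ 2 * (σ ^ 2 / 2) * (invCardMoment K G * ∑ i, ‖a i‖ ^ 2) := by
  have := isProbabilityMeasure_gainLaw (G := G) hK
  have := isProbabilityMeasure_roundLaw (M := M) (c := c) (G := G) (σ := σ) hK
  have hL := (memLp_roundNoise (G := G) (σ := σ) hK ρ sub t a).integrable_sq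
  unfold roundLaw at hL ⊢
  rw [integral_prod _ hL]
  simp_rw [integral_pi_complexGaussian_roundNoise_sq]
  have hA : ∀ s, MemLp (fun h => ∑ k, activeWeight G h k * t s k) 2 (gainLaw K G) :=
    fun s => memLp_sum_activeWeight hK _
  have hA' : MemLp (fun h : Fin M → Fin K → ℂ => ∑ s, ∑ k, activeWeight G (h s) k * t s k) 2
      (Measure.pi fun _ : Fin M => gainLaw K G) :=
    memLp_finsetSum _ fun s _ => (hA s).comp_measurePreserving (measurePreserving_eval _ s)
  have hI : ∀ i, Integrable (fun h : Fin M → Fin K → ℂ =>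
      (((activeSet G (h (sub i))).card : ℝ)⁻¹) ^ 2) (Measure.pi fun _ : Fin M => gainLaw K G) :=
    fun i => integrable_comp_eval (μ := fun _ : Fin M => gainLaw K G) (i := sub i)
      (f := fun h => (((activeSet G h).card : ℝ)⁻¹) ^ 2) (integrable_inv_card_sq hK)
  rw [integral_add hA'.integrable_sq
    ((integrable_finsetSum _ fun i _ => (hI i).mul_const _).const_mul _),
    integral_sum_pi_sq hA fun s => integral_sum_activeWeight_eq_zero hK (ht s), integral_const_mul,
    integral_finsetSum _ fun i _ => (hI i).mul_const _]
  congr 2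
  rw [Finset.mul_sum]
  refine Finset.sum_congr rfl fun i _ => ?_
  rw [integral_mul_const, integral_comp_eval (μ := fun _ : Fin M => gainLaw K G)
    (f := fun h => (((activeSet G h).card : ℝ)⁻¹) ^ 2) (integrable_inv_card_sq hK).1]
  rfl

lemma le_integral_roundNoise_sq (hK : 0 < K) (ρ : ℝ) (sub : Fin c → Fin M)
    {t : Fin M → Fin K → ℝ} (ht : ∀ s, ∑ k, t s k = 0) {a : Fin c → ℂ}
    (ha : ∑ i, ‖a i‖ ^ 2 = 1) :
    invCardMoment K G * (ρ ^ 2 * (σ ^ 2 / 2))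
      ≤ ∫ x, roundNoise G ρ sub t a x ^ 2 ∂(roundLaw K M c G σ) := by
  rw [integral_roundNoise_sq hK ρ sub ht a, ha]
  have : 0 ≤ ∑ s, ∫ h, (∑ k, activeWeight G h k * t s k) ^ 2 ∂(gainLaw K G) :=
    Finset.sum_nonneg fun s _ => integral_nonneg fun h => sq_nonneg _
  linarith

lemma integral_roundNoise_sq_le (hK : 0 < K) (ρ : ℝ) (sub : Fin c → Fin M)
    {t : Fin M → Fin K → ℝ} (ht : ∀ s, ∑ k, t s k = 0) {a : Fin c → ℂ}
    (ha : ∑ i, ‖a i‖ ^ 2 = 1) {κ : ℝ} (htκ : ∑ s, ∑ k, t s k ^ 2 ≤ K * κ ^ 2) :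
    ∫ x, roundNoise G ρ sub t a x ^ 2 ∂(roundLaw K M c G σ)
      ≤ invCardMoment K G * (K * κ ^ 2 + ρ ^ 2 * (σ ^ 2 / 2)) := by
  rw [integral_roundNoise_sq hK ρ sub ht a, ha]
  have h1 : ∑ s, ∫ h, (∑ k, activeWeight G h k * t s k) ^ 2 ∂(gainLaw K G)
      ≤ ∑ s, invCardMoment K G * ∑ k, t s k ^ 2 :=
    Finset.sum_le_sum fun s _ => integral_sum_activeWeight_sq_le hK (ht s)
  rw [← Finset.mul_sum] at h1
  have := mul_le_mul_of_nonneg_left htκ (invCardMoment_nonneg (K := K) (G := G))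
  linarith

end RoundNoise

/-! ### The complex vectorization is a real isometry -/

section Vectorization

variable {D d c : ℕ} (e : Fin D × Fin d ≃ Fin c × Fin 2)

lemma vec_devec (x : Fin c → ℂ) : vec e (devec e x) = x := by
  funext i
  apply Complex.ext <;> simp [vec, devec]

lemma vec_sub (u v : Mat D d) : vec e (u - v) = vec e u - vec e v := by
  funext i
  apply Complex.ext <;> simp [vec]

lemma vec_add (u v : Mat D d) : vec e (u + v) = vec e u + vec e v := by
  funext i
  apply Complex.ext <;> simp [vec]

lemma vec_smul (r : ℝ) (u : Mat D d) : vec e (r • u) = r • vec e u := by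
  funext i
  apply Complex.ext <;> simp [vec]

/-- `vec` as a real linear map. -/
def vecLinear : Mat D d →ₗ[ℝ] (Fin c → ℂ) where
  toFun := vec e
  map_add' := vec_add e
  map_smul' := vec_smul e

lemma inner_eq_sum_inner_vec (u v : Mat D d) :
    inner ℝ u v = ∑ i, inner ℝ (vec e u i) (vec e v i) := by
  rw [PiLp.inner_apply, ← e.symm.sum_comp, Fintype.sum_prod_type]
  refine Finset.sum_congr rfl fun i _ => ?_
  rw [Fin.sum_univ_two, inner_complex_eq]
  simp [vec]
  ring

lemma norm_sq_eq_sum_norm_sq_vec (u : Mat D d) : ‖u‖ ^ 2 = ∑ i, ‖vec e u i‖ ^ 2 := by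
  rw [← real_inner_self_eq_norm_sq, inner_eq_sum_inner_vec e]
  simp

lemma norm_le_sum_norm_vec (u : Mat D d) : ‖u‖ ≤ ∑ i, ‖vec e u i‖ := by
  refine le_of_sq_le_sq ?_ (by positivity)
  rw [norm_sq_eq_sum_norm_sq_vec e]
  exact Finset.sum_sq_le_sq_sum_of_nonneg fun i _ => norm_nonneg _

lemma measurable_vec (i : Fin c) : Measurable fun u : Mat D d => vec e u i := by
  have : (fun u : Mat D d => vec e u i)
      = fun u => Complex.measurableEquivRealProd.symm (u (e.symm (i, 0)), u (e.symm (i, 1))) := by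
    funext u
    rfl
  rw [this]
  fun_prop

lemma measurable_devec : Measurable (devec e : (Fin c → ℂ) → Mat D d) := by
  refine (WithLp.measurable_toLp 2 _).comp (measurable_pi_lambda _ fun p => ?_)
  split_ifs <;> fun_prop

end Vectorization

/-! ### Consequences of the data noise assumption -/

section DataNoise

variable {D d c K : ℕ} (e : Fin D × Fin d ≃ Fin c × Fin 2) {f : Fin K → Mat D d → ℝ}

lemma hasGradientAt_globalObjective (hf : ∀ k, Differentiable ℝ (f k)) (W : Mat D d) :
    HasGradientAt (globalObjective f) ((K : ℝ)⁻¹ • ∑ k, gradient (f k) W) W := by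
  rw [hasGradientAt_iff_hasFDerivAt, map_smulₛₗ, map_sum]
  have h := (HasFDerivAt.fun_sum (u := Finset.univ) fun k _ =>
    ((hf k W).hasGradientAt).hasFDerivAt).const_mul (K : ℝ)⁻¹
  exact (show HasFDerivAt (globalObjective f) _ W from h).congr_fderiv (by simp)

lemma gradient_globalObjective (hf : ∀ k, Differentiable ℝ (f k)) (W : Mat D d) :
    gradient (globalObjective f) W = (K : ℝ)⁻¹ • ∑ k, gradient (f k) W :=
  (hasGradientAt_globalObjective hf W).gradient

lemma sum_dataNoise (hK : 0 < K) (hf : ∀ k, Differentiable ℝ (f k)) (W : Mat D d) :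
    ∑ k, dataNoise e f W k = 0 := by
  have h : ∑ k, dataNoise e f W k
      = vecLinear e (∑ k, (gradient (f k) W - gradient (globalObjective f) W)) := by
    rw [map_sum]
    exact Finset.sum_congr rfl fun k _ => (vec_sub e _ _).symm
  have hK' : (K : ℝ) ≠ 0 := by positivity
  rw [h, Finset.sum_sub_distrib, Finset.sum_const, Finset.card_univ, Fintype.card_fin,
    gradient_globalObjective hf, ← Nat.cast_smul_eq_nsmul ℝ, smul_smul, mul_inv_cancel₀ hK',
    one_smul, sub_self, map_zero]

lemma inner_sum_le_norm_star_dotProduct (a x : Fin c → ℂ) :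
    (∑ i, inner ℝ (a i) (x i)) ^ 2 ≤ ‖star a ⬝ᵥ x‖ ^ 2 := by
  have : ∑ i, inner ℝ (a i) (x i) = (star a ⬝ᵥ x).re := by
    simp [dotProduct, Complex.inner]
    exact Finset.sum_congr rfl fun i _ => by ring
  rw [this, ← sq_abs]
  gcongr
  exact Complex.abs_re_le_norm _

/-- The Loewner inequality is tested on a. The real inner product is the real part of the Hermitian
one, hence no larger in modulus. -/
lemma DataNoiseBound.sum_inner_sq_le {κ : ℝ} (hK : 0 < K) (h : DataNoiseBound e f κ) (W : Mat D d)
    (a : Fin c → ℂ) :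
    ∑ k, (∑ i, inner ℝ (a i) (dataNoise e f W k i)) ^ 2 ≤ K * κ ^ 2 * ∑ i, ‖a i‖ ^ 2 := by
  have h1 := (h W).dotProduct_mulVec_nonneg a
  have h2 : star a ⬝ᵥ ((((κ : ℂ) ^ 2) • (1 : Matrix (Fin c) (Fin c) ℂ) -
      (K : ℂ)⁻¹ • ∑ k, Matrix.vecMulVec (dataNoise e f W k) (star (dataNoise e f W k))).mulVec a)
      = ((κ ^ 2 * ∑ i, ‖a i‖ ^ 2 - (K : ℝ)⁻¹ * ∑ k, ‖star a ⬝ᵥ dataNoise e f W k‖ ^ 2 : ℝ) : ℂ) := by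
    rw [Matrix.sub_mulVec, dotProduct_sub, Matrix.smul_mulVec, Matrix.smul_mulVec,
      dotProduct_smul, dotProduct_smul, Matrix.one_mulVec, Matrix.sum_mulVec, dotProduct_sum]
    push_cast
    congr 1
    · rw [smul_eq_mul]
      congr 1
      refine Finset.sum_congr rfl fun i _ => ?_
      rw [Pi.star_apply, ← Complex.conj_mul']
      rfl
    · rw [smul_eq_mul]
      congr 1
      refine Finset.sum_congr rfl fun k _ => ?_
      rw [Matrix.vecMulVec_mulVec, ← Complex.mul_conj']
      have : (starRingEnd ℂ) (star a ⬝ᵥ dataNoise e f W k) = star (dataNoise e f W k) ⬝ᵥ a := by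
        rw [starRingEnd_apply, Matrix.star_dotProduct, star_star]
      rw [this]
      simp [mul_comm]
  rw [h2, Complex.zero_le_real, sub_nonneg] at h1
  have hK' : (0 : ℝ) < K := by exact_mod_cast hK
  rw [inv_mul_le_iff₀ hK'] at h1
  calc ∑ k, (∑ i, inner ℝ (a i) (dataNoise e f W k i)) ^ 2
      ≤ ∑ k, ‖star a ⬝ᵥ dataNoise e f W k‖ ^ 2 :=
        Finset.sum_le_sum fun k _ => inner_sum_le_norm_star_dotProduct _ _
    _ ≤ _ := by linarith

/-- Testing with x placed in coordinate i, where x is the noise entry itself, gives ‖x‖⁴ ≤ Kκ²‖x‖².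
-/
lemma DataNoiseBound.norm_le {κ : ℝ} (hK : 0 < K) (h : DataNoiseBound e f κ) (W : Mat D d)
    (k : Fin K) (i : Fin c) : ‖dataNoise e f W k i‖ ≤ Real.sqrt (K * κ ^ 2) := by
  set x := dataNoise e f W k i with hx
  have h1 := h.sum_inner_sq_le e hK W (Pi.single i x)
  have h2 : ∀ k, ∑ j, inner ℝ ((Pi.single i x : Fin c → ℂ) j) (dataNoise e f W k j)
      = inner ℝ x (dataNoise e f W k i) := fun k => by
    rw [Finset.sum_eq_single i (fun j _ hj => by simp [hj]) (by simp)]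
    simp
  have h3 : ∑ j, ‖(Pi.single i x : Fin c → ℂ) j‖ ^ 2 = ‖x‖ ^ 2 := by
    rw [Finset.sum_eq_single i (fun j _ hj => by simp [hj]) (by simp)]
    simp
  simp_rw [h2] at h1
  rw [h3] at h1
  have h4 := (Finset.single_le_sum (f := fun k => inner ℝ x (dataNoise e f W k i) ^ 2)
    (fun k _ => sq_nonneg _) (Finset.mem_univ k)).trans h1
  simp only [← hx, real_inner_self_eq_norm_sq] at h4
  refine Real.le_sqrt_of_sq_le ?_
  rcases (norm_nonneg x).eq_or_lt with h0 | h0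
  · rw [← h0]; simp; positivity
  · have : 0 < ‖x‖ ^ 2 := by positivity
    refine le_of_mul_le_mul_right ?_ this
    rw [← pow_two]
    exact h4

end DataNoise

/-! ### The received gradient as gradient plus noise -/

section GradientNoise

variable {D d c K M : ℕ} (e : Fin D × Fin d ≃ Fin c × Fin 2) (sub : Fin c → Fin M)
  {f : Fin K → Mat D d → ℝ} {G κ ν Pmin p : ℝ} {η : ℂ} {σ : ℝ≥0}

/-- The deviation of the received gradient from the gradient of the global objective. -/
noncomputable def gradientNoise (f : Fin K → Mat D d → ℝ) (G ν : ℝ) (η : ℂ) (p : ℝ)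
    (x : (Fin M → Fin K → ℂ) × (Fin c → ℂ)) (W : Mat D d) : Mat D d :=
  receivedGradient e sub f G ν η p x.1 x.2 W - gradient (globalObjective f) W

/-- The component of the data noise of a device on a sub-channel in direction `a`. -/
noncomputable def dataNoiseComponent (f : Fin K → Mat D d → ℝ) (W : Mat D d) (a : Fin c → ℂ)
    (s : Fin M) (k : Fin K) : ℝ :=
  ∑ i, if sub i = s then inner ℝ (a i) (dataNoise e f W k i) else 0

/-- The channel realizations in which channel inversion is possible and every sub-channel has an
active device. -/
def nondegenerateGains (K M c : ℕ) (G : ℝ) : Set ((Fin M → Fin K → ℂ) × (Fin c → ℂ)) :=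
  {x | ∀ s, (activeSet G (x.1 s)).Nonempty ∧ ∀ k, x.1 s k ≠ 0}

lemma ae_mem_nondegenerateGains (hK : 0 < K) :
    ∀ᵐ x ∂(roundLaw K M c G σ), x ∈ nondegenerateGains K M c G := by
  have := isProbabilityMeasure_gainLaw (G := G) hK
  have h1 : ∀ᵐ h ∂(Measure.pi fun _ : Fin M => gainLaw K G),
      ∀ s, (activeSet G (h s)).Nonempty ∧ ∀ k, h s k ≠ 0 := by
    refine Filter.eventually_all.2 fun s => ?_
    exact (measurePreserving_eval (fun _ : Fin M => gainLaw K G) s).quasiMeasurePreserving.ae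
      (ae_gainLaw_activeSet_nonempty.and ae_gainLaw_ne_zero)
  exact measurePreserving_fst.quasiMeasurePreserving.ae h1

/-- Inverted channels contribute √p times the symbol. De-normalization removes ν and η, leaving the
average over the active devices plus scaled receiver noise. -/
lemma vec_gradientNoise {x : (Fin M → Fin K → ℂ) × (Fin c → ℂ)}
    (hx : x ∈ nondegenerateGains K M c G) (hν : 0 < ν) (hp : 0 < p) (W : Mat D d) (i : Fin c) :
    vec e (gradientNoise e sub f G ν η p x W) i
      = ∑ k, (activeWeight G (x.1 (sub i)) k : ℂ) * dataNoise e f W k i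
        + ((ν / Real.sqrt p : ℝ) : ℂ) * ((((activeSet G (x.1 (sub i))).card : ℝ)⁻¹ : ℝ) : ℂ)
          * x.2 i := by
  obtain ⟨hne, hnz⟩ := hx (sub i)
  set h := x.1 (sub i) with hh
  have hcard : ((activeSet G h).card : ℂ) ≠ 0 := by
    exact_mod_cast (Finset.card_pos.2 hne).ne'
  have hν' : (ν : ℂ) ≠ 0 := by exact_mod_cast hν.ne'
  have hs : (Real.sqrt p : ℂ) ≠ 0 := by exact_mod_cast (Real.sqrt_pos.2 hp).ne'
  rw [gradientNoise, vec_sub, receivedGradient, vec_devec, Pi.sub_apply]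
  have hsum : ∑ k, h k * precoder G p (h k) * ((vec e (gradient (f k) W) i - η) / (ν : ℂ))
      = (Real.sqrt p : ℂ) / ν * ∑ k ∈ activeSet G h, (vec e (gradient (f k) W) i - η) := by
    rw [activeSet, Finset.sum_filter, Finset.mul_sum]
    refine Finset.sum_congr rfl fun k _ => ?_
    unfold precoder
    split_ifs
    · have := hnz k
      field_simp
    · simp
  have hdata : ∑ k, (activeWeight G h k : ℂ) * dataNoise e f W k i
      = ((activeSet G h).card : ℂ)⁻¹ * ∑ k ∈ activeSet G h, dataNoise e f W k i :=
    sum_activeWeight_mul h _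
  rw [hdata, receivedSymbol, ← hh, hsum]
  simp only [dataNoise, Pi.sub_apply, Finset.sum_sub_distrib, Finset.sum_const, nsmul_eq_mul]
  push_cast
  field_simp
  ring

lemma inner_gradientNoise {x : (Fin M → Fin K → ℂ) × (Fin c → ℂ)}
    (hx : x ∈ nondegenerateGains K M c G) (hν : 0 < ν) (hp : 0 < p) (W u : Mat D d) :
    inner ℝ u (gradientNoise e sub f G ν η p x W)
      = roundNoise G (ν / Real.sqrt p) sub (dataNoiseComponent e sub f W (vec e u)) (vec e u) x := by
  rw [inner_eq_sum_inner_vec e]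
  simp_rw [vec_gradientNoise e sub hx hν hp, inner_add_right, inner_sum, ← Complex.real_smul]
  rw [Finset.sum_add_distrib, roundNoise]
  congr 1
  · simp only [real_inner_smul_right, dataNoiseComponent, Finset.mul_sum]
    have : ∀ i, ∑ k, activeWeight G (x.1 (sub i)) k * inner ℝ (vec e u i) (dataNoise e f W k i)
        = ∑ s, ∑ k, activeWeight G (x.1 s) k *
          (if sub i = s then inner ℝ (vec e u i) (dataNoise e f W k i) else 0) := by
      intro i
      rw [Finset.sum_eq_single (sub i) (fun s _ hs => by simp [Ne.symm hs]) (by simp)]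
      simp
    rw [Finset.sum_congr rfl fun i _ => this i, Finset.sum_comm]
    refine Finset.sum_congr rfl fun s _ => ?_
    rw [Finset.sum_comm]
  · rw [Finset.mul_sum]
    refine Finset.sum_congr rfl fun i _ => ?_
    rw [smul_mul_assoc, real_inner_smul_right, ← Complex.real_smul, real_inner_smul_right]

lemma sum_dataNoiseComponent (hK : 0 < K) (hf : ∀ k, Differentiable ℝ (f k)) (W : Mat D d)
    (a : Fin c → ℂ) (s : Fin M) : ∑ k, dataNoiseComponent e sub f W a s k = 0 := by
  unfold dataNoiseComponent
  rw [Finset.sum_comm]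
  refine Finset.sum_eq_zero fun i _ => ?_
  split_ifs
  · rw [← inner_sum, ← Finset.sum_apply, sum_dataNoise e hK hf]
    simp
  · simp

/-- Several symbols may share a sub-channel and its gains. The data noise bound is applied to the
restriction of a to each sub-channel, and the squared norms of these restrictions add up to 1. -/
lemma sum_dataNoiseComponent_sq_le (hK : 0 < K) (hκ : DataNoiseBound e f κ) (W : Mat D d)
    {a : Fin c → ℂ} (ha : ∑ i, ‖a i‖ ^ 2 = 1) :
    ∑ s, ∑ k, dataNoiseComponent e sub f W a s k ^ 2 ≤ K * κ ^ 2 := by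
  have h1 : ∀ s, ∑ k, dataNoiseComponent e sub f W a s k ^ 2
      ≤ K * κ ^ 2 * ∑ i, if sub i = s then ‖a i‖ ^ 2 else 0 := fun s => by
    have := hκ.sum_inner_sq_le e hK W (fun i => if sub i = s then a i else 0)
    refine (le_of_eq ?_).trans (this.trans (le_of_eq ?_))
    · refine Finset.sum_congr rfl fun k _ => ?_
      congr 1
      refine Finset.sum_congr rfl fun i _ => ?_
      split_ifs <;> simp
    · congr 1
      refine Finset.sum_congr rfl fun i _ => ?_
      split_ifs <;> simp
  refine (Finset.sum_le_sum fun s _ => h1 s).trans (le_of_eq ?_)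
  rw [← Finset.mul_sum, Finset.sum_comm]
  simp [ha]

lemma integral_inner_gradientNoise (hK : 0 < K) (hf : ∀ k, Differentiable ℝ (f k)) (hν : 0 < ν)
    (hp : 0 < p) (W u : Mat D d) :
    ∫ x, inner ℝ u (gradientNoise e sub f G ν η p x W) ∂(roundLaw K M c G σ) = 0 := by
  rw [← integral_roundNoise (σ := σ) (G := G) hK (ν / Real.sqrt p) sub
    (sum_dataNoiseComponent e sub hK hf W (vec e u)) (vec e u)]
  refine integral_congr_ae ?_
  filter_upwards [ae_mem_nondegenerateGains hK] with x hx
  exact inner_gradientNoise e sub hx hν hp W u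

lemma integral_inner_gradientNoise_sq_eq (hK : 0 < K) (hν : 0 < ν) (hp : 0 < p) (W u : Mat D d) :
    ∫ x, inner ℝ u (gradientNoise e sub f G ν η p x W) ^ 2 ∂(roundLaw K M c G σ)
      = ∫ x, roundNoise G (ν / Real.sqrt p) sub (dataNoiseComponent e sub f W (vec e u))
        (vec e u) x ^ 2 ∂(roundLaw K M c G σ) := by
  refine integral_congr_ae ?_
  filter_upwards [ae_mem_nondegenerateGains hK] with x hx
  rw [inner_gradientNoise e sub hx hν hp W u]

lemma le_integral_inner_gradientNoise_sq (hK : 0 < K) (hf : ∀ k, Differentiable ℝ (f k))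
    (hν : 0 < ν) (hp : 0 < p) (W : Mat D d) {u : Mat D d} (hu : ‖u‖ = 1) :
    invCardMoment K G * (ν ^ 2 * (σ : ℝ) ^ 2 / (2 * p))
      ≤ ∫ x, inner ℝ u (gradientNoise e sub f G ν η p x W) ^ 2 ∂(roundLaw K M c G σ) := by
  have ha : ∑ i, ‖vec e u i‖ ^ 2 = 1 := by rw [← norm_sq_eq_sum_norm_sq_vec, hu, one_pow]
  rw [integral_inner_gradientNoise_sq_eq e sub hK hν hp]
  refine le_trans (le_of_eq ?_) (le_integral_roundNoise_sq (σ := σ) hK (ν / Real.sqrt p) sub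
    (sum_dataNoiseComponent e sub hK hf W (vec e u)) ha)
  rw [div_pow, Real.sq_sqrt hp.le]
  field_simp

lemma integral_inner_gradientNoise_sq_le (hK : 0 < K) (hf : ∀ k, Differentiable ℝ (f k))
    (hκ : DataNoiseBound e f κ) (hν : 0 < ν) (hp : 0 < p) (W : Mat D d) {u : Mat D d}
    (hu : ‖u‖ = 1) :
    ∫ x, inner ℝ u (gradientNoise e sub f G ν η p x W) ^ 2 ∂(roundLaw K M c G σ)
      ≤ invCardMoment K G * (K * κ ^ 2 + ν ^ 2 * (σ : ℝ) ^ 2 / (2 * p)) := by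
  have ha : ∑ i, ‖vec e u i‖ ^ 2 = 1 := by rw [← norm_sq_eq_sum_norm_sq_vec, hu, one_pow]
  rw [integral_inner_gradientNoise_sq_eq e sub hK hν hp]
  refine (integral_roundNoise_sq_le (σ := σ) hK (ν / Real.sqrt p) sub
    (sum_dataNoiseComponent e sub hK hf W (vec e u)) ha
    (sum_dataNoiseComponent_sq_le e sub hK hκ W ha)).trans (le_of_eq ?_)
  rw [div_pow, Real.sq_sqrt hp.le]
  field_simp

/-- An envelope of the norm of the gradient noise that does not depend on the iterate. -/
noncomputable def noiseEnvelope (K c : ℕ) (κ ν Pmin : ℝ) {M : ℕ}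
    (x : (Fin M → Fin K → ℂ) × (Fin c → ℂ)) : ℝ :=
  ∑ i, (K * Real.sqrt (K * κ ^ 2) + ν / Real.sqrt Pmin * ‖x.2 i‖)

/-- The bound depends on neither W nor the local functions, and on p only through Pmin. This is why
the final δ depends on the constants alone. -/
lemma norm_gradientNoise_le {x : (Fin M → Fin K → ℂ) × (Fin c → ℂ)}
    (hx : x ∈ nondegenerateGains K M c G) (hK : 0 < K) (hκ : DataNoiseBound e f κ) (hν : 0 < ν)
    (hPmin : 0 < Pmin) (hp : Pmin ≤ p) (W : Mat D d) :
    ‖gradientNoise e sub f G ν η p x W‖ ≤ noiseEnvelope K c κ ν Pmin x := by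
  refine (norm_le_sum_norm_vec e _).trans (Finset.sum_le_sum fun i _ => ?_)
  rw [vec_gradientNoise e sub hx hν (hPmin.trans_le hp)]
  refine (norm_add_le _ _).trans (add_le_add ?_ ?_)
  · refine (norm_sum_le _ _).trans ?_
    have : ∀ k ∈ (Finset.univ : Finset (Fin K)),
        ‖(activeWeight G (x.1 (sub i)) k : ℂ) * dataNoise e f W k i‖
          ≤ Real.sqrt (K * κ ^ 2) := fun k _ => by
      rw [norm_mul, Complex.norm_real, Real.norm_of_nonneg (activeWeight_nonneg _ _)]
      exact (mul_le_of_le_one_left (norm_nonneg _) (activeWeight_le_one _ _)).trans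
        (hκ.norm_le e hK W k i)
    refine (Finset.sum_le_sum this).trans (le_of_eq ?_)
    simp
  · rw [norm_mul, norm_mul, Complex.norm_real, Complex.norm_real,
      Real.norm_of_nonneg (inv_card_nonneg _), Real.norm_of_nonneg (by positivity)]
    refine mul_le_mul_of_nonneg_right ?_ (norm_nonneg _)
    have hs := Real.sqrt_pos.2 hPmin
    calc ν / Real.sqrt p * ((activeSet G (x.1 (sub i))).card : ℝ)⁻¹ ≤ ν / Real.sqrt p * 1 := by
          have := inv_card_le_one (G := G) (x.1 (sub i))
          gcongr
      _ = ν / Real.sqrt p := mul_one _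
      _ ≤ ν / Real.sqrt Pmin := by gcongr

lemma memLp_noiseEnvelope (hK : 0 < K) :
    MemLp (noiseEnvelope K c κ ν Pmin (M := M)) 4 (roundLaw K M c G σ) := by
  have := isProbabilityMeasure_roundLaw (M := M) (c := c) (G := G) (σ := σ) hK
  have h1 := fun i => (memLp_snd_roundLaw (M := M) (c := c) (G := G) (σ := σ) hK i
    (p := 4) (by simp)).norm.const_mul (ν / Real.sqrt Pmin)
  have h2 := fun i => (memLp_const (μ := roundLaw K M c G σ) (p := 4)
    (K * Real.sqrt (K * κ ^ 2))).add (h1 i)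
  exact memLp_finsetSum Finset.univ fun i _ => h2 i

lemma measurable_gradient (F : Mat D d → ℝ) : Measurable (gradient F) := by
  have : gradient F = fun W => (InnerProductSpace.toDual ℝ (Mat D d)).symm (fderiv ℝ F W) := rfl
  rw [this]
  exact (InnerProductSpace.toDual ℝ (Mat D d)).symm.continuous.measurable.comp
    (measurable_fderiv ℝ F)

lemma measurable_precoder : Measurable (precoder G p) := by
  unfold precoder
  exact Measurable.ite (measurableSet_le measurable_const (by fun_prop))
    (measurable_const.div measurable_id) measurable_const

lemma measurable_receivedGradient :
    Measurable fun y : ((Fin M → Fin K → ℂ) × (Fin c → ℂ)) × Mat D d =>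
      receivedGradient e sub f G ν η p y.1.1 y.1.2 y.2 := by
  refine (measurable_devec e).comp (measurable_pi_lambda _ fun i => ?_)
  have hh : ∀ k, Measurable fun y : ((Fin M → Fin K → ℂ) × (Fin c → ℂ)) × Mat D d =>
      y.1.1 (sub i) k := fun k => by fun_prop
  have hcard : Measurable fun y : ((Fin M → Fin K → ℂ) × (Fin c → ℂ)) × Mat D d =>
      ((activeSet G (y.1.1 (sub i))).card : ℂ) := by
    have h1 := measurable_card_activeSet (G := G) (K := K)
    have h2 : Measurable fun y : ((Fin M → Fin K → ℂ) × (Fin c → ℂ)) × Mat D d =>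
      ((activeSet G (y.1.1 (sub i))).card : ℝ) := h1.comp (measurable_pi_lambda _ hh)
    have h3 : (fun y : ((Fin M → Fin K → ℂ) × (Fin c → ℂ)) × Mat D d =>
        ((activeSet G (y.1.1 (sub i))).card : ℂ))
        = fun y => (((activeSet G (y.1.1 (sub i))).card : ℝ) : ℂ) := by
      funext y
      simp
    rw [h3]
    exact Complex.measurable_ofReal.comp h2
  unfold receivedSymbol
  refine ((hcard.inv.mul_const _).mul ((Finset.measurable_sum _ fun k _ => ?_).add ?_)).add_const _
  · refine ((hh k).mul (measurable_precoder.comp (hh k))).mul ?_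
    exact (((measurable_vec e i).comp ((measurable_gradient (f k)).comp
      measurable_snd)).sub_const _).div_const _
  · fun_prop

lemma measurable_gradientNoise :
    Measurable fun y : ((Fin M → Fin K → ℂ) × (Fin c → ℂ)) × Mat D d =>
      gradientNoise e sub f G ν η p y.1 y.2 :=
  (measurable_receivedGradient e sub).sub ((measurable_gradient _).comp measurable_snd)

end GradientNoise

/-! ### Independence of a round from its past -/

section Past

variable {α : Type*} [MeasurableSpace α]

/-- The σ-algebra on sequences generated by the coordinates before time `m`. -/
def pastFiltration (α : Type*) [mα : MeasurableSpace α] :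
    Filtration ℕ (MeasurableSpace.pi : MeasurableSpace (ℕ → α)) where
  seq m := ⨆ k ∈ {k | k < m}, MeasurableSpace.comap (fun ω : ℕ → α => ω k) mα
  mono' _ _ h := biSup_mono fun _ hk => lt_of_lt_of_le hk h
  le' _ := iSup₂_le fun k _ => (measurable_pi_apply k).comap_le

lemma measurable_eval_pastFiltration {k m : ℕ} (h : k < m) :
    Measurable[pastFiltration α m] (fun ω : ℕ → α => ω k) := by
  refine Measurable.of_comap_le ?_
  exact le_iSup₂_of_le k h le_rfl

lemma map_past_eval (ρ : Measure α) [IsProbabilityMeasure ρ] {β : Type*} [MeasurableSpace β]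
    {m : ℕ} {φ : (ℕ → α) → β} (hφ : Measurable[pastFiltration α m] φ) :
    (Measure.infinitePi fun _ : ℕ => ρ).map (fun ω => (φ ω, ω m))
      = ((Measure.infinitePi fun _ : ℕ => ρ).map φ).prod ρ := by
  have hi : iIndepFun (fun k (ω : ℕ → α) => ω k) (Measure.infinitePi fun _ : ℕ => ρ) :=
    iIndepFun_infinitePi (X := fun _ x => x) fun _ => measurable_id
  have hind : Indep (⨆ k ∈ {k | k < m}, MeasurableSpace.comap (fun ω : ℕ → α => ω k) ‹_›)
      (⨆ k ∈ ({m} : Set ℕ), MeasurableSpace.comap (fun ω : ℕ → α => ω k) ‹_›)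
      (Measure.infinitePi fun _ : ℕ => ρ) :=
    indep_iSup_of_disjoint (fun k => (measurable_pi_apply k).comap_le) hi (by simp)
  rw [iSup_singleton] at hind
  have hφ' : Measurable φ := hφ.mono ((pastFiltration α).le m) le_rfl
  have hf : IndepFun φ (fun ω : ℕ → α => ω m) (Measure.infinitePi fun _ : ℕ => ρ) :=
    (IndepFun_iff_Indep _ _ _).2 (indep_of_indep_of_le_left hind hφ.comap_le)
  rw [(indepFun_iff_map_prod_eq_prod_map_map hφ'.aemeasurable
    (measurable_pi_apply m).aemeasurable).1 hf,
    Measure.infinitePi_map_eval]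

/-- Freezing: by independence and Fubini, the current round is integrated out first, with past
quantities held fixed. -/
lemma integral_past_eval (ρ : Measure α) [IsProbabilityMeasure ρ] {β : Type*} [MeasurableSpace β]
    {m : ℕ} {φ : (ℕ → α) → β} (hφ : Measurable[pastFiltration α m] φ) {Ψ : β × α → ℝ}
    (hΨ : Measurable Ψ)
    (hint : Integrable (fun ω => Ψ (φ ω, ω m)) (Measure.infinitePi fun _ : ℕ => ρ)) :
    Integrable Ψ (((Measure.infinitePi fun _ : ℕ => ρ).map φ).prod ρ) ∧
    ∫ ω, Ψ (φ ω, ω m) ∂(Measure.infinitePi fun _ : ℕ => ρ)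
      = ∫ y, ∫ x, Ψ (y, x) ∂ρ ∂((Measure.infinitePi fun _ : ℕ => ρ).map φ) := by
  have hφ' : Measurable φ := hφ.mono ((pastFiltration α).le m) le_rfl
  have := Measure.isProbabilityMeasure_map (μ := Measure.infinitePi fun _ : ℕ => ρ)
    hφ'.aemeasurable
  have hm : Measurable fun ω : ℕ → α => (φ ω, ω m) := hφ'.prodMk (measurable_pi_apply m)
  have hI : Integrable Ψ (((Measure.infinitePi fun _ : ℕ => ρ).map φ).prod ρ) := by
    rw [← map_past_eval ρ hφ]
    exact (integrable_map_measure hΨ.aestronglyMeasurable hm.aemeasurable).2 hint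
  refine ⟨hI, ?_⟩
  rw [← integral_prod _ hI, ← map_past_eval ρ hφ,
    integral_map hm.aemeasurable hΨ.aestronglyMeasurable]

end Past

/-! ### Symmetry and spectrum of the Hessian -/

section Hessian

variable {D d : ℕ} {F : Mat D d → ℝ} {B C β χ γ : ℝ}

namespace IsRegularObjective

variable (h : IsRegularObjective F B C β χ)

include h

lemma differentiable : Differentiable ℝ F := h.contDiff.differentiable (by norm_num)

lemma hasGradientAt (W : Mat D d) : HasGradientAt F (gradient F W) W :=
  (h.differentiable W).hasGradientAt

lemma differentiable_gradient : Differentiable ℝ (gradient F) := by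
  have h1 : Differentiable ℝ (fderiv ℝ F) :=
    (h.contDiff.fderiv_right (m := 1) (by norm_num)).differentiable (by norm_num)
  exact (InnerProductSpace.toDual ℝ (Mat D d)).symm.differentiable.comp h1

lemma inner_hessian (W x y : Mat D d) :
    inner ℝ (hessian F W x) y = fderiv ℝ (fderiv ℝ F) W x y := by
  have h1 : Differentiable ℝ (fderiv ℝ F) :=
    (h.contDiff.fderiv_right (m := 1) (by norm_num)).differentiable (by norm_num)
  have e : (fun V => inner ℝ (gradient F V) y) = fun V => fderiv ℝ F V y := by
    funext V
    exact InnerProductSpace.toDual_symm_apply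
  have h2 := ((h.differentiable_gradient W).hasFDerivAt).inner ℝ (hasFDerivAt_const y W)
  rw [e] at h2
  have h3 := congrArg (fun L => L x) (h2.unique ((h1 W).hasFDerivAt.clm_apply (hasFDerivAt_const y W)))
  simpa [hessian] using h3

lemma inner_hessian_symm (W x y : Mat D d) :
    inner ℝ (hessian F W x) y = inner ℝ x (hessian F W y) := by
  have h1 := (h.contDiff.contDiffAt (x := W)).isSymmSndFDerivAt (by simp)
  rw [← real_inner_comm x, h.inner_hessian, h.inner_hessian]
  exact h1 x y

lemma taylor (hχ : 0 ≤ χ) (W x : Mat D d) :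
    ‖gradient F (W + x) - gradient F W - hessian F W x‖ ≤ χ * ‖x‖ ^ 2 :=
  norm_sub_sub_fderiv_le hχ h.differentiable_gradient h.hessian_lipschitz W x

lemma norm_hessian_le (hβ : 0 ≤ β) (W : Mat D d) : ‖hessian F W‖ ≤ β := by
  have hl : LipschitzWith β.toNNReal (gradient F) := LipschitzWith.of_dist_le_mul fun v w => by
    simpa [dist_eq_norm, Real.coe_toNNReal β hβ] using h.smooth v w
  unfold hessian
  simpa [Real.coe_toNNReal β hβ] using norm_fderiv_le_of_lipschitz ℝ hl (x₀ := W)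

end IsRegularObjective

lemma exists_hasEigenvalue_le (hγ : 0 < γ) {W : Mat D d} (h : hessianMinEigenvalue F W ≤ -γ) :
    ∃ l ≤ -γ, Module.End.HasEigenvalue (hessian F W : Mat D d →ₗ[ℝ] Mat D d) l := by
  unfold hessianMinEigenvalue at h
  set S := {l : ℝ | Module.End.HasEigenvalue (hessian F W : Mat D d →ₗ[ℝ] Mat D d) l} with hS
  have hfin : S.Finite := Module.End.finite_hasEigenvalue _
  -- Over an empty spectrum the infimum would take the default value 0, which exceeds -γ. Being
  -- finite and nonempty, the spectrum attains its infimum.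
  have hne : S.Nonempty := by
    by_contra hne
    rw [Set.not_nonempty_iff_eq_empty] at hne
    rw [hne, Real.sInf_empty] at h
    linarith
  exact ⟨sInf S, h, hne.csInf_mem hfin⟩

lemma exists_eigenvector_basis (hF : IsRegularObjective F B C β χ) (hβ : 0 ≤ β) (hγ : 0 < γ)
    {W : Mat D d} (hW : hessianMinEigenvalue F W ≤ -γ) :
    ∃ (u : OrthonormalBasis (Fin (Module.finrank ℝ (Mat D d))) ℝ (Mat D d))
      (l : Fin (Module.finrank ℝ (Mat D d)) → ℝ),
      (∀ i, hessian F W (u i) = l i • u i) ∧ (∀ i, |l i| ≤ β) ∧ ∃ i, l i ≤ -γ := by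
  have hs : (hessian F W : Mat D d →ₗ[ℝ] Mat D d).IsSymmetric :=
    fun x y => hF.inner_hessian_symm W x y
  have hu : ∀ i, hessian F W (hs.eigenvectorBasis rfl i)
      = hs.eigenvalues rfl i • hs.eigenvectorBasis rfl i := fun i =>
    hs.apply_eigenvectorBasis rfl i
  refine ⟨hs.eigenvectorBasis rfl, hs.eigenvalues rfl, hu, fun i => ?_, ?_⟩
  · have h1 := (hessian F W).le_opNorm (hs.eigenvectorBasis rfl i)
    rw [hu i, norm_smul, (hs.eigenvectorBasis rfl).orthonormal.1 i, mul_one, mul_one] at h1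
    exact h1.trans (hF.norm_hessian_le hβ W)
  · obtain ⟨l, hl, hev⟩ := exists_hasEigenvalue_le hγ hW
    obtain ⟨v, hv⟩ := hev.exists_hasEigenvector
    -- Otherwise an eigenvector for l ≤ -γ would be orthogonal to every basis vector, all of which
    -- have other eigenvalues.
    by_contra! hcon
    refine hv.2 ((hs.eigenvectorBasis rfl).toBasis.ext_elem fun i => ?_)
    have h1 : inner ℝ (hs.eigenvectorBasis rfl i) v = 0 := by
      have h2 := hF.inner_hessian_symm W (hs.eigenvectorBasis rfl i) v
      have h3 : hessian F W v = l • v := hv.apply_eq_smul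
      rw [hu i, h3, real_inner_smul_left, real_inner_smul_right] at h2
      have h4 := hcon i
      by_contra h5
      have := mul_right_cancel₀ h5 h2
      linarith
    simpa [OrthonormalBasis.repr_apply_apply] using h1

end Hessian

/-! ### The iterates on the product space of channel realizations -/

section CanonicalProcess

variable {D d c K M : ℕ} (e : Fin D × Fin d ≃ Fin c × Fin 2) (sub : Fin c → Fin M)
  (f : Fin K → Mat D d → ℝ) (G ν : ℝ) (η : ℂ) (μ : ℝ) (p : ℕ → ℝ) (W₀ : Mat D d)

/-- The iterates on the canonical space of channel realizations. -/
noncomputable def canonicalState (m : ℕ) (ω : ℕ → (Fin M → Fin K → ℂ) × (Fin c → ℂ)) : Mat D d :=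
  state e sub f G ν η μ p W₀ (fun j => (ω j).1) (fun j => (ω j).2) m

/-- The gradient noise along the iterates on the canonical space of channel realizations. -/
noncomputable def canonicalNoise (m : ℕ) (ω : ℕ → (Fin M → Fin K → ℂ) × (Fin c → ℂ)) : Mat D d :=
  gradientNoise e sub f G ν η (p m) (ω m) (canonicalState e sub f G ν η μ p W₀ m ω)

/-- The fourth moment of the envelope of the gradient noise. -/
noncomputable def envelopeMoment (K M c : ℕ) (G : ℝ) (σ : ℝ≥0) (κ ν Pmin : ℝ) : ℝ :=
  ∫ x, noiseEnvelope K c κ ν Pmin x ^ 4 ∂(roundLaw K M c G σ)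

lemma state_congr {p p' : ℕ → ℝ} (h : ℕ → Fin M → Fin K → ℂ) (z : ℕ → Fin c → ℂ) {n : ℕ}
    (hp : ∀ m < n, p m = p' m) :
    state e sub f G ν η μ p W₀ h z n = state e sub f G ν η μ p' W₀ h z n := by
  induction n with
  | zero => rfl
  | succ k ih => rw [state, state, ih fun m hm => hp m (hm.trans k.lt_succ_self),
      hp k k.lt_succ_self]

lemma canonicalState_succ (m : ℕ) (ω : ℕ → (Fin M → Fin K → ℂ) × (Fin c → ℂ)) :
    canonicalState e sub f G ν η μ p W₀ (m + 1) ω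
      = canonicalState e sub f G ν η μ p W₀ m ω
        - μ • (gradient (globalObjective f) (canonicalState e sub f G ν η μ p W₀ m ω)
          + canonicalNoise e sub f G ν η μ p W₀ m ω) := by
  rw [canonicalNoise, gradientNoise, add_sub_cancel]
  rfl

lemma measurable_canonicalState (m : ℕ) :
    Measurable[pastFiltration _ m] (canonicalState e sub f G ν η μ p W₀ m) := by
  induction m with
  | zero => exact measurable_const
  | succ k ih =>
    have h1 : Measurable[pastFiltration _ (k + 1)] (canonicalState e sub f G ν η μ p W₀ k) :=
      ih.mono ((pastFiltration _).mono k.le_succ) le_rfl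
    have h2 := measurable_eval_pastFiltration
      (α := (Fin M → Fin K → ℂ) × (Fin c → ℂ)) k.lt_succ_self
    exact h1.sub (((measurable_receivedGradient e sub (f := f) (G := G) (ν := ν) (η := η)
      (p := p k)).comp (h2.prodMk h1)).const_smul μ)

lemma measurable_canonicalNoise (m : ℕ) :
    Measurable[pastFiltration _ (m + 1)] (canonicalNoise e sub f G ν η μ p W₀ m) := by
  have h1 : Measurable[pastFiltration _ (m + 1)] (canonicalState e sub f G ν η μ p W₀ m) :=
    (measurable_canonicalState e sub f G ν η μ p W₀ m).mono
      ((pastFiltration _).mono m.le_succ) le_rfl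
  have h2 := measurable_eval_pastFiltration
    (α := (Fin M → Fin K → ℂ) × (Fin c → ℂ)) m.lt_succ_self
  have h3 := (measurable_gradientNoise e sub (f := f) (G := G) (ν := ν) (η := η)
    (p := p m)).comp (h2.prodMk h1)
  exact h3

variable {f G ν p} {κ Pmin : ℝ} {σ : ℝ≥0}

lemma measurePreserving_eval_infinitePi {α : Type*} [MeasurableSpace α] (ρ : Measure α)
    [IsProbabilityMeasure ρ] (m : ℕ) :
    MeasurePreserving (fun ω : ℕ → α => ω m) (Measure.infinitePi fun _ : ℕ => ρ) ρ :=
  ⟨measurable_pi_apply m, Measure.infinitePi_map_eval _ m⟩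

lemma norm_canonicalNoise_le (hK : 0 < K) (hκ : DataNoiseBound e f κ) (hν : 0 < ν)
    (hPmin : 0 < Pmin) (hp : ∀ m, Pmin ≤ p m) (m : ℕ) :
    ∀ᵐ ω ∂(Measure.infinitePi fun _ : ℕ => roundLaw K M c G σ),
      ‖canonicalNoise e sub f G ν η μ p W₀ m ω‖ ≤ noiseEnvelope K c κ ν Pmin (ω m) := by
  have := isProbabilityMeasure_roundLaw (M := M) (c := c) (G := G) (σ := σ) hK
  have h := (measurePreserving_eval_infinitePi (roundLaw K M c G σ) m).quasiMeasurePreserving.ae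
    (ae_mem_nondegenerateGains hK)
  filter_upwards [h] with ω hω
  exact norm_gradientNoise_le e sub hω hK hκ hν hPmin (hp m) _

lemma memLp_envelope_eval (hK : 0 < K) (m : ℕ) :
    MemLp (fun ω : ℕ → (Fin M → Fin K → ℂ) × (Fin c → ℂ) => noiseEnvelope K c κ ν Pmin (ω m)) 4
      (Measure.infinitePi fun _ : ℕ => roundLaw K M c G σ) := by
  have := isProbabilityMeasure_roundLaw (M := M) (c := c) (G := G) (σ := σ) hK
  exact (memLp_noiseEnvelope hK).comp_measurePreserving (measurePreserving_eval_infinitePi _ m)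

lemma memLp_canonicalNoise (hK : 0 < K) (hκ : DataNoiseBound e f κ) (hν : 0 < ν)
    (hPmin : 0 < Pmin) (hp : ∀ m, Pmin ≤ p m) (m : ℕ) :
    MemLp (canonicalNoise e sub f G ν η μ p W₀ m) 4
      (Measure.infinitePi fun _ : ℕ => roundLaw K M c G σ) :=
  (memLp_envelope_eval (κ := κ) (Pmin := Pmin) (ν := ν) hK m).mono'
    ((measurable_canonicalNoise e sub f G ν η μ p W₀ m).mono ((pastFiltration _).le _)
      le_rfl).aestronglyMeasurable
    (norm_canonicalNoise_le e sub η μ W₀ hK hκ hν hPmin hp m)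

lemma integral_norm_canonicalNoise_pow_four_le (hK : 0 < K) (hκ : DataNoiseBound e f κ)
    (hν : 0 < ν) (hPmin : 0 < Pmin) (hp : ∀ m, Pmin ≤ p m) (m : ℕ) :
    ∫ ω, ‖canonicalNoise e sub f G ν η μ p W₀ m ω‖ ^ 4
      ∂(Measure.infinitePi fun _ : ℕ => roundLaw K M c G σ) ≤ envelopeMoment K M c G σ κ ν Pmin := by
  have := isProbabilityMeasure_roundLaw (M := M) (c := c) (G := G) (σ := σ) hK
  have hE := memLp_envelope_eval (M := M) (c := c) (κ := κ) (Pmin := Pmin) (ν := ν) (G := G)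
    (σ := σ) hK m
  have hE4 := integrable_norm_pow_of_memLp_four hE le_rfl
  calc ∫ ω, ‖canonicalNoise e sub f G ν η μ p W₀ m ω‖ ^ 4
        ∂(Measure.infinitePi fun _ : ℕ => roundLaw K M c G σ)
      ≤ ∫ ω, ‖noiseEnvelope K c κ ν Pmin (ω m)‖ ^ 4
        ∂(Measure.infinitePi fun _ : ℕ => roundLaw K M c G σ) := by
        refine integral_mono_ae (integrable_norm_pow_of_memLp_four
          (memLp_canonicalNoise e sub η μ W₀ hK hκ hν hPmin hp m) le_rfl) hE4 ?_
        filter_upwards [norm_canonicalNoise_le e sub η μ W₀ hK hκ hν hPmin hp m] with ω hω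
        have := hω.trans (le_abs_self _)
        rw [← Real.norm_eq_abs] at this
        gcongr
    _ = envelopeMoment K M c G σ κ ν Pmin := by
        have hmp := measurePreserving_eval_infinitePi (roundLaw K M c G σ) m
        have hmeas : AEStronglyMeasurable (fun x => noiseEnvelope K c κ ν Pmin x ^ 4)
            ((Measure.infinitePi fun _ : ℕ => roundLaw K M c G σ).map fun ω => ω m) := by
          rw [hmp.map_eq]
          exact (memLp_noiseEnvelope hK).1.pow 4
        have h := integral_map hmp.measurable.aemeasurable hmeas
        rw [hmp.map_eq] at h
        rw [envelopeMoment, h]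
        refine integral_congr_ae (.of_forall fun ω => ?_)
        simp only [Real.norm_eq_abs]
        exact Even.pow_abs (by decide) _

lemma measurable_inner_gradientNoise (q : ℝ) :
    Measurable fun y : (Mat D d × Mat D d) × ((Fin M → Fin K → ℂ) × (Fin c → ℂ)) =>
      inner ℝ y.1.1 (gradientNoise e sub f G ν η q y.2 y.1.2) := by
  have h := (measurable_gradientNoise e sub (f := f) (G := G) (ν := ν) (η := η) (p := q)).comp
    (measurable_snd.prodMk (measurable_snd.comp measurable_fst) :
      Measurable fun y : (Mat D d × Mat D d) × ((Fin M → Fin K → ℂ) × (Fin c → ℂ)) =>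
        (y.2, y.1.2))
  exact (measurable_fst.comp measurable_fst).inner h

lemma isNoisyDescent_canonicalState {B C β χ : ℝ} (hK : 0 < K)
    (hf : ∀ k, Differentiable ℝ (f k))
    (hF : IsRegularObjective (globalObjective f) B C β χ) (hβ : 0 ≤ β)
    (hκ : DataNoiseBound e f κ) (hν : 0 < ν) (hPmin : 0 < Pmin) (hp : ∀ m, Pmin ≤ p m)
    (hμ : 0 < μ) (hμ1 : μ ≤ 1) :
    IsNoisyDescent (globalObjective f) (gradient (globalObjective f)) B C β μ
      (envelopeMoment K M c G σ κ ν Pmin) W₀ (pastFiltration _)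
      (Measure.infinitePi fun _ : ℕ => roundLaw K M c G σ)
      (canonicalNoise e sub f G ν η μ p W₀) (canonicalState e sub f G ν η μ p W₀) where
  hasGradientAt := hF.hasGradientAt
  bounded := hF.bounded
  gradient_le := hF.gradient_bounded
  lipschitz := hF.smooth
  beta_nonneg := hβ
  step_pos := hμ
  step_le_one := hμ1
  start _ := rfl
  step := canonicalState_succ e sub f G ν η μ p W₀
  adapted m := (measurable_canonicalNoise e sub f G ν η μ p W₀ m).stronglyMeasurable
  memLp := memLp_canonicalNoise e sub η μ W₀ hK hκ hν hPmin hp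
  fourth_moment := integral_norm_canonicalNoise_pow_four_le e sub η μ W₀ hK hκ hν hPmin hp
  centred m φ hφ hint := by
    have := isProbabilityMeasure_roundLaw (M := M) (c := c) (G := G) (σ := σ) hK
    have hpast : Measurable[pastFiltration _ m]
        (fun ω => (φ ω, canonicalState e sub f G ν η μ p W₀ m ω)) :=
      hφ.measurable.prodMk (measurable_canonicalState e sub f G ν η μ p W₀ m)
    have hE := (integral_past_eval (roundLaw K M c G σ) hpast
      (measurable_inner_gradientNoise e sub η (p m)) hint).2
    refine (show ∫ ω, inner ℝ (φ ω) (canonicalNoise e sub f G ν η μ p W₀ m ω)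
      ∂(Measure.infinitePi fun _ : ℕ => roundLaw K M c G σ) = _ from hE).trans ?_
    simp only
    simp_rw [fun y : Mat D d × Mat D d => integral_inner_gradientNoise e sub (G := G) (σ := σ)
      (η := η) hK hf hν (hPmin.trans_le (hp m)) y.2 y.1]
    simp

/-- The bounds for a fixed iterate are uniform in it, so they survive integration against the law of
the current iterate. -/
lemma integral_inner_canonicalNoise_sq_mem_Icc (hK : 0 < K)
    (hf : ∀ k, Differentiable ℝ (f k)) (hκ : DataNoiseBound e f κ) (hν : 0 < ν)
    (hPmin : 0 < Pmin) (hp : ∀ m, Pmin ≤ p m) (m : ℕ) {u : Mat D d} (hu : ‖u‖ = 1) :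
    ∫ ω, inner ℝ u (canonicalNoise e sub f G ν η μ p W₀ m ω) ^ 2
        ∂(Measure.infinitePi fun _ : ℕ => roundLaw K M c G σ) ∈
      Set.Icc (invCardMoment K G * (ν ^ 2 * (σ : ℝ) ^ 2 / (2 * p m)))
        (invCardMoment K G * (K * κ ^ 2 + ν ^ 2 * (σ : ℝ) ^ 2 / (2 * p m))) := by
  have := isProbabilityMeasure_roundLaw (M := M) (c := c) (G := G) (σ := σ) hK
  have hpm : 0 < p m := hPmin.trans_le (hp m)
  have hL := memLp_canonicalNoise (G := G) (σ := σ) e sub η μ W₀ hK hκ hν hPmin hp m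
  have hint : Integrable (fun ω => inner ℝ u (canonicalNoise e sub f G ν η μ p W₀ m ω) ^ 2)
      (Measure.infinitePi fun _ : ℕ => roundLaw K M c G σ) := by
    refine integrable_of_abs_le_norm_pow_mul hL hL (i := 2) (j := 0) (by norm_num)
      ((aestronglyMeasurable_const.inner hL.1).pow 2) (c := ‖u‖ ^ 2) fun ω => ?_
    rw [abs_pow, pow_zero, mul_one, ← mul_pow]
    exact pow_le_pow_left₀ (abs_nonneg _) (abs_real_inner_le_norm _ _) 2
  have hΨ : Measurable fun y : Mat D d × ((Fin M → Fin K → ℂ) × (Fin c → ℂ)) =>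
      inner ℝ u (gradientNoise e sub f G ν η (p m) y.2 y.1) ^ 2 :=
    ((measurable_inner_gradientNoise e sub η (p m)).comp
      ((measurable_const.prodMk measurable_fst).prodMk measurable_snd :
        Measurable fun y : Mat D d × ((Fin M → Fin K → ℂ) × (Fin c → ℂ)) =>
          ((u, y.1), y.2))).pow_const 2
  obtain ⟨hI, hE⟩ := integral_past_eval (roundLaw K M c G σ)
    (measurable_canonicalState e sub f G ν η μ p W₀ m) hΨ hint
  have hmeas : Measurable (canonicalState e sub f G ν η μ p W₀ m) :=
    (measurable_canonicalState e sub f G ν η μ p W₀ m).mono ((pastFiltration _).le _) le_rfl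
  have := Measure.isProbabilityMeasure_map
    (μ := Measure.infinitePi fun _ : ℕ => roundLaw K M c G σ) hmeas.aemeasurable
  have hI' := hI.integral_prod_left
  have hE' : ∫ ω, inner ℝ u (canonicalNoise e sub f G ν η μ p W₀ m ω) ^ 2
        ∂(Measure.infinitePi fun _ : ℕ => roundLaw K M c G σ) = _ := hE
  rw [hE']
  constructor
  · have h1 := integral_mono (integrable_const _) hI' fun W =>
      le_integral_inner_gradientNoise_sq (G := G) (σ := σ) (η := η) e sub hK hf hν hpm W hu
    simpa using h1
  · have h1 := integral_mono hI' (integrable_const _) fun W =>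
      integral_inner_gradientNoise_sq_le (G := G) (σ := σ) (η := η) e sub hK hf hκ hν hpm W hu
    simpa using h1

end CanonicalProcess

/-! ### Choice of the step threshold and assembly on the canonical space -/

section Descent

variable {D d c K M : ℕ} {B C β χ ε γ G κ ν : ℝ} {σ : ℝ≥0} {Pmin Pmax T : ℝ}

/-- The displacement constant of the iterates: as soon as the expected displacement exceeds it, the
descent lemma alone gives the claimed error reduction. -/
noncomputable def saddleDisplacementConst (K M c : ℕ) (β γ G κ ν : ℝ) (σ : ℝ≥0)
    (Pmin Pmax T : ℝ) : ℝ :=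
  displacementConst β (envelopeMoment K M c G σ κ ν Pmin) T
    (Real.log (escapeFactor K c (activationProb G) κ ν σ Pmin Pmax) / (2 * γ))
    ((Vmax K (activationProb G) κ ν σ Pmin
      + γ * T * Real.exp (2 * γ * T) * (ν ^ 2 * (σ : ℝ) ^ 2 / Pmin)) / 4)

/-- The constant of the `μ ^ (3 / 2)` error term. -/
noncomputable def stepErrorConst (K M c : ℕ) (β χ γ G κ ν : ℝ) (σ : ℝ≥0)
    (Pmin Pmax T : ℝ) : ℝ :=
  |remainderConst (2 * c) β χ T (saddleDisplacementConst K M c β γ G κ ν σ Pmin Pmax T)|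
    + |discretizationConst K c (activationProb G) κ ν σ Pmin Pmax γ β|

/-- A bound on the step size under which the error terms are negligible. -/
noncomputable def stepThreshold (K M c : ℕ) (β χ γ G κ ν : ℝ) (σ : ℝ≥0)
    (Pmin Pmax T : ℝ) : ℝ :=
  min (min 1 (1 / (2 * β)))
    ((Vmax K (activationProb G) κ ν σ Pmin
      / (4 * (stepErrorConst K M c β χ γ G κ ν σ Pmin Pmax T + 1))) ^ 2)

lemma stepErrorConst_nonneg : 0 ≤ stepErrorConst K M c β χ γ G κ ν σ Pmin Pmax T := by
  unfold stepErrorConst; positivity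

lemma stepThreshold_pos (hβ : 0 < β) (hV : 0 < Vmax K (activationProb G) κ ν σ Pmin) :
    0 < stepThreshold K M c β χ γ G κ ν σ Pmin Pmax T := by
  have := stepErrorConst_nonneg (K := K) (M := M) (c := c) (β := β) (χ := χ) (γ := γ) (G := G)
    (κ := κ) (ν := ν) (σ := σ) (Pmin := Pmin) (Pmax := Pmax) (T := T)
  unfold stepThreshold
  positivity

/-- Since τ ≤ 1, both errors are at most multiples of τ³ = μτ, and the hypothesis says that τ is
small against V. -/
lemma error_terms_le {μ τ V r s : ℝ} (hμ1 : μ ≤ 1) (hτ : 0 < τ) (hτμ : τ ^ 2 = μ) (hV : 0 < V)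
    (h : μ ≤ (V / (4 * (|r| + |s| + 1))) ^ 2) :
    r * τ ^ 3 + s * μ ^ 2 ≤ μ / 4 * V := by
  have hE : 0 < |r| + |s| + 1 := by positivity
  have hτ1 : τ ≤ 1 := by nlinarith
  have h1 : τ ≤ V / (4 * (|r| + |s| + 1)) :=
    (pow_le_pow_iff_left₀ hτ.le (by positivity) two_ne_zero).1 (by rwa [hτμ])
  rw [le_div_iff₀ (by positivity)] at h1
  have h2 : r * τ ^ 3 ≤ |r| * τ ^ 3 := by gcongr; exact le_abs_self r
  have h3 : s * τ ^ 4 ≤ |s| * τ ^ 3 :=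
    (mul_le_mul_of_nonneg_right (le_abs_self s) (by positivity)).trans
      (mul_le_mul_of_nonneg_left (pow_le_pow_of_le_one hτ.le hτ1 (by norm_num)) (abs_nonneg s))
  have h4 : τ ^ 2 * (τ * (4 * (|r| + |s| + 1))) ≤ τ ^ 2 * V :=
    mul_le_mul_of_nonneg_left h1 (by positivity)
  have h5 : 0 < τ ^ 3 := by positivity
  rw [← hτμ]
  nlinarith

variable (e : Fin D × Fin d ≃ Fin c × Fin 2) (sub : Fin c → Fin M) (η : ℂ)
  {f : Fin K → Mat D d → ℝ} {W₀ : Mat D d} {μ : ℝ} {p : ℕ → ℝ} {n : ℕ}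

lemma card_eq_two_mul (e : Fin D × Fin d ≃ Fin c × Fin 2) :
    Fintype.card (Fin (Module.finrank ℝ (Mat D d))) = 2 * c := by
  rw [Fintype.card_fin, finrank_euclideanSpace, Fintype.card_congr e]
  simp [mul_comm]

lemma integral_objective_canonicalState_le (hK : 0 < K) (hβ : 0 < β) (hχ : 0 < χ) (hγ : 0 < γ)
    (hν : 0 < ν) (hσ : 0 < σ) (hPmin : 0 < Pmin) (hP : Pmin ≤ Pmax) (hc : 0 < c)
    (hf : ∀ k, Differentiable ℝ (f k))
    (hF : IsRegularObjective (globalObjective f) B C β χ) (hκ : DataNoiseBound e f κ)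
    (hW₀ : hessianMinEigenvalue (globalObjective f) W₀ ≤ -γ) (hμ : 0 < μ)
    (hμδ : μ ≤ stepThreshold K M c β χ γ G κ ν σ Pmin Pmax T)
    (hn : Nmax K c (activationProb G) κ ν σ Pmin Pmax γ μ < n) (hT : n * μ ≤ T)
    (hp : ∀ m, p m ∈ Set.Icc Pmin Pmax) :
    ∫ ω, globalObjective f (canonicalState e sub f G ν η μ p W₀ n ω)
        ∂(Measure.infinitePi fun _ : ℕ => roundLaw K M c G σ) ≤
      globalObjective f W₀
        - reductionBound K c (activationProb G) κ ν σ Pmin Pmax γ μ p n := by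
  have := isProbabilityMeasure_roundLaw (M := M) (c := c) (G := G) (σ := σ) hK
  have hσ' : (0 : ℝ) < σ := hσ
  have hζ := activationProb_pos G
  have hPmax := hPmin.trans_le hP
  have hV := Vmax_pos (κ := κ) hK hν hσ' hPmin hζ
  have hμ1 : μ ≤ 1 := hμδ.trans ((min_le_left _ _).trans (min_le_left _ _))
  have hβμ : β * μ ≤ 1 / 2 := by
    have h1 : μ ≤ 1 / (2 * β) := hμδ.trans ((min_le_left _ _).trans (min_le_right _ _))
    rw [le_div_iff₀ (by positivity)] at h1
    linarith
  have hL := one_lt_escapeFactor (κ := κ) hK hν hσ' hPmin hPmax hζ hc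
  have hT₀ : 0 < Real.log (escapeFactor K c (activationProb G) κ ν σ Pmin Pmax) / (2 * γ) := by
    have := Real.log_pos hL
    positivity
  -- N_max · μ = log L/(2γ), so n > N_max supplies the lower bound on the elapsed time.
  have hn₀ : Real.log (escapeFactor K c (activationProb G) κ ν σ Pmin Pmax) / (2 * γ)
      ≤ n * μ := by
    have h1 := mul_le_mul_of_nonneg_right hn.le hμ.le
    refine (le_of_eq ?_).trans h1
    rw [Nmax, escapeFactor]
    field_simp
  have hT0 : 0 ≤ T := hT₀.le.trans (hn₀.trans hT)
  have h := isNoisyDescent_canonicalState (G := G) (σ := σ) e sub η μ W₀ hK hf hF hβ.le hκ hν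
    hPmin (fun m => (hp m).1) hμ hμ1
  rcases h.descent_or_displacement_le hβμ hT₀ (R := (Vmax K (activationProb G) κ ν σ Pmin
      + γ * T * Real.exp (2 * γ * T) * (ν ^ 2 * (σ : ℝ) ^ 2 / Pmin)) / 4) (by positivity) hT hn₀
    with h1 | ⟨hg, hA⟩
  · have h2 := reductionBound_le (c := c) (κ := κ) (Pmax := Pmax) hK hν hσ' hPmin hPmax hζ hγ hμ
      hT fun m _ => (hp m).1
    linarith
  · obtain ⟨u, l, hu, hl, i₀, hi₀⟩ := exists_eigenvector_basis hF hβ.le hγ hW₀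
    have hτ := Real.sqrt_pos.2 hμ
    have hτμ := Real.sq_sqrt hμ.le
    have hA₀ : 0 ≤ saddleDisplacementConst K M c β γ G κ ν σ Pmin Pmax T := by
      have h1 := (sq_nonneg _).trans hg
      exact nonneg_of_mul_nonneg_left h1 hμ
    have h1 := h.integral_objective_le_sum_eigenvalues u hχ.le (hF.inner_hessian_symm W₀)
      (hF.taylor hχ.le W₀) hl hu hβμ hT hτ hτμ hA₀ hg hA
    have hm := fun i m => integral_inner_canonicalNoise_sq_mem_Icc (G := G) (σ := σ) e sub η μ W₀
      hK hf hκ hν hPmin (fun m => (hp m).1) m (u.orthonormal.1 i)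
    have h2 := sum_eigenvalues_le_neg_reductionBound (card_eq_two_mul e) hK hν hσ' hPmin hP hζ
      (activationProb_le_one G) hγ hμ hβ.le hβμ (one_le_invCardMoment_mul hK)
      (invCardMoment_le_one hK) (fun i => (le_abs_self _).trans (hl i)) hi₀ (fun m _ => hp m)
      (fun i m _ => (hm i m).1) (fun i m _ => (hm i m).2) hn
    rw [card_eq_two_mul e] at h1
    have h3 := error_terms_le hμ1 hτ hτμ hV (hμδ.trans (min_le_right _ _))
    linarith

end Descent

/-- Transfers expectations from an arbitrary probability space to the canonical one. -/
lemma hasLaw_rounds {K M c : ℕ} {G : ℝ} {σ : ℝ≥0} (hK : 0 < K) {Ω : Type*} [MeasurableSpace Ω]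
    {P : Measure Ω} [IsProbabilityMeasure P]
    {H : ℕ → Ω → Fin M → Fin K → ℂ} {Z : ℕ → Ω → Fin c → ℂ}
    (hlaw : ∀ m, HasLaw (fun ω => (H m ω, Z m ω)) (roundLaw K M c G σ) P)
    (hind : iIndepFun (fun m ω => (H m ω, Z m ω)) P) :
    HasLaw (fun ω m => (H m ω, Z m ω)) (Measure.infinitePi fun _ : ℕ => roundLaw K M c G σ) P :=
  have := isProbabilityMeasure_roundLaw (M := M) (c := c) (G := G) (σ := σ) hK
  iIndepFun.hasLaw_infinitePi hlaw hind (aemeasurable_pi_iff.2 fun m => (hlaw m).aemeasurable)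

end AirPCA

theorem theorem2 (D d c K M : ℕ) (hK : 0 < K)
    (B C β χ ε γ : ℝ) (hβ : 0 < β) (hχ : 0 < χ) (hε : 0 < ε) (hγ : 0 < γ)
    (G κ ν : ℝ) (σ : ℝ≥0) (hG : 0 ≤ G) (hν : 0 < ν) (hσ : 0 < σ)
    (Pmin Pmax : ℝ) (hPmin : 0 < Pmin) (hP : Pmin ≤ Pmax) (T : ℝ) :
    ∃ δ : ℝ, 0 < δ ∧
      ∀ (e : Fin D × Fin d ≃ Fin c × Fin 2) (sub : Fin c → Fin M) (η : ℂ)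
        (f : Fin K → AirPCA.Mat D d → ℝ),
        (∀ k, Differentiable ℝ (f k)) →
        AirPCA.IsRegularObjective (AirPCA.globalObjective f) B C β χ →
        AirPCA.DataNoiseBound e f κ →
      ∀ W₀ ∈ AirPCA.saddleRegion (AirPCA.globalObjective f) ε γ,
      ∀ μ : ℝ, 0 < μ →
        μ ≤ δ / (c * AirPCA.Vmax K (AirPCA.activationProb G) κ ν σ Pmin) →
      ∀ n : ℕ, AirPCA.Nmax K c (AirPCA.activationProb G) κ ν σ Pmin Pmax γ μ < n →
        n * μ ≤ T →
      ∀ p : ℕ → ℝ, (∀ m < n, p m ∈ Set.Icc Pmin Pmax) →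
      ∀ (Ω : Type*) [MeasurableSpace Ω] (P : Measure Ω) [IsProbabilityMeasure P]
        (H : ℕ → Ω → Fin M → Fin K → ℂ) (Z : ℕ → Ω → Fin c → ℂ),
        (∀ m, HasLaw (fun ω => (H m ω, Z m ω)) (AirPCA.roundLaw K M c G σ) P) →
        iIndepFun (fun m ω => (H m ω, Z m ω)) P →
        let W : ℕ → Ω → AirPCA.Mat D d := fun m ω =>
          AirPCA.state e sub f G ν η μ p W₀ (fun j => H j ω) (fun j => Z j ω) m
        Integrable (fun ω =>
          AirPCA.globalObjective f (W 0 ω) - AirPCA.globalObjective f (W n ω)) P ∧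
        AirPCA.reductionBound K c (AirPCA.activationProb G) κ ν σ Pmin Pmax γ μ p n ≤
          ∫ ω, (AirPCA.globalObjective f (W 0 ω) - AirPCA.globalObjective f (W n ω)) ∂P := by
  have hζ := AirPCA.activationProb_pos G
  have hσ' : (0 : ℝ) < σ := hσ
  have hV := AirPCA.Vmax_pos (κ := κ) hK hν hσ' hPmin hζ
  have hδ := AirPCA.stepThreshold_pos (M := M) (c := c) (χ := χ) (γ := γ) (Pmax := Pmax) (T := T)
    hβ hV
  -- The factor c · V_max cancels the denominator in the step-size condition. The extra 1 only keeps
  -- δ positive when c = 0, a case in which division by zero reads μ ≤ 0.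
  refine ⟨(c * AirPCA.Vmax K (AirPCA.activationProb G) κ ν σ Pmin + if c = 0 then 1 else 0)
    * AirPCA.stepThreshold K M c β χ γ G κ ν σ Pmin Pmax T, ?_, ?_⟩
  · refine mul_pos ?_ hδ
    rcases Nat.eq_zero_or_pos c with rfl | hc
    · simp
    · have : (0 : ℝ) < c := by exact_mod_cast hc
      have : (0 : ℝ) ≤ if c = 0 then 1 else 0 := by split_ifs <;> norm_num
      positivity
  intro e sub η f hf hF hκ W₀ hW₀ μ hμ hμδ n hn hT p hp Ω _ P _ H Z hlaw hind
  have hc : 0 < c := by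
    rcases Nat.eq_zero_or_pos c with rfl | hc
    · simp at hμδ
      exact absurd hμ hμδ.not_gt
    · exact hc
  have hc' : (0 : ℝ) < c := by exact_mod_cast hc
  rw [if_neg hc.ne', add_zero, mul_div_cancel_left₀ _ (by positivity)] at hμδ
  -- The powers are constrained only before round n. Later ones are reset so that the noise bounds
  -- hold in every round; neither the n-th iterate nor the bound changes.
  let p' : ℕ → ℝ := fun m => if m < n then p m else Pmin
  have hpp : ∀ m < n, p m = p' m := fun m hm => (if_pos hm).symm
  have hp' : ∀ m, p' m ∈ Set.Icc Pmin Pmax := fun m => by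
    by_cases hm : m < n
    · simpa only [p', if_pos hm] using hp m hm
    · simpa only [p', if_neg hm] using Set.left_mem_Icc.2 hP
  have hX := AirPCA.hasLaw_rounds hK hlaw hind
  have hpr := AirPCA.isProbabilityMeasure_roundLaw (M := M) (c := c) (G := G) (σ := σ) hK
  have hmeas : Measurable fun ω => AirPCA.globalObjective f
      (AirPCA.canonicalState e sub f G ν η μ p' W₀ n ω) :=
    hF.contDiff.continuous.measurable.comp
      ((AirPCA.measurable_canonicalState e sub f G ν η μ p' W₀ n).mono
        ((AirPCA.pastFiltration _).le _) le_rfl)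
  have hint : Integrable (fun ω => AirPCA.globalObjective f
      (AirPCA.state e sub f G ν η μ p W₀ (fun j => H j ω) (fun j => Z j ω) n)) P := by
    simp_rw [AirPCA.state_congr e sub f G ν η μ W₀ _ _ hpp]
    exact Integrable.of_bound (hmeas.comp_aemeasurable hX.aemeasurable).aestronglyMeasurable B
      (.of_forall fun ω => hF.bounded _)
  have hle := AirPCA.integral_objective_canonicalState_le e sub η hK hβ hχ hγ hν hσ hPmin hP hc hf
    hF hκ hW₀.2 hμ hμδ hn hT hp'
  rw [← hX.integral_comp hmeas.aestronglyMeasurable] at hle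
  have heq : AirPCA.reductionBound K c (AirPCA.activationProb G) κ ν σ Pmin Pmax γ μ p n
      = AirPCA.reductionBound K c (AirPCA.activationProb G) κ ν σ Pmin Pmax γ μ p' n := by
    have hN := AirPCA.floor_sub_Nmax_le (c := c) (κ := κ) (Pmax := Pmax) hK hν hσ' hPmin
      (hPmin.trans_le hP) hζ hγ hμ n
    unfold AirPCA.reductionBound
    congr 4
    refine Finset.sum_congr rfl fun m hm => ?_
    rw [hpp m ((Finset.mem_range.1 hm).trans_le hN)]
  refine ⟨(integrable_const (AirPCA.globalObjective f W₀)).sub hint, ?_⟩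
  have hsub : ∫ ω, (AirPCA.globalObjective f W₀ - AirPCA.globalObjective f
      (AirPCA.state e sub f G ν η μ p W₀ (fun j => H j ω) (fun j => Z j ω) n)) ∂P = _ :=
    integral_sub (integrable_const _) hint
  simp_rw [AirPCA.state_congr e sub f G ν η μ W₀ _ _ hpp] at hsub
  simp_rw [AirPCA.state_congr e sub f G ν η μ W₀ _ _ hpp]
  refine le_of_le_of_eq ?_ hsub.symm
  rw [heq, integral_const, probReal_univ, one_smul]
  exact le_sub_comm.1 hle
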